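/- Let $\mathcal{S}$ be a theory in classical first-order logic with equality whose countable language $L$ extends $\{0,S,+,\cdot\}$, whose symbols and nonlogical axioms are given (through Gödel numbers) by fixed arithmetical formulas, and which proves every axiom of Peano arithmetic. Let $\prec$ be a strict total ordering of $\mathbb{N}$ represented in Peano arithmetic by an arithmetical formula, also written $x\prec y$, which $\mathcal{S}$ proves to be a strict total ordering. For $a\in\mathbb{N}$ let $L_a$ be $L$ augmented by unary predicate symbols $T_b$ for all $b\prec a$, and let $L_{a+1}$ be $L$ augmented by $T_b$ for all $b\preceq a$. The deduction rules are modus ponens, generalization, and the usual logical axioms (as rules without premises). For each $a$ let $\mathcal{S}_a$ be the formal system with language $L_{a+1}$ whose nonlogical axioms are the nonlogical axioms of $\mathcal{S}$, the induction axioms for all formulas of $L_{a+1}$, and the following, where $\hat n$ is the numeral $S\cdots S0$ of $n$, $\ulcorner A\urcorner$ is (the numeral of) the Gödel number of $A$, $\overline{A}$ is the universal closure of $A$, and statements about formulas are expressed arithmetically through Gödel numbers: 1. the sentence "$T_a(\ulcorner A\urcorner)$ for all nonlogical axioms $A$ of $\mathcal{S}$"; 2. the sentence "$T_a(\ulcorner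 A\urcorner)\wedge T_a(\ulcorner B\urcorner)\to T_a(\ulcorner C\urcorner)$ for all $A,B,C\in L_a$ such that some deduction rule infers $C$ from $A$ and $B$"; 3. the sentence "$T_a$ holds of every induction axiom for formulas of $L_a$"; 4. the sentence "$(\forall n)\,T_a(\ulcorner A(\hat n)\urcorner)\leftrightarrow T_a(\ulcorner(\forall n)A(n)\urcorner)$ for every formula $A$ of $L_a$ with exactly one free variable"; 5. for every formula $A$ of $L_a$, the sentence $\overline{A}\leftrightarrow T_a(\ulcorner A\urcorner)$; 6. the sentence "for all $b\prec \hat a$ and every $A\in L_b$, $T_a(\ulcorner\,\overline{A}\leftrightarrow T_b(\ulcorner A\urcorner)\,\urcorner)$"; 7. for each $b\prec a$, the sentence "$T_b(\ulcorner A\urcorner)\leftrightarrow T_a(\ulcorner A\urcorner)$ for all $A\in L_b$". Let $\mathrm{Thm}_b(x)$ be the arithmetical formula expressing that $x$ is the Gödel number of the last formula of a finite sequence of formulas of $L_{b+1}$, each of which is an axiom of $\mathcal{S}_b$ or a logical axiom, or is inferred from earlier ones by modus ponens or generalization. **Proposition.** For all $a,b\in\mathbb{N}$ with $b\prec a$,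 it is a theorem of $\mathcal{S}_a$ that every theorem of $\mathcal{S}_b$ is true, i.e. $$\mathcal{S}_a\vdash(\forall x)\bigl(\mathrm{Thm}_b(x)\to T_a(x)\bigr).$$ -/

import Mathlib

/-!  Iterated truth theories over an arithmetical first-order theory: syntax, derivability,
     arithmetized syntax, and the theories of the hierarchy. -/

namespace IteratedTruth

/-! ### First-order syntax

All the languages considered are sublanguages of one big countable language: the arithmetical
symbols, further function symbols `fn k i` and predicate symbols `rel k i` (arity `k`, number `i`),
and the unary truth predicates `tr a`.  Variables are `v_0, v_1, ...` . -/

/-- Terms. -/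
inductive Tm : Type
  | var (v : ℕ) : Tm
  | zero : Tm
  | succ (t : Tm) : Tm
  | add (t u : Tm) : Tm
  | mul (t u : Tm) : Tm
  | fn (k i : ℕ) (ts : Fin k → Tm) : Tm

/-- Formulas of classical first-order logic with equality; `tr a t` is `T_a(t)`. -/
inductive Fm : Type
  | bot : Fm
  | eq (t u : Tm) : Fm
  | rel (k i : ℕ) (ts : Fin k → Tm) : Fm
  | tr (a : ℕ) (t : Tm) : Fm
  | imp (A B : Fm) : Fm
  | all (v : ℕ) (A : Fm) : Fm

/-- The canonical constant term evaluating to `n`. -/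
def num : ℕ → Tm
  | 0 => Tm.zero
  | n + 1 => Tm.succ (num n)

namespace Tm

/-- The variable `v` occurs in the term. -/
def Occ (v : ℕ) : Tm → Prop
  | var w => w = v
  | zero => False
  | succ t => t.Occ v
  | add t u => t.Occ v ∨ u.Occ v
  | mul t u => t.Occ v ∨ u.Occ v
  | fn _ _ ts => ∃ j, (ts j).Occ v

/-- `t.subst v s` replaces every occurrence of `v` in `t` by `s`. -/
def subst : Tm → ℕ → Tm → Tm
  | var w, v, s => if w = v then s else var w
  | zero, _, _ => zero
  | succ t, v, s => succ (t.subst v s)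
  | add t u, v, s => add (t.subst v s) (u.subst v s)
  | mul t u, v, s => mul (t.subst v s) (u.subst v s)
  | fn k i ts, v, s => fn k i (fun j => (ts j).subst v s)

/-- Rename every variable `v_i` to `v_(i+d)`. -/
def shift (d : ℕ) : Tm → Tm
  | var w => var (w + d)
  | zero => zero
  | succ t => succ (t.shift d)
  | add t u => add (t.shift d) (u.shift d)
  | mul t u => mul (t.shift d) (u.shift d)
  | fn k i ts => fn k i (fun j => (ts j).shift d)

end Tm

/-- Code of a list of codes. -/
def codeList : List ℕ → ℕ
  | [] => Nat.pair 6 0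
  | x :: l => Nat.pair 7 (Nat.pair x (codeList l))

/-- Gödel number of a term. -/
def Tm.code : Tm → ℕ
  | .var v => Nat.pair 0 v
  | .zero => Nat.pair 1 0
  | .succ t => Nat.pair 2 t.code
  | .add t u => Nat.pair 3 (Nat.pair t.code u.code)
  | .mul t u => Nat.pair 4 (Nat.pair t.code u.code)
  | .fn k i ts => Nat.pair 5 (Nat.pair (Nat.pair k i) (codeList (List.ofFn fun j => (ts j).code)))

namespace Fm

/-- Gödel number of a formula. -/
def code : Fm → ℕ
  | bot => Nat.pair 8 0
  | eq t u => Nat.pair 9 (Nat.pair t.code u.code)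
  | rel k i ts => Nat.pair 10 (Nat.pair (Nat.pair k i) (codeList (List.ofFn fun j => (ts j).code)))
  | tr a t => Nat.pair 11 (Nat.pair a t.code)
  | imp A B => Nat.pair 12 (Nat.pair A.code B.code)
  | all v A => Nat.pair 13 (Nat.pair v A.code)

def not (A : Fm) : Fm := imp A bot
def and (A B : Fm) : Fm := not (imp A (not B))
def or (A B : Fm) : Fm := imp (not A) B
def iff (A B : Fm) : Fm := and (imp A B) (imp B A)
def ex (v : ℕ) (A : Fm) : Fm := not (all v (not A))

/-- The variable `v` occurs free in the formula. -/
def Free (v : ℕ) : Fm → Prop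
  | bot => False
  | eq t u => t.Occ v ∨ u.Occ v
  | rel _ _ ts => ∃ j, (ts j).Occ v
  | tr _ t => t.Occ v
  | imp A B => A.Free v ∨ B.Free v
  | all w A => w ≠ v ∧ A.Free v

/-- Replace every free occurrence of `v` by `s`. -/
def subst (v : ℕ) (s : Tm) : Fm → Fm
  | bot => bot
  | eq t u => eq (t.subst v s) (u.subst v s)
  | rel k i ts => rel k i (fun j => (ts j).subst v s)
  | tr a t => tr a (t.subst v s)
  | imp A B => imp (A.subst v s) (B.subst v s)
  | all w A => if w = v then all w A else all w (A.subst v s)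

/-- The term `s` is free for `v` in the formula (substituting it leads to no capture). -/
def FreeFor (v : ℕ) (s : Tm) : Fm → Prop
  | bot => True
  | eq _ _ => True
  | rel _ _ _ => True
  | tr _ _ => True
  | imp A B => A.FreeFor v s ∧ B.FreeFor v s
  | all w A => w = v ∨ (A.FreeFor v s ∧ (s.Occ w → ¬ A.Free v))

/-- Rename every variable `v_i`, free or bound, to `v_(i+d)`. -/
def shift (d : ℕ) : Fm → Fm
  | bot => bot
  | eq t u => eq (t.shift d) (u.shift d)
  | rel k i ts => rel k i (fun j => (ts j).shift d)
  | tr a t => tr a (t.shift d)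
  | imp A B => imp (A.shift d) (B.shift d)
  | all w A => all (w + d) (A.shift d)

def Sentence (A : Fm) : Prop := ∀ v, ¬ A.Free v

/-- `A.Prefixed B`: `B` arises from `A` by successively quantifying free variables universally. -/
inductive Prefixed (A : Fm) : Fm → Prop
  | refl : Prefixed A A
  | all {B : Fm} {v : ℕ} : Prefixed A B → B.Free v → Prefixed A (Fm.all v B)

/-- `B` is a universal closure of `A` (the order of the quantifiers being immaterial). -/
def IsUnivClosure (A B : Fm) : Prop := A.Prefixed B ∧ B.Sentence

/-- The induction axiom `(A(0) ∧ ∀ v (A(v) → A(v+1))) → ∀ v A(v)`. -/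
def ind (v : ℕ) (A : Fm) : Fm :=
  imp (and (A.subst v Tm.zero) (all v (imp A (A.subst v (Tm.succ (Tm.var v)))))) (all v A)

end Fm

/-! ### Languages and derivability -/

/-- A language: which of the non-arithmetical symbols it has. -/
structure Lang where
  fn : ℕ → ℕ → Prop
  rel : ℕ → ℕ → Prop
  tr : ℕ → Prop

/-- The language `0, S, +, ·` of Peano arithmetic. -/
def Lang.arith : Lang := ⟨fun _ _ => False, fun _ _ => False, fun _ => False⟩

/-- The term belongs to the language. -/
def Tm.In (L : Lang) : Tm → Prop
  | .var _ => True
  | .zero => True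
  | .succ t => t.In L
  | .add t u => t.In L ∧ u.In L
  | .mul t u => t.In L ∧ u.In L
  | .fn k i ts => L.fn k i ∧ ∀ j, (ts j).In L

/-- The formula belongs to the language. -/
def Fm.In (L : Lang) : Fm → Prop
  | .bot => True
  | .eq t u => t.In L ∧ u.In L
  | .rel k i ts => L.rel k i ∧ ∀ j, (ts j).In L
  | .tr a t => L.tr a ∧ t.In L
  | .imp A B => A.In L ∧ B.In L
  | .all _ A => A.In L

/-- The logical axioms of classical first-order logic with equality
(deduction rules without premises). -/
inductive LogAx (L : Lang) : Fm → Prop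
  | k (A B : Fm) : LogAx L (A.imp (B.imp A))
  | s (A B C : Fm) : LogAx L ((A.imp (B.imp C)).imp ((A.imp B).imp (A.imp C)))
  | dne (A : Fm) : LogAx L (A.not.not.imp A)
  | inst (v : ℕ) (t : Tm) (A : Fm) : t.In L → A.FreeFor v t →
      LogAx L ((Fm.all v A).imp (A.subst v t))
  | dist (v : ℕ) (A B : Fm) : ¬ A.Free v →
      LogAx L ((Fm.all v (A.imp B)).imp (A.imp (Fm.all v B)))
  | refl (t : Tm) : LogAx L (Fm.eq t t)
  | leibniz (v : ℕ) (t u : Tm) (A : Fm) : A.In L → A.FreeFor v t → A.FreeFor v u →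
      LogAx L ((Fm.eq t u).imp ((A.subst v t).imp (A.subst v u)))

/-- `Provable L Γ A`: the formula `A` is a theorem of the formal system with language `L` and
nonlogical axioms `Γ`.  The deduction rules are modus ponens and generalization. -/
inductive Provable (L : Lang) (Γ : Set Fm) : Fm → Prop
  | ax {A : Fm} : A ∈ Γ → A.In L → Provable L Γ A
  | log {A : Fm} : LogAx L A → A.In L → Provable L Γ A
  | mp {A B : Fm} : Provable L Γ A → Provable L Γ (A.imp B) → Provable L Γ B
  | gen {A : Fm} (v : ℕ) : Provable L Γ A → Provable L Γ (Fm.all v A)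

/-- The axioms of Peano arithmetic. -/
inductive PA : Set Fm
  | succ_ne : PA (.all 0 (Fm.not (.eq (.succ (.var 0)) .zero)))
  | succ_inj : PA (.all 0 (.all 1
      (.imp (.eq (.succ (.var 0)) (.succ (.var 1))) (.eq (.var 0) (.var 1)))))
  | add_zero : PA (.all 0 (.eq (.add (.var 0) .zero) (.var 0)))
  | add_succ : PA (.all 0 (.all 1
      (.eq (.add (.var 0) (.succ (.var 1))) (.succ (.add (.var 0) (.var 1))))))
  | mul_zero : PA (.all 0 (.eq (.mul (.var 0) .zero) .zero))
  | mul_succ : PA (.all 0 (.all 1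
      (.eq (.mul (.var 0) (.succ (.var 1))) (.add (.mul (.var 0) (.var 1)) (.var 0)))))
  | ind (v : ℕ) (A : Fm) : A.In Lang.arith → PA (Fm.ind v A)

/-- Value of an arithmetical term in the standard model
(the value of the other terms is irrelevant). -/
def Tm.val (r : ℕ → ℕ) : Tm → ℕ
  | .var v => r v
  | .zero => 0
  | .succ t => t.val r + 1
  | .add t u => t.val r + u.val r
  | .mul t u => t.val r * u.val r
  | .fn _ _ _ => 0

/-- Satisfaction of an arithmetical formula in the standard model
(for the other formulas it is irrelevant). -/
def Fm.Sat (r : ℕ → ℕ) : Fm → Prop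
  | .bot => False
  | .eq t u => t.val r = u.val r
  | .rel _ _ _ => False
  | .tr _ _ => False
  | .imp A B => A.Sat r → B.Sat r
  | .all v A => ∀ n, A.Sat (Function.update r v n)

/-- An arithmetical formula whose free variables are among `v_0, ..., v_(n-1)`. -/
structure ArithFm (n : ℕ) where
  fm : Fm
  arith : fm.In Lang.arith
  free : ∀ v, fm.Free v → v < n

/-- A first-order theory whose language extends that of arithmetic, given by arithmetical
formulas defining its further function symbols, its further predicate symbols, and (the Gödel
numbers of) its nonlogical axioms.  Every recursively axiomatized theory in a recursive language
can be so given, e.g. with `ax(x)` expressing that `x` is a value of a primitive recursive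
enumeration of the axioms. -/
structure Thy where
  funSym : ArithFm 2
  relSym : ArithFm 2
  ax : ArithFm 1

namespace Thy

/-- The language of the theory, augmented by the predicates `T_b` with `b` satisfying `D`. -/
def lang (S : Thy) (D : ℕ → Prop) : Lang where
  fn k i := S.funSym.fm.Sat fun j => if j = 0 then k else i
  rel k i := S.relSym.fm.Sat fun j => if j = 0 then k else i
  tr := D

/-- The language of the theory. -/
def lang₀ (S : Thy) : Lang := S.lang fun _ => False

/-- The nonlogical axioms of the theory. -/
def axioms (S : Thy) : Set Fm := {A | A.In S.lang₀ ∧ S.ax.fm.Sat fun _ => A.code}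

/-- The formula is a theorem of the theory. -/
def Proves (S : Thy) (A : Fm) : Prop := Provable S.lang₀ S.axioms A

/-- The theory extends Peano arithmetic. -/
def ExtendsPA (S : Thy) : Prop := ∀ A ∈ PA, S.Proves A

end Thy

/-! ### Writing formulas

`Bld` is the type of formulas under construction: the argument is a number `d` such that the
variables `v_d, v_(d+1), ...` are fresh.  Quantifiers take a Lean function from terms to `Bld`;
they bind `v_d`, pass it to the function, and go on with `d + 1`. -/

abbrev Bld : Type := ℕ → Fm

namespace Bld

def all (f : Tm → Bld) : Bld := fun d => Fm.all d (f (Tm.var d) (d + 1))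
def ex (f : Tm → Bld) : Bld := fun d => Fm.ex d (f (Tm.var d) (d + 1))
def eq (t u : Tm) : Bld := fun _ => Fm.eq t u
def tr (a : ℕ) (t : Tm) : Bld := fun _ => Fm.tr a t
def bot : Bld := fun _ => Fm.bot
def not (A : Bld) : Bld := fun d => Fm.not (A d)
def imp (A B : Bld) : Bld := fun d => Fm.imp (A d) (B d)
def and (A B : Bld) : Bld := fun d => Fm.and (A d) (B d)
def or (A B : Bld) : Bld := fun d => Fm.or (A d) (B d)
def iff (A B : Bld) : Bld := fun d => Fm.iff (A d) (B d)

/-- `A(t)`, the bound variables of `A` being renamed to fresh ones. -/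
def app1 (A : ArithFm 1) (t : Tm) : Bld := fun d => (A.fm.shift d).subst d t

/-- `A(t, u)`, the bound variables of `A` being renamed to fresh ones. -/
def app2 (A : ArithFm 2) (t u : Tm) : Bld :=
  fun d => ((A.fm.shift d).subst d t).subst (d + 1) u

end Bld

infix:70 " =ₐ " => Bld.eq
infixr:65 " ∧ₐ " => Bld.and
infixr:60 " ∨ₐ " => Bld.or
infixr:55 " →ₐ " => Bld.imp
infix:50 " ↔ₐ " => Bld.iff

open Bld (all ex app1 app2)

/-! ### Arithmetized syntax -/

/-- `x ≤ y` -/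
def leA (x y : Tm) : Bld := ex fun w => Tm.add x w =ₐ y

/-- `x < y` -/
def ltA (x y : Tm) : Bld := leA (Tm.succ x) y

/-- `z` is the pair `⟨x, y⟩` (the pairing function `Nat.pair`). -/
def pairA (x y z : Tm) : Bld :=
  (ltA x y ∧ₐ z =ₐ Tm.add (Tm.mul y y) x) ∨ₐ
  (leA y x ∧ₐ z =ₐ Tm.add (Tm.add (Tm.mul x x) x) y)

/-- `y` is the `i`-th entry of the sequence coded by `p, q` with Gödel's beta function, that is,
the remainder of `p` modulo `1 + (i + 1) * q`. -/
def betaA (p q i y : Tm) : Bld :=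
  leA y (Tm.mul (Tm.succ i) q) ∧ₐ
  ex fun w => p =ₐ Tm.add (Tm.mul w (Tm.succ (Tm.mul (Tm.succ i) q))) y

/-- `x` belongs to the least class which contains all `y` with `base y` and which, if it contains
`u` and `w`, contains all `y` with `step u w y`: there is a finite sequence with last entry `x`
each entry of which satisfies `base` or comes from two earlier entries by `step`. -/
def genA (base : Tm → Bld) (step : Tm → Tm → Tm → Bld) (x : Tm) : Bld :=
  ex fun p => ex fun q => ex fun l => betaA p q l x ∧ₐ
    all fun i => leA i l →ₐ ex fun y => betaA p q i y ∧ₐ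
      (base y ∨ₐ ex fun j => ex fun k => ex fun u => ex fun w =>
        ltA j i ∧ₐ ltA k i ∧ₐ betaA p q j u ∧ₐ betaA p q k w ∧ₐ step u w y)

/-- Expressions for codes: numbers built up by pairing. -/
inductive Cd : Type
  | tm (t : Tm) : Cd
  | pr (c d : Cd) : Cd

instance : Coe Tm Cd := ⟨Cd.tm⟩

/-- `x` is the value of the expression `c`. -/
def isA (x : Tm) : Cd → Bld
  | .tm t => x =ₐ t
  | .pr c d => ex fun y => ex fun z => isA y c ∧ₐ isA z d ∧ₐ pairA y z x

namespace Cd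

/-- The pair of the numeral for `i` and `c`. -/
def tag (i : ℕ) (c : Cd) : Cd := pr (tm (num i)) c

def var (v : Cd) : Cd := tag 0 v
def zero : Cd := tag 1 (tm Tm.zero)
def succ (t : Cd) : Cd := tag 2 t
def add (t u : Cd) : Cd := tag 3 (pr t u)
def mul (t u : Cd) : Cd := tag 4 (pr t u)
/-- `f` is the pair of the arity and the number of the symbol, `l` the list of the arguments. -/
def fn (f l : Cd) : Cd := tag 5 (pr f l)
def nil : Cd := tag 6 (tm Tm.zero)
def cons (t l : Cd) : Cd := tag 7 (pr t l)
def bot : Cd := tag 8 (tm Tm.zero)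
def eq (t u : Cd) : Cd := tag 9 (pr t u)
def rel (r l : Cd) : Cd := tag 10 (pr r l)
def tr (a t : Cd) : Cd := tag 11 (pr a t)
def imp (A B : Cd) : Cd := tag 12 (pr A B)
def all (v A : Cd) : Cd := tag 13 (pr v A)
def not (A : Cd) : Cd := imp A bot
def and (A B : Cd) : Cd := not (imp A (not B))
def iff (A B : Cd) : Cd := and (imp A B) (imp B A)

end Cd

/-- Well-formedness of the pair `⟨s, x⟩`: `x` is a term if `s = 0`, a formula if `s = 1`, a list of
`k` terms if `s = k + 2`, in the language of `S` augmented by the `T_e` with `D e`. -/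
def wfA (S : Thy) (D : Tm → Bld) (s : Tm) (x : Tm) : Bld :=
  ex fun z => isA z (.pr s x) ∧ₐ genA
    (fun y =>
      (ex fun v => isA y (.tag 0 (.var v))) ∨ₐ
      isA y (.tag 0 .zero) ∨ₐ
      isA y (.tag 1 .bot) ∨ₐ
      isA y (.tag 2 .nil))
    (fun u w y =>
      (ex fun t => isA u (.tag 0 t) ∧ₐ isA y (.tag 0 (.succ t))) ∨ₐ
      (ex fun t => ex fun t' => isA u (.tag 0 t) ∧ₐ isA w (.tag 0 t') ∧ₐ
        (isA y (.tag 0 (.add t t')) ∨ₐ isA y (.tag 0 (.mul t t')) ∨ₐ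
          isA y (.tag 1 (.eq t t')))) ∨ₐ
      (ex fun t => ex fun k => ex fun l =>
        isA u (.tag 0 t) ∧ₐ isA w (.pr (Tm.succ (Tm.succ k)) l) ∧ₐ
        isA y (.pr (Tm.succ (Tm.succ (Tm.succ k))) (.cons t l))) ∨ₐ
      (ex fun k => ex fun i => ex fun l => isA u (.pr (Tm.succ (Tm.succ k)) l) ∧ₐ
        ((app2 S.funSym k i ∧ₐ isA y (.tag 0 (.fn (.pr k i) l))) ∨ₐ
          (app2 S.relSym k i ∧ₐ isA y (.tag 1 (.rel (.pr k i) l))))) ∨ₐ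
      (ex fun e => ex fun t => isA u (.tag 0 t) ∧ₐ D e ∧ₐ isA y (.tag 1 (.tr e t))) ∨ₐ
      (ex fun A => ex fun B => isA u (.tag 1 A) ∧ₐ isA w (.tag 1 B) ∧ₐ
        isA y (.tag 1 (.imp A B))) ∨ₐ
      (ex fun v => ex fun A => isA u (.tag 1 A) ∧ₐ isA y (.tag 1 (.all v A)))) z

/-- `x` is a term of the language. -/
def tmA (S : Thy) (D : Tm → Bld) (x : Tm) : Bld := wfA S D (num 0) x

/-- `x` is a formula of the language. -/
def fmA (S : Thy) (D : Tm → Bld) (x : Tm) : Bld := wfA S D (num 1) x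

/-- `x'` arises from the term, list of terms, or formula `x` by replacing the free occurrences of
the variable `v` by `t`, where for every quantified variable `z` into whose scope `t` is
substituted at least once, `ok z` holds. -/
def replA (ok : Tm → Bld) (v t x x' : Tm) : Bld :=
  ex fun z => isA z (.pr x x') ∧ₐ genA
    (fun y =>
      isA y (.pr (.var v) t) ∨ₐ
      (ex fun u => Bld.not (u =ₐ v) ∧ₐ isA y (.pr (.var u) (.var u))) ∨ₐ
      isA y (.pr .zero .zero) ∨ₐ
      isA y (.pr .nil .nil) ∨ₐ
      isA y (.pr .bot .bot) ∨ₐ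
      (ex fun A => isA y (.pr (.all v A) (.all v A))))
    (fun u w y => ex fun c => ex fun c' => isA u (.pr c c') ∧ₐ
      (isA y (.pr (.succ c) (.succ c')) ∨ₐ
       (ex fun e => isA y (.pr (.fn e c) (.fn e c')) ∨ₐ isA y (.pr (.rel e c) (.rel e c')) ∨ₐ
          isA y (.pr (.tr e c) (.tr e c')) ∨ₐ
          (Bld.not (e =ₐ v) ∧ₐ (ok e ∨ₐ c =ₐ c') ∧ₐ isA y (.pr (.all e c) (.all e c')))) ∨ₐ
       (ex fun b => ex fun b' => isA w (.pr b b') ∧ₐ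
          (isA y (.pr (.add c b) (.add c' b')) ∨ₐ isA y (.pr (.mul c b) (.mul c' b')) ∨ₐ
           isA y (.pr (.cons c b) (.cons c' b')) ∨ₐ isA y (.pr (.eq c b) (.eq c' b')) ∨ₐ
           isA y (.pr (.imp c b) (.imp c' b')))))) z

/-- The variable `v` does not occur free in the term or formula `x`: replacing its free
occurrences by the constant `0` does not change `x`. -/
def notFreeA (v x : Tm) : Bld :=
  ex fun t => isA t .zero ∧ₐ replA (fun _ => Tm.zero =ₐ Tm.zero) v t x x

/-- `x'` is `x(t/v)`, and the term `t` is free for `v` in `x`. -/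
def subA (v t x x' : Tm) : Bld := replA (fun z => notFreeA z t) v t x x'

/-- `m` is the code of the canonical constant term for `n`. -/
def numA (n m : Tm) : Bld :=
  ex fun z => isA z (.pr n m) ∧ₐ genA
    (fun y => isA y (.pr Tm.zero .zero))
    (fun u _ y => ex fun k => ex fun c => isA u (.pr k c) ∧ₐ isA y (.pr (Tm.succ k) (.succ c))) z

/-- `B` is a universal closure of `A`. -/
def closureA (A B : Tm) : Bld :=
  genA (fun y => y =ₐ A)
    (fun u _ y => ex fun v => Bld.not (notFreeA v u) ∧ₐ isA y (.all v u)) B ∧ₐ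
  all fun v => notFreeA v B

/-- `x` is the induction axiom for the formula `A` and the variable `v`. -/
def indA (v A x : Tm) : Bld :=
  ex fun z => ex fun s => ex fun A₀ => ex fun A₁ =>
    isA z .zero ∧ₐ isA s (.succ (.var v)) ∧ₐ subA v z A A₀ ∧ₐ subA v s A A₁ ∧ₐ
    isA x (.imp (.and A₀ (.all v (.imp A A₁))) (.all v A))

/-- `x` has the shape of a logical axiom. -/
def logAxA (S : Thy) (D : Tm → Bld) (x : Tm) : Bld :=
  (ex fun A => ex fun B => isA x (.imp A (.imp B A))) ∨ₐ
  (ex fun A => ex fun B => ex fun C =>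
    isA x (.imp (.imp A (.imp B C)) (.imp (.imp A B) (.imp A C)))) ∨ₐ
  (ex fun A => isA x (.imp (.not (.not A)) A)) ∨ₐ
  (ex fun v => ex fun t => ex fun A => ex fun B => tmA S D t ∧ₐ subA v t A B ∧ₐ
    isA x (.imp (.all v A) B)) ∨ₐ
  (ex fun v => ex fun A => ex fun B => notFreeA v A ∧ₐ
    isA x (.imp (.all v (.imp A B)) (.imp A (.all v B)))) ∨ₐ
  (ex fun t => isA x (.eq t t)) ∨ₐ
  (ex fun v => ex fun t => ex fun u => ex fun A => ex fun B => ex fun C => fmA S D A ∧ₐ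
    subA v t A B ∧ₐ subA v u A C ∧ₐ isA x (.imp (.eq t u) (.imp B C)))

/-- `z` follows from `x` and `y` by modus ponens, or from `x` by generalization. -/
def inferA (x y z : Tm) : Bld :=
  isA y (.imp x z) ∨ₐ ex fun v => isA z (.all v x)

/-- There is a deduction rule that infers `z` from `x` and `y`
(the logical axioms being rules without premises). -/
def ruleA (S : Thy) (D : Tm → Bld) (x y z : Tm) : Bld := logAxA S D z ∨ₐ inferA x y z

/-- `T_a` holds of the value of `c`. -/
def trueA (a : ℕ) (c : Cd) : Bld := ex fun z => isA z c ∧ₐ Bld.tr a z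

/-! ### The hierarchy

`S` is the base theory, and `lt` a formula for the ordering `≺`. -/

/-- The arithmetical formula `lt` represents the relation `prec` in Peano arithmetic. -/
def Represents (lt : ArithFm 2) (prec : ℕ → ℕ → Prop) : Prop :=
  ∀ m n, (prec m n → Provable Lang.arith PA (app2 lt (num m) (num n) 0)) ∧
    (¬ prec m n → Provable Lang.arith PA (Bld.not (app2 lt (num m) (num n)) 0))

/-- The theory `S` proves that `lt` is a (strict) total ordering. -/
structure ProvesTotalOrder (S : Thy) (lt : ArithFm 2) : Prop where
  irrefl : S.Proves ((all fun x => Bld.not (app2 lt x x)) 0)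
  trans : S.Proves ((all fun x => all fun y => all fun z =>
    app2 lt x y →ₐ app2 lt y z →ₐ app2 lt x z) 0)
  total : S.Proves ((all fun x => all fun y => app2 lt x y ∨ₐ x =ₐ y ∨ₐ app2 lt y x) 0)

/-- The language `L_a`: that of `S` with `T_b` for `b ≺ a`. -/
def langL (S : Thy) (prec : ℕ → ℕ → Prop) (a : ℕ) : Lang := S.lang fun b => prec b a

/-- The language `L_(a+1)`: that of `S` with `T_b` for `b ≼ a`. -/
def langLsucc (S : Thy) (prec : ℕ → ℕ → Prop) (a : ℕ) : Lang := S.lang fun b => prec b a ∨ b = a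

/-- `x` is a formula of the language of `S`. -/
def baseA (S : Thy) (x : Tm) : Bld := fmA S (fun _ => Bld.bot) x

/-- The index condition `e ≺ c`. -/
def below (lt : ArithFm 2) (c e : Tm) : Bld := app2 lt e c

/-- The index condition `e ≼ c`. -/
def upTo (lt : ArithFm 2) (c e : Tm) : Bld := app2 lt e c ∨ₐ e =ₐ c

/-- The formula `v_1 ∈ L_(v_0)`. -/
def inLFm (S : Thy) (lt : ArithFm 2) : Fm := fmA S (below lt (Tm.var 0)) (Tm.var 1) 2

section axioms

variable (S : Thy) (lt : ArithFm 2) (a : ℕ)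

/-- `x ∈ L_a` -/
def inLA (x : Tm) : Bld := fmA S (below lt (num a)) x

/-- `x ∈ L_(a+1)` -/
def inLsuccA (x : Tm) : Bld := fmA S (upTo lt (num a)) x

/-- `T_a` holds of all the axioms of `S`. -/
def axAxioms : Fm := (all fun x => baseA S x ∧ₐ app1 S.ax x →ₐ Bld.tr a x) 0

/-- `T_a` respects the deduction rules for formulas in `L_a`. -/
def axRules : Fm := (all fun x => all fun y => all fun z =>
  inLA S lt a x ∧ₐ inLA S lt a y ∧ₐ inLA S lt a z ∧ₐ ruleA S (below lt (num a)) x y z →ₐ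
    Bld.tr a x ∧ₐ Bld.tr a y →ₐ Bld.tr a z) 0

/-- `T_a` holds of every instance of the induction scheme for formulas in `L_a`. -/
def axInd : Fm := (all fun v => all fun A => all fun x =>
  inLA S lt a A ∧ₐ indA v A x →ₐ Bld.tr a x) 0

/-- The `ω`-rule: for every `A` in `L_a` with exactly one free variable `v`,
`T_a` holds of `A(n)` for all `n` if and only if it holds of `∀ v A`. -/
def axOmega : Fm := (all fun v => all fun A =>
  inLA S lt a A ∧ₐ (all fun u => Bld.not (notFreeA u A) ↔ₐ u =ₐ v) →ₐ
    ((all fun n => ex fun m => ex fun y => numA n m ∧ₐ subA v m A y ∧ₐ Bld.tr a y) ↔ₐ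
      trueA a (.all v A))) 0

/-- For all `c ≺ a` and `A ∈ L_c` with universal closure `B`, `T_a` holds of the truth definition
`B ↔ T_c(⌜A⌝)`. -/
def axDefs : Fm := (all fun c => all fun A => all fun B => all fun m =>
  app2 lt c (num a) ∧ₐ fmA S (below lt c) A ∧ₐ closureA A B ∧ₐ numA A m →ₐ
    trueA a (.iff B (.tr c m))) 0

/-- For all `A` in `L_b`, `T_b(⌜A⌝) ↔ T_a(⌜A⌝)`. -/
def axAgree (b : ℕ) : Fm :=
  .all 1 (.imp ((inLFm S lt).subst 0 (num b)) (.iff (.tr b (.var 1)) (.tr a (.var 1))))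

/-- The nonlogical axioms of `S_a`. -/
inductive Ax (prec : ℕ → ℕ → Prop) : Set Fm
  | base {A : Fm} : A ∈ S.axioms → Ax prec A
  | ind (v : ℕ) {A : Fm} : A.In (langLsucc S prec a) → Ax prec (Fm.ind v A)
  | axioms : Ax prec (axAxioms S a)
  | rules : Ax prec (axRules S lt a)
  | truthInd : Ax prec (axInd S lt a)
  | omega : Ax prec (axOmega S lt a)
  | truthDef {A B : Fm} : A.In (langL S prec a) → A.IsUnivClosure B →
      Ax prec (Fm.iff B (.tr a (num A.code)))
  | defs : Ax prec (axDefs S lt a)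
  | agree {b : ℕ} : prec b a → Ax prec (axAgree S lt a b)

/-- The formula is a theorem of `S_a`. -/
def TheoremOf (prec : ℕ → ℕ → Prop) (A : Fm) : Prop :=
  Provable (langLsucc S prec a) (Ax S lt a prec) A

/-- `x` is (the Gödel number of) a nonlogical axiom of `S_a`. -/
def axA (x : Tm) : Bld :=
  (baseA S x ∧ₐ app1 S.ax x) ∨ₐ
  (ex fun v => ex fun A => inLsuccA S lt a A ∧ₐ indA v A x) ∨ₐ
  x =ₐ num (axAxioms S a).code ∨ₐ
  x =ₐ num (axRules S lt a).code ∨ₐ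
  x =ₐ num (axInd S lt a).code ∨ₐ
  x =ₐ num (axOmega S lt a).code ∨ₐ
  (ex fun A => ex fun B => ex fun m => inLA S lt a A ∧ₐ closureA A B ∧ₐ numA A m ∧ₐ
    isA x (.iff B (.tr (num a) m))) ∨ₐ
  x =ₐ num (axDefs S lt a).code ∨ₐ
  (ex fun b => ex fun m => ex fun f => app2 lt b (num a) ∧ₐ numA b m ∧ₐ
    subA Tm.zero m (num (inLFm S lt).code) f ∧ₐ
    isA x (.all (num 1) (.imp f (.iff (.tr b (.var (num 1))) (.tr (num a) (.var (num 1)))))))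

/-- `x` is (the Gödel number of) a theorem of `S_a`: the last entry of a finite sequence of formulas
of `L_(a+1)` each of which is an axiom or inferred from earlier ones. -/
def thmA (x : Tm) : Bld :=
  genA (fun y => inLsuccA S lt a y ∧ₐ (axA S lt a y ∨ₐ logAxA S (upTo lt (num a)) y))
    (fun u w y => inLsuccA S lt a y ∧ₐ inferA u w y) x

/-- The sentence saying that every theorem of `S_b` is true: `T_a` holds of its Gödel number. -/
def theoremsTrue (b : ℕ) : Fm := (all fun x => thmA S lt b x →ₐ Bld.tr a x) 0

end axioms

end IteratedTruth

/-!
Provability in `S_a` is reduced to truth in models: by Gödel's completeness theorem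
(`Provable.of_holds`), it suffices that the sentence `theoremsTrue S lt a b` holds in every
structure `M` satisfying the axioms of `S_a`.  Such an `M` is a model of Peano arithmetic, usually
nonstandard, and satisfies induction for all formulas that mention `T_a`.  So one can argue about `M`
as about the natural numbers, as long as each induction is on a property definable in `M` with
parameters; the type classes `DefP` and `DefF` find the defining formulas.

In `M`, the arithmetized syntax becomes a syntax with nonstandard formulas: `Wf` (well-formedness),
`Repl` (substitution), `Clos` (universal closure), `cNum` (numerals) and so on, each proved to be
what the formulas of the statement express (the lemmas `holds_…`).  All of these classes are
generated inductively by sequences coded with the beta function (`Gen`), and `Gen.induct` is the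
corresponding induction principle.  The elements of `M` that are formulas of `L_a` and satisfy `T_a`
contain the logical axioms and are closed under modus ponens, generalization and the `ω`-rule.

That every theorem `x` of `S_b` satisfies `T_a` is then proved by induction on derivations
(`Models.th_isThm`), where the point is that the axioms of `S_b` satisfy `T_a` (`Models.th_isAx`).
For the axioms of `S` and the induction axioms this is an axiom of `S_a`, as it is for the truth
definitions of `T_b`.  A single axiom of `S_b` about `T_b` is a standard formula of `L_a`; it holds
in `M` because the corresponding axiom about `T_a` does and `T_a` and `T_b` agree on `L_b`, and
therefore `T_a` holds of it (`Models.tr_code`).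

There remain the axioms of `S_b` saying that `T_c` and `T_b` agree on `L_c`, for `c ≺ b`, where `c`
may be nonstandard, so that the axiom is a formula in the sense of `M` only (`Models.th_agree`).  By
the `ω`-rule it is enough to consider its instance for each element `n` of `M`.  If `n` is a formula
of `L_c` with closure `B`, then `T_a` holds of the truth definitions `B ↔ T_c(n)` and `B ↔ T_b(n)`,
hence of `T_c(n) ↔ T_b(n)`.  If not, `T_a` holds of the negation of `n ∈ L_c`, because `T_a` decides
arithmetical formulas with parameters from `M` correctly (`Models.th_of_holds`).
-/

namespace IteratedTruth

/-! ### Structures, satisfaction and soundness -/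

/-- A structure for the big language containing all the symbols. -/
structure Str : Type 1 where
  C : Type
  zero : C
  succ : C → C
  add : C → C → C
  mul : C → C → C
  fn : ∀ k : ℕ, ℕ → (Fin k → C) → C
  rel : ∀ k : ℕ, ℕ → (Fin k → C) → Prop
  tr : ℕ → C → Prop

/-- Value of a term in a structure. -/
def Tm.eval (M : Str) (r : ℕ → M.C) : Tm → M.C
  | .var v => r v
  | .zero => M.zero
  | .succ t => M.succ (t.eval M r)
  | .add t u => M.add (t.eval M r) (u.eval M r)
  | .mul t u => M.mul (t.eval M r) (u.eval M r)
  | .fn k i ts => M.fn k i fun j => (ts j).eval M r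

/-- Satisfaction of a formula in a structure, equality being interpreted as identity. -/
def Fm.Holds (M : Str) : (ℕ → M.C) → Fm → Prop
  | _, .bot => False
  | r, .eq t u => t.eval M r = u.eval M r
  | r, .rel k i ts => M.rel k i fun j => (ts j).eval M r
  | r, .tr a t => M.tr a (t.eval M r)
  | r, .imp A B => A.Holds M r → B.Holds M r
  | r, .all v A => ∀ x, A.Holds M (Function.update r v x)

/-- A strict upper bound for the indices of the variables of a term. -/
def Tm.ub : Tm → ℕ
  | .var v => v + 1
  | .zero => 0
  | .succ t => t.ub
  | .add t u => max t.ub u.ub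
  | .mul t u => max t.ub u.ub
  | .fn _ _ ts => Finset.univ.sup fun j => (ts j).ub

/-- A strict upper bound for the indices of the variables, free or bound, of a formula. -/
def Fm.ub : Fm → ℕ
  | .bot => 0
  | .eq t u => max t.ub u.ub
  | .rel _ _ ts => Finset.univ.sup fun j => (ts j).ub
  | .tr _ t => t.ub
  | .imp A B => max A.ub B.ub
  | .all v A => max (v + 1) A.ub

theorem Tm.occ_lt_ub {t : Tm} {v : ℕ} (h : t.Occ v) : v < t.ub := by
  induction t with
  | var w => simp_all [Tm.Occ, Tm.ub]
  | zero => simp_all [Tm.Occ]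
  | succ t ih => exact ih h
  | add t u iht ihu => simp only [Tm.Occ, Tm.ub, lt_max_iff] at *; tauto
  | mul t u iht ihu => simp only [Tm.Occ, Tm.ub, lt_max_iff] at *; tauto
  | fn k i ts ih =>
    obtain ⟨j, hj⟩ := h
    exact (ih j hj).trans_le (Finset.le_sup (f := fun j => (ts j).ub) (Finset.mem_univ j))

theorem Fm.free_lt_ub {A : Fm} {v : ℕ} (h : A.Free v) : v < A.ub := by
  induction A with
  | bot => exact h.elim
  | eq t u =>
    simp only [Fm.ub, lt_max_iff]
    exact h.imp Tm.occ_lt_ub Tm.occ_lt_ub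
  | rel k i ts =>
    obtain ⟨j, hj⟩ := h
    exact (Tm.occ_lt_ub hj).trans_le (Finset.le_sup (f := fun j => (ts j).ub) (Finset.mem_univ j))
  | tr a t => exact Tm.occ_lt_ub h
  | imp A B ihA ihB => simp only [Fm.Free, Fm.ub, lt_max_iff] at *; tauto
  | all w A ih => simp only [Fm.Free, Fm.ub, lt_max_iff] at *; tauto

variable {M : Str}

theorem Tm.eval_congr {t : Tm} {r s : ℕ → M.C} (h : ∀ v, t.Occ v → r v = s v) :
    t.eval M r = t.eval M s := by
  induction t with
  | var w => exact h w rfl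
  | zero => rfl
  | succ t ih => simp only [Tm.eval, ih h]
  | add t u iht ihu =>
    simp only [Tm.eval, iht fun v hv => h v (.inl hv), ihu fun v hv => h v (.inr hv)]
  | mul t u iht ihu =>
    simp only [Tm.eval, iht fun v hv => h v (.inl hv), ihu fun v hv => h v (.inr hv)]
  | fn k i ts ih => simp only [Tm.eval, fun j => ih j fun v hv => h v ⟨j, hv⟩]

theorem Fm.holds_congr {A : Fm} {r s : ℕ → M.C} (h : ∀ v, A.Free v → r v = s v) :
    A.Holds M r ↔ A.Holds M s := by
  induction A generalizing r s with
  | bot => rfl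
  | eq t u =>
    simp only [Fm.Holds, Tm.eval_congr fun v hv => h v (.inl hv),
      Tm.eval_congr fun v hv => h v (.inr hv)]
  | rel k i ts =>
    simp only [Fm.Holds, fun j => Tm.eval_congr (t := ts j) fun v hv => h v ⟨j, hv⟩]
  | tr a t => simp only [Fm.Holds, Tm.eval_congr h]
  | imp A B ihA ihB =>
    simp only [Fm.Holds, ihA fun v hv => h v (.inl hv), ihB fun v hv => h v (.inr hv)]
  | all w A ih =>
    simp only [Fm.Holds]
    refine forall_congr' fun x => ih fun v hv => ?_
    by_cases hw : v = w
    · simp [hw]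
    · simp [hw, h v ⟨Ne.symm hw, hv⟩]

theorem Tm.eval_subst (t : Tm) (v : ℕ) (s : Tm) (r : ℕ → M.C) :
    (t.subst v s).eval M r = t.eval M (Function.update r v (s.eval M r)) := by
  induction t with
  | var w => by_cases h : w = v <;> simp [Tm.subst, Tm.eval, h]
  | zero => rfl
  | succ t ih => simp only [Tm.subst, Tm.eval, ih]
  | add t u iht ihu => simp only [Tm.subst, Tm.eval, iht, ihu]
  | mul t u iht ihu => simp only [Tm.subst, Tm.eval, iht, ihu]
  | fn k i ts ih => simp only [Tm.subst, Tm.eval, ih]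

theorem Fm.holds_subst {A : Fm} {v : ℕ} {s : Tm} {r : ℕ → M.C} (h : A.FreeFor v s) :
    (A.subst v s).Holds M r ↔ A.Holds M (Function.update r v (s.eval M r)) := by
  induction A generalizing r with
  | bot => rfl
  | eq t u => simp only [Fm.subst, Fm.Holds, Tm.eval_subst]
  | rel k i ts => simp only [Fm.subst, Fm.Holds, Tm.eval_subst]
  | tr a t => simp only [Fm.subst, Fm.Holds, Tm.eval_subst]
  | imp A B ihA ihB => simp only [Fm.subst, Fm.Holds, ihA h.1, ihB h.2]
  | all w A ih =>
    by_cases hw : w = v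
    · simp [Fm.subst, Fm.Holds, hw]
    · obtain ⟨h1, h2⟩ := h.resolve_left hw
      simp only [Fm.subst, hw, if_false, Fm.Holds]
      refine forall_congr' fun x => ?_
      rw [ih h1, Function.update_comm hw]
      by_cases hf : A.Free v
      · rw [Tm.eval_congr (s := r)]
        intro u hu
        have : u ≠ w := fun e => h2 (e ▸ hu) hf
        simp [this]
      · refine Fm.holds_congr fun u hu => ?_
        have : u ≠ v := fun e => hf (e ▸ hu)
        simp [Function.update_apply, this]

theorem LogAx.holds {L : Lang} {A : Fm} (h : LogAx L A) (r : ℕ → M.C) : A.Holds M r := by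
  cases h with
  | k A B => exact fun a _ => a
  | s A B C => exact fun f g a => f a (g a)
  | dne A => exact fun h => Classical.not_not.1 h
  | inst v t A _ hf => exact fun h => (Fm.holds_subst hf).2 (h _)
  | dist v A B hv =>
    intro h a x
    refine h x ((Fm.holds_congr fun u hu => ?_).1 a)
    have : u ≠ v := fun e => hv (e ▸ hu)
    simp [this]
  | refl t => exact rfl
  | leibniz v t u A _ ht hu =>
    intro e h
    rw [Fm.holds_subst hu, ← show t.eval M r = u.eval M r from e]
    exact (Fm.holds_subst ht).1 h

/-- Soundness of the calculus. -/
theorem Provable.holds {L : Lang} {Γ : Set Fm} {A : Fm} (h : Provable L Γ A)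
    (hM : ∀ B ∈ Γ, B.In L → ∀ r, B.Holds M r) (r : ℕ → M.C) : A.Holds M r := by
  induction h generalizing r with
  | ax h hL => exact hM _ h hL r
  | log h _ => exact h.holds r
  | mp _ _ ih1 ih2 => exact ih2 r (ih1 r)
  | gen v _ ih => exact fun x => ih _

theorem Provable.in {L : Lang} {Γ : Set Fm} {A : Fm} (h : Provable L Γ A) : A.In L := by
  induction h with
  | ax _ h => exact h
  | log _ h => exact h
  | mp _ _ _ ih => exact ih.2
  | gen v _ ih => exact ih

/-- Every formula has a universal closure. -/
theorem Fm.exists_isUnivClosure (A : Fm) : ∃ B, A.IsUnivClosure B := by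
  have key : ∀ n, ∃ B, A.Prefixed B ∧ (∀ v < n, ¬ B.Free v) ∧ ∀ v, B.Free v → A.Free v := by
    intro n
    induction n with
    | zero => exact ⟨A, .refl, by simp, fun _ h => h⟩
    | succ n ih =>
      obtain ⟨B, h1, h2, h3⟩ := ih
      by_cases hn : B.Free n
      · refine ⟨.all n B, .all h1 hn, fun v hv hf => ?_, fun v hv => h3 v hv.2⟩
        have := hf.1
        exact h2 v (by omega) hf.2
      · refine ⟨B, h1, fun v hv hf => ?_, h3⟩
        rcases Nat.lt_succ_iff_lt_or_eq.1 hv with h | rfl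
        · exact h2 v h hf
        · exact hn hf
  obtain ⟨B, h1, h2, h3⟩ := key A.ub
  exact ⟨B, h1, fun v hv => h2 v (Fm.free_lt_ub (h3 v hv)) hv⟩

theorem Fm.Prefixed.in {A B : Fm} {L : Lang} (h : A.Prefixed B) (hA : A.In L) : B.In L := by
  induction h with
  | refl => exact hA
  | all _ _ ih => exact ih

theorem Fm.Prefixed.provable {A B : Fm} {L : Lang} {Γ : Set Fm} (h : A.Prefixed B)
    (hA : Provable L Γ A) : Provable L Γ B := by
  induction h with
  | refl => exact hA
  | all _ _ ih => exact .gen _ ih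

theorem Fm.Prefixed.forall_holds {A B : Fm} (h : A.Prefixed B) :
    (∀ r, B.Holds M r) ↔ ∀ r, A.Holds M r := by
  induction h with
  | refl => rfl
  | @all B v _ _ ih =>
    rw [← ih]
    exact ⟨fun h r => by simpa using h r (r v), fun h r x => h _⟩

theorem Fm.Sentence.holds_iff {A : Fm} (h : A.Sentence) (r s : ℕ → M.C) :
    A.Holds M r ↔ A.Holds M s :=
  Fm.holds_congr fun v hv => (h v hv).elim

/-! ### Propositional reasoning in Hilbert systems -/

/-- A Hilbert system for classical propositional logic: `W` singles out the formulas, `Th` the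
theorems. -/
structure Hilbert (F : Type) where
  imp : F → F → F
  bot : F
  W : F → Prop
  Th : F → Prop
  w_bot : W bot
  w_imp : ∀ {A B}, W (imp A B) ↔ W A ∧ W B
  th_w : ∀ {A}, Th A → W A
  k : ∀ {A B}, W A → W B → Th (imp A (imp B A))
  s : ∀ {A B C}, W A → W B → W C →
    Th (imp (imp A (imp B C)) (imp (imp A B) (imp A C)))
  dne : ∀ {A}, W A → Th (imp (imp (imp A bot) bot) A)
  mp : ∀ {A B}, Th A → Th (imp A B) → Th B

namespace Hilbert

variable {F : Type} {H : Hilbert F}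

/-- Derivability from hypotheses by modus ponens. -/
inductive Der (H : Hilbert F) (Δ : Set F) : F → Prop
  | hyp {A} : A ∈ Δ → H.W A → Der H Δ A
  | th {A} : H.Th A → Der H Δ A
  | mp {A B} : Der H Δ A → Der H Δ (H.imp A B) → Der H Δ B

variable {Δ Δ' : Set F} {A B C : F}

theorem Der.w (h : H.Der Δ A) : H.W A := by
  induction h with
  | hyp _ h => exact h
  | th h => exact H.th_w h
  | mp _ _ _ ih => exact (H.w_imp.1 ih).2

theorem Der.mono (h : H.Der Δ A) (hs : ∀ B ∈ Δ, H.W B → H.Der Δ' B) : H.Der Δ' A := by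
  induction h with
  | hyp h h' => exact hs _ h h'
  | th h => exact .th h
  | mp _ _ ih1 ih2 => exact .mp ih1 ih2

theorem Der.subset (h : H.Der Δ A) (hs : Δ ⊆ Δ') : H.Der Δ' A :=
  h.mono fun _ hB hw => .hyp (hs hB) hw

theorem Der.weaken (h : H.Der Δ A) : H.Der (insert B Δ) A :=
  h.subset (Set.subset_insert _ _)

theorem der_empty (h : H.Der ∅ A) : H.Th A := by
  induction h with
  | hyp h _ => exact h.elim
  | th h => exact h
  | mp _ _ ih1 ih2 => exact H.mp ih1 ih2

theorem th_id (hA : H.W A) : H.Th (H.imp A A) :=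
  H.mp (H.k hA hA) (H.mp (H.k hA (H.w_imp.2 ⟨hA, hA⟩)) (H.s hA (H.w_imp.2 ⟨hA, hA⟩) hA))

theorem Der.imp_of (h : H.Der Δ B) (hA : H.W A) : H.Der Δ (H.imp A B) :=
  .mp h (.th (H.k h.w hA))

/-- The deduction theorem. -/
theorem Der.deduct (hA : H.W A) (h : H.Der (insert A Δ) B) : H.Der Δ (H.imp A B) := by
  induction h with
  | hyp h hw =>
    rcases h with rfl | h
    · exact .th (th_id hA)
    · exact (Der.hyp h hw).imp_of hA
  | th h => exact (Der.th h).imp_of hA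
  | @mp B C h1 h2 ih1 ih2 =>
    exact .mp ih1 (.mp ih2 (.th (H.s hA h1.w (H.w_imp.1 h2.w).2)))

/-- Proof by contradiction. -/
theorem Der.by_contra (hA : H.W A) (h : H.Der (insert (H.imp A H.bot) Δ) H.bot) : H.Der Δ A :=
  .mp (h.deduct (H.w_imp.2 ⟨hA, H.w_bot⟩)) (.th (H.dne hA))

theorem Der.exfalso (hA : H.W A) (h : H.Der Δ H.bot) : H.Der Δ A :=
  .by_contra hA h.weaken

end Hilbert

/-! ### Renaming lemmas -/

theorem Tm.subst_self (t : Tm) (v : ℕ) : t.subst v (.var v) = t := by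
  induction t with
  | var w => by_cases h : w = v <;> simp [Tm.subst, h]
  | zero => rfl
  | succ t ih => simp only [Tm.subst, ih]
  | add t u iht ihu => simp only [Tm.subst, iht, ihu]
  | mul t u iht ihu => simp only [Tm.subst, iht, ihu]
  | fn k i ts ih => simp only [Tm.subst, ih]

theorem Fm.subst_self (A : Fm) (v : ℕ) : A.subst v (.var v) = A := by
  induction A with
  | bot => rfl
  | eq t u => simp only [Fm.subst, Tm.subst_self]
  | rel k i ts => simp only [Fm.subst, Tm.subst_self]
  | tr a t => simp only [Fm.subst, Tm.subst_self]
  | imp A B ihA ihB => simp only [Fm.subst, ihA, ihB]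
  | all w A ih => by_cases h : w = v <;> simp [Fm.subst, h, ih]

theorem Fm.freeFor_self (A : Fm) (v : ℕ) : A.FreeFor v (.var v) := by
  induction A with
  | imp A B ihA ihB => exact ⟨ihA, ihB⟩
  | all w A ih =>
    by_cases h : w = v
    · exact .inl h
    · exact .inr ⟨ih, fun e => (h e.symm).elim⟩
  | _ => trivial

theorem Tm.subst_of_ub_le {t : Tm} {w : ℕ} (h : t.ub ≤ w) (s : Tm) : t.subst w s = t := by
  induction t with
  | var v =>
    have : v ≠ w := by simp only [Tm.ub] at h; omega
    simp [Tm.subst, this]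
  | zero => rfl
  | succ t ih => simp only [Tm.subst, ih h]
  | add t u iht ihu =>
    simp only [Tm.ub, max_le_iff] at h
    simp only [Tm.subst, iht h.1, ihu h.2]
  | mul t u iht ihu =>
    simp only [Tm.ub, max_le_iff] at h
    simp only [Tm.subst, iht h.1, ihu h.2]
  | fn k i ts ih =>
    simp only [Tm.ub, Finset.sup_le_iff, Finset.mem_univ, true_imp_iff] at h
    simp only [Tm.subst, fun j => ih j (h j)]

theorem Fm.subst_of_ub_le {A : Fm} {w : ℕ} (h : A.ub ≤ w) (s : Tm) : A.subst w s = A := by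
  induction A with
  | bot => rfl
  | eq t u =>
    simp only [Fm.ub, max_le_iff] at h
    simp only [Fm.subst, Tm.subst_of_ub_le h.1, Tm.subst_of_ub_le h.2]
  | rel k i ts =>
    simp only [Fm.ub, Finset.sup_le_iff, Finset.mem_univ, true_imp_iff] at h
    simp only [Fm.subst, fun j => Tm.subst_of_ub_le (h j)]
  | tr a t => simp only [Fm.subst, Tm.subst_of_ub_le h]
  | imp A B ihA ihB =>
    simp only [Fm.ub, max_le_iff] at h
    simp only [Fm.subst, ihA h.1, ihB h.2]
  | all v A ih =>
    simp only [Fm.ub, max_le_iff] at h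
    simp [Fm.subst, ih h.2]

theorem Fm.not_free_of_ub_le {A : Fm} {w : ℕ} (h : A.ub ≤ w) : ¬ A.Free w :=
  fun hf => absurd (Fm.free_lt_ub hf) (by omega)

theorem Fm.freeFor_of_ub_le {A : Fm} {w : ℕ} (h : A.ub ≤ w) (s : Tm) : A.FreeFor w s := by
  induction A with
  | imp A B ihA ihB =>
    simp only [Fm.ub, max_le_iff] at h
    exact ⟨ihA h.1, ihB h.2⟩
  | all v A ih =>
    simp only [Fm.ub, max_le_iff] at h
    exact .inr ⟨ih h.2, fun _ => Fm.not_free_of_ub_le h.2⟩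
  | _ => trivial

theorem Fm.freeFor_var_of_ub_le {A : Fm} {w : ℕ} (h : A.ub ≤ w) (v : ℕ) :
    A.FreeFor v (.var w) := by
  induction A with
  | imp A B ihA ihB =>
    simp only [Fm.ub, max_le_iff] at h
    exact ⟨ihA h.1, ihB h.2⟩
  | all u A ih =>
    simp only [Fm.ub, max_le_iff] at h
    refine .inr ⟨ih h.2, fun e => ?_⟩
    simp only [Tm.Occ] at e
    omega
  | _ => trivial

theorem Tm.subst_var_subst {t : Tm} {w : ℕ} (h : t.ub ≤ w) (v : ℕ) :
    (t.subst v (.var w)).subst w (.var v) = t := by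
  induction t with
  | var u =>
    have : u ≠ w := by simp only [Tm.ub] at h; omega
    by_cases hu : u = v
    · simp [Tm.subst, hu]
    · simp [Tm.subst, hu, this]
  | zero => rfl
  | succ t ih => simp only [Tm.subst, ih h]
  | add t u iht ihu =>
    simp only [Tm.ub, max_le_iff] at h
    simp only [Tm.subst, iht h.1, ihu h.2]
  | mul t u iht ihu =>
    simp only [Tm.ub, max_le_iff] at h
    simp only [Tm.subst, iht h.1, ihu h.2]
  | fn k i ts ih =>
    simp only [Tm.ub, Finset.sup_le_iff, Finset.mem_univ, true_imp_iff] at h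
    simp only [Tm.subst, fun j => ih j (h j)]

theorem Fm.subst_var_subst {A : Fm} {w : ℕ} (h : A.ub ≤ w) (v : ℕ) :
    (A.subst v (.var w)).subst w (.var v) = A := by
  induction A with
  | bot => rfl
  | eq t u =>
    simp only [Fm.ub, max_le_iff] at h
    simp only [Fm.subst, Tm.subst_var_subst h.1, Tm.subst_var_subst h.2]
  | rel k i ts =>
    simp only [Fm.ub, Finset.sup_le_iff, Finset.mem_univ, true_imp_iff] at h
    simp only [Fm.subst, fun j => Tm.subst_var_subst (h j)]
  | tr a t => simp only [Fm.subst, Tm.subst_var_subst h]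
  | imp A B ihA ihB =>
    simp only [Fm.ub, max_le_iff] at h
    simp only [Fm.subst, ihA h.1, ihB h.2]
  | all u A ih =>
    simp only [Fm.ub, max_le_iff] at h
    have : u ≠ w := by omega
    by_cases hu : u = v
    · simp [Fm.subst, hu, Fm.subst_of_ub_le h.2]
    · simp [Fm.subst, hu, this, ih h.2]

theorem Fm.freeFor_subst_var {A : Fm} {w : ℕ} (h : A.ub ≤ w) (v : ℕ) :
    (A.subst v (.var w)).FreeFor w (.var v) := by
  induction A with
  | imp A B ihA ihB =>
    simp only [Fm.ub, max_le_iff] at h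
    exact ⟨ihA h.1, ihB h.2⟩
  | all u A ih =>
    simp only [Fm.ub, max_le_iff] at h
    by_cases hu : u = v
    · simp only [Fm.subst, hu, if_true]
      exact .inr ⟨Fm.freeFor_of_ub_le h.2 _, fun _ => Fm.not_free_of_ub_le h.2⟩
    · simp only [Fm.subst, hu, if_false]
      exact .inr ⟨ih h.2, fun e => (hu e.symm).elim⟩
  | _ => trivial

theorem Tm.not_occ_subst_var {v w : ℕ} (h : v ≠ w) (t : Tm) :
    ¬ (t.subst v (.var w)).Occ v := by
  induction t with
  | var u => by_cases hu : u = v <;> simp [Tm.subst, hu, Tm.Occ, h.symm]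
  | zero => exact id
  | succ t ih => exact ih
  | add t u iht ihu => exact fun h => h.elim iht ihu
  | mul t u iht ihu => exact fun h => h.elim iht ihu
  | fn k i ts ih => exact fun ⟨j, hj⟩ => ih j hj

theorem Fm.not_free_subst_var {v w : ℕ} (h : v ≠ w) (A : Fm) :
    ¬ (A.subst v (.var w)).Free v := by
  induction A with
  | bot => exact id
  | eq t u => exact fun e => e.elim (t.not_occ_subst_var h) (u.not_occ_subst_var h)
  | rel k i ts => exact fun ⟨j, hj⟩ => (ts j).not_occ_subst_var h hj
  | tr a t => exact t.not_occ_subst_var h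
  | imp A B ihA ihB => exact fun h => h.elim ihA ihB
  | all u A ih =>
    by_cases hu : u = v
    · simp [Fm.subst, hu, Fm.Free]
    · simp only [Fm.subst, hu, if_false]
      exact fun h => ih h.2

theorem Tm.in_subst {L : Lang} {t s : Tm} (ht : t.In L) (hs : s.In L) (v : ℕ) :
    (t.subst v s).In L := by
  induction t with
  | var u => by_cases hu : u = v <;> simp [Tm.subst, hu, Tm.In, hs]
  | zero => trivial
  | succ t ih => exact ih ht
  | add t u iht ihu => exact ⟨iht ht.1, ihu ht.2⟩
  | mul t u iht ihu => exact ⟨iht ht.1, ihu ht.2⟩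
  | fn k i ts ih => exact ⟨ht.1, fun j => ih j (ht.2 j)⟩

theorem Fm.in_subst {L : Lang} {A : Fm} {s : Tm} (hA : A.In L) (hs : s.In L) (v : ℕ) :
    (A.subst v s).In L := by
  induction A with
  | bot => trivial
  | eq t u => exact ⟨Tm.in_subst hA.1 hs v, Tm.in_subst hA.2 hs v⟩
  | rel k i ts => exact ⟨hA.1, fun j => Tm.in_subst (hA.2 j) hs v⟩
  | tr a t => exact ⟨hA.1, Tm.in_subst hA.2 hs v⟩
  | imp A B ihA ihB => exact ⟨ihA hA.1, ihB hA.2⟩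
  | all u A ih =>
    by_cases hu : u = v
    · simpa [Fm.subst, hu] using hA
    · simp only [Fm.subst, hu, if_false]
      exact ih hA

/-- The number of logical symbols of a formula. -/
def Fm.size : Fm → ℕ
  | .imp A B => A.size + B.size + 1
  | .all _ A => A.size + 1
  | _ => 0

theorem Fm.size_subst (A : Fm) (v : ℕ) (s : Tm) : (A.subst v s).size = A.size := by
  induction A with
  | imp A B ihA ihB => simp only [Fm.subst, Fm.size, ihA, ihB]
  | all u A ih => by_cases hu : u = v <;> simp [Fm.subst, hu, Fm.size, ih]
  | _ => rfl

/-! ### Gödel numbers determine formulas -/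

theorem codeList_injective : Function.Injective codeList := by
  intro l
  induction l with
  | nil => intro m h; cases m <;> simp [codeList, Nat.pair_eq_pair] at h ⊢
  | cons x l ih =>
    intro m h
    cases m with
    | nil => simp [codeList, Nat.pair_eq_pair] at h
    | cons y m =>
      simp only [codeList, Nat.pair_eq_pair, true_and] at h
      rw [h.1, ih h.2]

theorem ofFn_code_injective {k : ℕ} {f g : Fin k → ℕ}
    (h : codeList (List.ofFn f) = codeList (List.ofFn g)) : f = g :=
  List.ofFn_injective (codeList_injective h)

theorem Tm.code_injective : Function.Injective Tm.code := by
  intro t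
  induction t with
  | var v => intro u h; cases u <;> simp_all [Tm.code, Nat.pair_eq_pair]
  | zero => intro u h; cases u <;> simp_all [Tm.code, Nat.pair_eq_pair]
  | succ t ih =>
    intro u h
    cases u <;> simp [Tm.code, Nat.pair_eq_pair] at h ⊢
    exact ih h
  | add t t' ih ih' =>
    intro u h
    cases u <;> simp [Tm.code, Nat.pair_eq_pair] at h ⊢
    exact ⟨ih h.1, ih' h.2⟩
  | mul t t' ih ih' =>
    intro u h
    cases u <;> simp [Tm.code, Nat.pair_eq_pair] at h ⊢
    exact ⟨ih h.1, ih' h.2⟩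
  | fn k i ts ih =>
    intro u h
    cases u <;> simp only [Tm.code, Nat.pair_eq_pair, true_and] at h <;> try omega
    obtain ⟨⟨rfl, rfl⟩, h⟩ := h
    congr 1
    exact funext fun j => ih j (congrFun (ofFn_code_injective h) j)

theorem Fm.code_injective : Function.Injective Fm.code := by
  intro A
  induction A with
  | bot => intro B h; cases B <;> simp_all [Fm.code, Nat.pair_eq_pair]
  | eq t u =>
    intro B h
    cases B <;> simp [Fm.code, Nat.pair_eq_pair] at h ⊢
    exact ⟨Tm.code_injective h.1, Tm.code_injective h.2⟩
  | rel k i ts =>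
    intro B h
    cases B <;> simp only [Fm.code, Nat.pair_eq_pair, true_and] at h <;> try omega
    obtain ⟨⟨rfl, rfl⟩, h⟩ := h
    congr 1
    exact funext fun j => Tm.code_injective (congrFun (ofFn_code_injective h) j)
  | tr a t =>
    intro B h
    cases B <;> simp [Fm.code, Nat.pair_eq_pair] at h ⊢
    exact ⟨h.1, Tm.code_injective h.2⟩
  | imp A A' ih ih' =>
    intro B h
    cases B <;> simp [Fm.code, Nat.pair_eq_pair] at h ⊢
    exact ⟨ih h.1, ih' h.2⟩
  | all v A ih =>
    intro B h
    cases B <;> simp [Fm.code, Nat.pair_eq_pair] at h ⊢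
    exact ⟨h.1, ih h.2⟩

instance : Countable Fm := Fm.code_injective.countable

/-! ### The completeness theorem -/

section Completeness

variable {L : Lang} {Γ : Set Fm}

/-- The propositional part of the calculus. -/
def provableHilbert (L : Lang) (Γ : Set Fm) : Hilbert Fm where
  imp := Fm.imp
  bot := Fm.bot
  W A := A.In L
  Th := Provable L Γ
  w_bot := trivial
  w_imp := Iff.rfl
  th_w := Provable.in
  k hA hB := .log (.k _ _) ⟨hA, hB, hA⟩
  s hA hB hC := .log (.s _ _ _) ⟨⟨hA, hB, hC⟩, ⟨hA, hB⟩, hA, hC⟩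
  dne hA := .log (.dne _) ⟨⟨⟨hA, trivial⟩, trivial⟩, hA⟩
  mp := .mp

/-- Derivability from hypotheses whose free variables are treated as constants. -/
abbrev Entails (L : Lang) (Γ Δ : Set Fm) (A : Fm) : Prop := (provableHilbert L Γ).Der Δ A

namespace Entails

variable {Δ : Set Fm} {A B : Fm}

open Hilbert

theorem mp' (h1 : Entails L Γ Δ A) (h2 : Entails L Γ Δ (A.imp B)) : Entails L Γ Δ B :=
  Der.mp h1 h2

theorem prov (h : Provable L Γ A) : Entails L Γ Δ A := Der.th h

theorem logax (h : LogAx L A) (hA : A.In L) : Entails L Γ Δ A := prov (.log h hA)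

theorem inst {v : ℕ} {t : Tm} (h : Entails L Γ Δ (.all v A)) (ht : t.In L)
    (hf : A.FreeFor v t) : Entails L Γ Δ (A.subst v t) :=
  mp' h (logax (.inst v t A ht hf) ⟨h.w, Fm.in_subst (A := A) h.w ht v⟩)

theorem hyp' (h : A ∈ Δ) (hA : A.In L) : Entails L Γ Δ A := Der.hyp h hA

theorem deduct' (hA : A.In L) (h : Entails L Γ (insert A Δ) B) : Entails L Γ Δ (A.imp B) :=
  Der.deduct (H := provableHilbert L Γ) hA h

theorem all_mp (v : ℕ) (hA : A.In L) (hB : B.In L) :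
    Provable L Γ ((Fm.all v (A.imp B)).imp ((Fm.all v A).imp (Fm.all v B))) := by
  have hin : Provable L Γ ((Fm.all v (A.imp B)).imp ((Fm.all v A).imp B)) := by
    refine der_empty (H := provableHilbert L Γ) (deduct' (A := Fm.all v (A.imp B)) ⟨hA, hB⟩
      (deduct' (A := Fm.all v A) hA ?_))
    have h1 : Entails L Γ {Fm.all v A, Fm.all v (A.imp B)} (.all v A) := hyp' (by simp) hA
    have h2 : Entails L Γ {Fm.all v A, Fm.all v (A.imp B)} (.all v (A.imp B)) :=
      hyp' (by simp) ⟨hA, hB⟩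
    have h1 := h1.inst (t := .var v) trivial (Fm.freeFor_self _ _)
    have h2 := h2.inst (t := .var v) trivial (Fm.freeFor_self _ _)
    rw [Fm.subst_self] at h1 h2
    simpa using h1.mp' h2
  refine der_empty (H := provableHilbert L Γ) (deduct' (A := Fm.all v (A.imp B)) ⟨hA, hB⟩ ?_)
  have h3 := (Provable.gen v hin).mp
    (.log (.dist v _ _ (by simp [Fm.Free])) ⟨⟨⟨hA, hB⟩, hA, hB⟩, ⟨hA, hB⟩, hA, hB⟩)
  have h4 : Entails L Γ (insert (Fm.all v (A.imp B)) ∅) (.all v ((Fm.all v A).imp B)) :=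
    mp' (hyp' (by simp) (show (Fm.all v (A.imp B)).In L from ⟨hA, hB⟩)) (prov h3)
  exact h4.mp' (logax (.dist v _ _ (by simp [Fm.Free])) ⟨⟨hA, hB⟩, hA, hB⟩)

theorem gen' {v : ℕ} (hv : ∀ B ∈ Δ, ¬ B.Free v) (h : Entails L Γ Δ A) :
    Entails L Γ Δ (.all v A) := by
  induction h with
  | @hyp A h hw =>
    refine mp' (Der.hyp h hw) ?_
    refine mp' (prov (.gen v (th_id (H := provableHilbert L Γ) hw)))
      (logax (.dist v _ _ (hv _ h)) ⟨⟨hw, hw⟩, hw, hw⟩)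
  | th h => exact prov (.gen v h)
  | @mp A B h1 h2 ih1 ih2 =>
    exact mp' ih1 (mp' ih2 (prov (all_mp v h1.w (show (A.imp B).In L from h2.w).2)))

end Entails

open Hilbert

theorem exists_ub {Δ : Set Fm} (h : Δ.Finite) : ∃ n, ∀ A ∈ Δ, A.ub ≤ n := by
  obtain ⟨n, hn⟩ := (h.image Fm.ub).bddAbove
  exact ⟨n, fun A hA => hn ⟨A, hA, rfl⟩⟩

/-- One step of the construction of a complete set of formulas: `φ` is decided, and a fresh
variable is made a witness if `φ` is a universal formula that is refuted. -/
theorem exists_decide {Δ : Set Fm} (hfin : Δ.Finite) (hcon : ¬ Entails L Γ Δ .bot)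
    (φ : Fm) (hφ : φ.In L) : ∃ Δ' : Set Fm, Δ ⊆ Δ' ∧ Δ'.Finite ∧ ¬ Entails L Γ Δ' .bot ∧
      (φ ∈ Δ' ∨ (φ.not ∈ Δ' ∧ ∀ v A, φ = .all v A → ∃ w, A.ub ≤ w ∧ v < w ∧
        (A.subst v (.var w)).not ∈ Δ')) := by
  by_cases h : Entails L Γ (insert φ Δ) .bot
  swap
  · exact ⟨_, Set.subset_insert _ _, hfin.insert _, h, .inl (by simp)⟩
  have hn : Entails L Γ Δ φ.not := h.deduct hφ
  have hc1 : ¬ Entails L Γ (insert φ.not Δ) .bot := fun h' =>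
    hcon (Der.mp hn (h'.deduct (A := φ.not) ⟨hφ, trivial⟩))
  by_cases hall : ∃ v A, φ = .all v A
  swap
  · exact ⟨_, Set.subset_insert _ _, hfin.insert _, hc1,
      .inr ⟨by simp, fun v A e => (hall ⟨v, A, e⟩).elim⟩⟩
  obtain ⟨v, A, rfl⟩ := hall
  obtain ⟨n, hub⟩ := exists_ub (hfin.insert (Fm.all v A).not)
  have hw := hub _ (Set.mem_insert _ _)
  simp only [Fm.not, Fm.ub, max_le_iff] at hw
  obtain ⟨⟨hv, hA⟩, -⟩ := hw
  refine ⟨insert (A.subst v (.var n)).not (insert (Fm.all v A).not Δ),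
    (Set.subset_insert _ _).trans (Set.subset_insert _ _), (hfin.insert _).insert _, ?_,
    .inr ⟨by simp, ?_⟩⟩
  · intro hbot
    have h1 : Entails L Γ (insert (Fm.all v A).not Δ) (A.subst v (.var n)) :=
      Der.by_contra (Fm.in_subst (A := A) (s := .var n) hφ trivial v) hbot
    have h2 := Entails.gen' (v := n) (fun B hB => Fm.not_free_of_ub_le (hub B hB)) h1
    have h3 : Entails L Γ {.all n (A.subst v (.var n))} A := by
      have : Entails L Γ {.all n (A.subst v (.var n))} (.all n (A.subst v (.var n))) :=
        Der.hyp rfl h2.w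
      simpa [Fm.subst_var_subst hA] using
        this.inst (t := .var v) trivial (Fm.freeFor_subst_var hA v)
    have h4 := Entails.gen' (v := v) (fun B hB => by
      obtain rfl := hB
      exact fun h => Fm.not_free_subst_var (by omega) A h.2) h3
    exact hc1 (Der.mp (h2.mp' (Der.mono (Der.deduct (Δ := ∅) h2.w (by simpa using h4))
      (by simp))) (Der.hyp (Set.mem_insert _ _) ⟨hφ, trivial⟩))
  · rintro _ _ ⟨⟩
    exact ⟨n, hA, hv, by simp⟩

/-- A set of formulas that is consistent, complete and has variables as witnesses. -/
structure Saturated (L : Lang) (Γ Δ : Set Fm) : Prop where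
  con : ¬ Entails L Γ Δ .bot
  wit : ∀ φ : Fm, φ.In L → (φ ∈ Δ ∨ (φ.not ∈ Δ ∧ ∀ v A, φ = .all v A → ∃ w, A.ub ≤ w ∧ v < w ∧
        (A.subst v (.var w)).not ∈ Δ))

theorem exists_saturated {Δ : Set Fm} (hfin : Δ.Finite) (hcon : ¬ Entails L Γ Δ .bot) :
    ∃ Δ', Δ ⊆ Δ' ∧ Saturated L Γ Δ' := by
  have : Nonempty Fm := ⟨.bot⟩
  obtain ⟨e, he⟩ := exists_surjective_nat Fm
  let G := {Δ : Set Fm // Δ.Finite ∧ ¬ Entails L Γ Δ .bot}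
  have step : ∀ (Δ : G) (φ : Fm), ∃ Δ' : G, Δ.1 ⊆ Δ'.1 ∧ (φ.In L →
      (φ ∈ Δ'.1 ∨ (φ.not ∈ Δ'.1 ∧ ∀ v A, φ = .all v A → ∃ w, A.ub ≤ w ∧ v < w ∧
        (A.subst v (.var w)).not ∈ Δ'.1))) := by
    intro Δ φ
    by_cases hφ : φ.In L
    · obtain ⟨Δ', h1, h2, h3, h4⟩ := exists_decide Δ.2.1 Δ.2.2 φ hφ
      exact ⟨⟨Δ', h2, h3⟩, h1, fun _ => h4⟩
    · exact ⟨Δ, subset_rfl, fun h => (hφ h).elim⟩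
  choose f hf1 hf2 using step
  let D : ℕ → G := fun n => Nat.rec ⟨Δ, hfin, hcon⟩ (fun n Δ => f Δ (e n)) n
  have hmono : Monotone fun n => (D n).1 := monotone_nat_of_le_succ fun n => hf1 _ _
  refine ⟨⋃ n, (D n).1, Set.subset_iUnion (fun n => (D n).1) 0, ?_, fun φ hφ => ?_⟩
  · intro h
    have key : ∀ A, Entails L Γ (⋃ n, (D n).1) A → ∃ n, Entails L Γ (D n).1 A := by
      intro A h
      induction h with
      | hyp h hw =>
        obtain ⟨n, hn⟩ := Set.mem_iUnion.1 h
        exact ⟨n, .hyp hn hw⟩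
      | th h => exact ⟨0, .th h⟩
      | mp _ _ ih1 ih2 =>
        obtain ⟨n, hn⟩ := ih1
        obtain ⟨m, hm⟩ := ih2
        exact ⟨max n m, .mp (hn.subset (hmono (le_max_left n m)))
          (hm.subset (hmono (le_max_right n m)))⟩
    obtain ⟨n, hn⟩ := key _ h
    exact (D n).2.2 hn
  · obtain ⟨n, rfl⟩ := he φ
    have hs : (D (n + 1)).1 ⊆ ⋃ n, (D n).1 := Set.subset_iUnion (fun n => (D n).1) (n + 1)
    refine (hf2 (D n) (e n) hφ).imp (fun h => hs h) fun ⟨h1, h2⟩ => ⟨hs h1, fun v A e => ?_⟩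
    obtain ⟨w, hw, hv, h⟩ := h2 v A e
    exact ⟨w, hw, hv, hs h⟩

end Completeness

section Completeness

variable {L : Lang} {Γ : Set Fm}
open Hilbert

namespace Saturated

variable {Δ : Set Fm} (hΔ : Saturated L Γ Δ)

section

variable {A B : Fm}

theorem entails_not (hΔ : Saturated L Γ Δ) (hA : A.In L) :
    Entails L Γ Δ A.not ↔ ¬ Entails L Γ Δ A := by
  refine ⟨fun h h' => hΔ.con (h'.mp' h), fun h => ?_⟩
  rcases hΔ.wit A hA with h1 | h1
  · exact (h (Entails.hyp' h1 hA)).elim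
  · exact Entails.hyp' h1.1 ⟨hA, trivial⟩

theorem entails_imp (hΔ : Saturated L Γ Δ) (hA : A.In L) (hB : B.In L) :
    Entails L Γ Δ (A.imp B) ↔ (Entails L Γ Δ A → Entails L Γ Δ B) := by
  refine ⟨fun h h' => h'.mp' h, fun h => ?_⟩
  by_cases hA' : Entails L Γ Δ A
  · exact Der.imp_of (H := provableHilbert L Γ) (h hA') hA
  · refine Entails.deduct' hA (Der.exfalso (H := provableHilbert L Γ) hB ?_)
    exact Der.mp (Entails.hyp' (by simp) hA) (((hΔ.entails_not hA).2 hA').weaken)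

theorem exists_witness (hΔ : Saturated L Γ Δ) {v : ℕ} (hA : A.In L)
    (h : ¬ Entails L Γ Δ (.all v A)) :
    ∃ w, A.ub ≤ w ∧ v < w ∧ ¬ Entails L Γ Δ (A.subst v (.var w)) := by
  rcases hΔ.wit (.all v A) hA with h1 | h1
  · exact (h (Entails.hyp' h1 hA)).elim
  · obtain ⟨w, h2, h3, h4⟩ := h1.2 v A rfl
    have hw : (A.subst v (.var w)).In L := Fm.in_subst hA (by trivial) v
    exact ⟨w, h2, h3, (hΔ.entails_not hw).1 (Entails.hyp' h4 ⟨hw, trivial⟩)⟩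

end

theorem leibniz {Δ : Set Fm} {A : Fm} {t u : Tm} {v : ℕ} (hA : A.In L) (ht : t.In L)
    (hu : u.In L) (ht' : A.FreeFor v t) (hu' : A.FreeFor v u) (h : Entails L Γ Δ (.eq t u))
    (h' : Entails L Γ Δ (A.subst v t)) : Entails L Γ Δ (A.subst v u) :=
  h'.mp' (h.mp' (Entails.logax (.leibniz v t u A hA ht' hu')
    ⟨⟨ht, hu⟩, Fm.in_subst hA ht v, Fm.in_subst hA hu v⟩))

theorem eq_refl {Δ : Set Fm} {t : Tm} (ht : t.In L) : Entails L Γ Δ (.eq t t) :=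
  Entails.logax (.refl t) ⟨ht, ht⟩

theorem eq_symm {Δ : Set Fm} {t u : Tm} (h : Entails L Γ Δ (.eq t u)) :
    Entails L Γ Δ (.eq u t) := by
  have hw : t.In L ∧ u.In L := h.w
  have := leibniz (v := t.ub) (A := .eq (.var t.ub) t) ⟨trivial, hw.1⟩ hw.1 hw.2 trivial trivial h
    (by simpa [Fm.subst, Tm.subst, Tm.subst_of_ub_le le_rfl] using eq_refl hw.1)
  simpa [Fm.subst, Tm.subst, Tm.subst_of_ub_le le_rfl] using this

theorem eq_trans {Δ : Set Fm} {t u s : Tm} (h : Entails L Γ Δ (.eq t u))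
    (h' : Entails L Γ Δ (.eq u s)) : Entails L Γ Δ (.eq t s) := by
  have hw : t.In L ∧ u.In L := h.w
  have hw' : u.In L ∧ s.In L := h'.w
  have := leibniz (v := t.ub) (A := .eq t (.var t.ub)) ⟨hw.1, trivial⟩ hw'.1 hw'.2 trivial
    trivial h' (by simpa [Fm.subst, Tm.subst, Tm.subst_of_ub_le le_rfl] using h)
  simpa [Fm.subst, Tm.subst, Tm.subst_of_ub_le le_rfl] using this

/-- Substitutivity of equality in all arguments of a symbol: `A` is the atomic formula with that
symbol as a function of its arguments. -/
theorem leibniz_args {Δ : Set Fm} {k : ℕ} {ts us : Fin k → Tm} (A : (Fin k → Tm) → Fm)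
    (n : ℕ) (hin : ∀ ts : Fin k → Tm, (∀ j, (ts j).In L) → (A ts).In L)
    (hfree : ∀ ts v s, (A ts).FreeFor v s)
    (hsub : ∀ (ts : Fin k → Tm) v s, n ≤ v → (A ts).subst v s = A fun j => (ts j).subst v s)
    (hts : ∀ j, (ts j).In L) (hus : ∀ j, (us j).In L)
    (h : ∀ j, Entails L Γ Δ (.eq (ts j) (us j))) (hA : Entails L Γ Δ (A ts)) :
    Entails L Γ Δ (A us) := by
  have key : ∀ m ≤ k, Entails L Γ Δ (A fun j => if j.1 < m then us j else ts j) := by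
    intro m
    induction m with
    | zero => simpa using hA
    | succ m ih =>
      intro hm
      have ih := ih (by omega)
      obtain ⟨w, hw⟩ : ∃ w, w = max n (Finset.univ.sup fun j => max (ts j).ub (us j).ub) := ⟨_, rfl⟩
      have hb : ∀ j, (ts j).ub ≤ w ∧ (us j).ub ≤ w := fun j => by
        have := Finset.le_sup (f := fun j => max (ts j).ub (us j).ub) (Finset.mem_univ j)
        exact max_le_iff.1 (hw ▸ this.trans (le_max_right _ _))
      let B := A fun j => if j.1 < m then us j else if j.1 = m then .var w else ts j
      have hB : ∀ s, B.subst w s =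
          A fun j => if j.1 < m then us j else if j.1 = m then s else ts j := by
        intro s
        rw [hsub _ _ _ (hw ▸ le_max_left _ _)]
        congr 1
        funext j
        split_ifs
        · exact Tm.subst_of_ub_le (hb j).2 s
        · simp [Tm.subst]
        · exact Tm.subst_of_ub_le (hb j).1 s
      have := leibniz (v := w) (A := B) (t := ts ⟨m, hm⟩) (u := us ⟨m, hm⟩)
        (hin _ fun j => by split_ifs <;> first | exact hus j | exact hts j | trivial)
        (hts _) (hus _) (hfree _ _ _) (hfree _ _ _) (h _) (by
          rw [hB]
          convert ih using 3 with j
          split_ifs with h1 h2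
          · rfl
          · congr 1
            exact Fin.ext h2.symm
          · rfl)
      rw [hB] at this
      convert this using 3 with j
      split_ifs with h1 h2 h3 h4
      · rfl
      · congr 1
        exact Fin.ext h3
      · omega
      · omega
      · omega
      · rfl
  have := key k le_rfl
  simpa using this

/-- Provable equality of terms of the language. -/
def setoid (L : Lang) (Γ Δ : Set Fm) : Setoid {t : Tm // t.In L} where
  r t u := Entails L Γ Δ (.eq t.1 u.1)
  iseqv := ⟨fun t => eq_refl t.2, eq_symm, eq_trans⟩

/-- The domain of the term model. -/
abbrev Dom (L : Lang) (Γ Δ : Set Fm) : Type := Quotient (setoid L Γ Δ)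

/-- The element of the term model denoted by a term. -/
abbrev Dom.mk (L : Lang) (Γ Δ : Set Fm) (t : Tm) (ht : t.In L) : Dom L Γ Δ :=
  Quotient.mk (setoid L Γ Δ) ⟨t, ht⟩

/-- A term denoting an element of the term model. -/
noncomputable def Dom.tm (x : Dom L Γ Δ) : Tm := x.out.1

theorem Dom.tm_in (x : Dom L Γ Δ) : x.tm.In L := x.out.2

theorem Dom.mk_tm (x : Dom L Γ Δ) : Dom.mk L Γ Δ x.tm x.tm_in = x := Quotient.out_eq x

theorem Dom.mk_eq {t u : Tm} {ht : t.In L} {hu : u.In L} :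
    Dom.mk L Γ Δ t ht = Dom.mk L Γ Δ u hu ↔ Entails L Γ Δ (.eq t u) :=
  Quotient.eq (r := setoid L Γ Δ)

theorem Dom.tm_mk {t : Tm} (ht : t.In L) : Entails L Γ Δ (.eq (Dom.mk L Γ Δ t ht).tm t) :=
  Dom.mk_eq (ht := Dom.tm_in _).1 (Dom.mk_tm _)

open Classical in
/-- The term model. -/
noncomputable def model (L : Lang) (Γ Δ : Set Fm) : Str where
  C := Dom L Γ Δ
  zero := .mk L Γ Δ .zero trivial
  succ x := .mk L Γ Δ (.succ x.tm) x.tm_in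
  add x y := .mk L Γ Δ (.add x.tm y.tm) ⟨x.tm_in, y.tm_in⟩
  mul x y := .mk L Γ Δ (.mul x.tm y.tm) ⟨x.tm_in, y.tm_in⟩
  fn k i xs := if h : L.fn k i then
      .mk L Γ Δ (.fn k i fun j => (xs j).tm) ⟨h, fun j => (xs j).tm_in⟩
    else .mk L Γ Δ .zero trivial
  rel k i xs := Entails L Γ Δ (.rel k i fun j => (xs j).tm)
  tr a x := Entails L Γ Δ (.tr a x.tm)

/-- The assignment of variables to themselves. -/
def asg (L : Lang) (Γ Δ : Set Fm) : ℕ → (model L Γ Δ).C := fun v => .mk L Γ Δ (.var v) trivial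

theorem eval_model (t : Tm) (ht : t.In L) :
    t.eval (model L Γ Δ) (asg L Γ Δ) = Dom.mk L Γ Δ t ht := by
  induction t with
  | var v => rfl
  | zero => rfl
  | succ t ih =>
    have h : (Tm.succ t).eval (model L Γ Δ) (asg L Γ Δ) =
        (model L Γ Δ).succ (Dom.mk L Γ Δ t ht) := by rw [Tm.eval, ih ht]
    rw [h]
    refine Dom.mk_eq.2 ?_
    exact leibniz_args (k := 1) (ts := fun _ => t) (us := fun _ => (Dom.mk L Γ Δ t ht).tm)
      (fun s => .eq (.succ (s 0)) (.succ t)) t.ub (fun s hs => ⟨hs 0, ht⟩) (fun _ _ _ => trivial)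
      (fun s v u hv => by simp [Fm.subst, Tm.subst, Tm.subst_of_ub_le hv])
      (fun _ => ht) (fun _ => Dom.tm_in _) (fun _ => eq_symm (Dom.tm_mk (t := t) ht)) (eq_refl ht)
  | add t u iht ihu =>
    have ht' : t.In L ∧ u.In L := ht
    have h : (Tm.add t u).eval (model L Γ Δ) (asg L Γ Δ) = (model L Γ Δ).add
        (Dom.mk L Γ Δ t ht.1) (Dom.mk L Γ Δ u ht.2) := by rw [Tm.eval, iht ht.1, ihu ht.2]
    rw [h]
    refine Dom.mk_eq.2 ?_
    exact leibniz_args (k := 2) (ts := ![t, u])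
      (us := ![(Dom.mk L Γ Δ t ht.1).tm, (Dom.mk L Γ Δ u ht.2).tm])
      (fun s => .eq (.add (s 0) (s 1)) (.add t u)) (max t.ub u.ub)
      (fun s hs => ⟨⟨hs 0, hs 1⟩, ht⟩) (fun _ _ _ => trivial)
      (fun s v w hv => by
        simp only [max_le_iff] at hv
        simp [Fm.subst, Tm.subst, Tm.subst_of_ub_le hv.1, Tm.subst_of_ub_le hv.2])
      (by simpa [Fin.forall_fin_two] using ht')
      (by simpa [Fin.forall_fin_two] using ⟨Dom.tm_in _, Dom.tm_in _⟩)
      (by simpa [Fin.forall_fin_two] using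
        ⟨eq_symm (Dom.tm_mk ht.1), eq_symm (Dom.tm_mk ht.2)⟩) (eq_refl ht)
  | mul t u iht ihu =>
    have ht' : t.In L ∧ u.In L := ht
    have h : (Tm.mul t u).eval (model L Γ Δ) (asg L Γ Δ) = (model L Γ Δ).mul
        (Dom.mk L Γ Δ t ht.1) (Dom.mk L Γ Δ u ht.2) := by rw [Tm.eval, iht ht.1, ihu ht.2]
    rw [h]
    refine Dom.mk_eq.2 ?_
    exact leibniz_args (k := 2) (ts := ![t, u])
      (us := ![(Dom.mk L Γ Δ t ht.1).tm, (Dom.mk L Γ Δ u ht.2).tm])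
      (fun s => .eq (.mul (s 0) (s 1)) (.mul t u)) (max t.ub u.ub)
      (fun s hs => ⟨⟨hs 0, hs 1⟩, ht⟩) (fun _ _ _ => trivial)
      (fun s v w hv => by
        simp only [max_le_iff] at hv
        simp [Fm.subst, Tm.subst, Tm.subst_of_ub_le hv.1, Tm.subst_of_ub_le hv.2])
      (by simpa [Fin.forall_fin_two] using ht')
      (by simpa [Fin.forall_fin_two] using ⟨Dom.tm_in _, Dom.tm_in _⟩)
      (by simpa [Fin.forall_fin_two] using
        ⟨eq_symm (Dom.tm_mk ht.1), eq_symm (Dom.tm_mk ht.2)⟩) (eq_refl ht)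
  | fn k i ts ih =>
    have h : (fun j => (ts j).eval (model L Γ Δ) (asg L Γ Δ)) =
      fun j => Dom.mk L Γ Δ (ts j) (ht.2 j) := funext fun j => ih j (ht.2 j)
    simp only [Tm.eval, h]
    simp only [model, ht.1, dif_pos]
    refine Dom.mk_eq.2 ?_
    exact leibniz_args (ts := ts) (us := fun j => (Dom.mk L Γ Δ (ts j) (ht.2 j)).tm)
      (fun s => .eq (.fn k i s) (.fn k i ts)) (Tm.fn k i ts).ub
      (fun s hs => ⟨⟨ht.1, hs⟩, ht⟩) (fun _ _ _ => trivial)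
      (fun s v w hv => by
        have := Tm.subst_of_ub_le hv w
        simp only [Tm.subst] at this
        simp [Fm.subst, Tm.subst, this])
      ht.2 (fun _ => Dom.tm_in _) (fun j => eq_symm (Dom.tm_mk (ht.2 j))) (eq_refl ht)

include hΔ

/-- Every element of the term model is denoted by variables of arbitrarily large index. -/
theorem exists_var (x : (model L Γ Δ).C) (n : ℕ) : ∃ w, n ≤ w ∧ x = asg L Γ Δ w := by
  obtain ⟨⟨t, ht⟩, rfl⟩ := Quotient.exists_rep x
  obtain ⟨v, hv1, hv2⟩ : ∃ v, n ≤ v ∧ t.ub ≤ v := ⟨_, le_max_left n t.ub, le_max_right _ _⟩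
  have hin : ((Fm.eq (.var v) t).not).In L := ⟨⟨trivial, ht⟩, trivial⟩
  have h : ¬ Entails L Γ Δ (.all v (Fm.not (.eq (.var v) t))) := fun h => by
    have := h.inst ht ⟨trivial, trivial⟩
    simp only [Fm.subst, Fm.not, Tm.subst, if_true,
      Tm.subst_of_ub_le hv2] at this
    exact hΔ.con ((eq_refl ht).mp' this)
  obtain ⟨w, -, h2, h3⟩ := hΔ.exists_witness hin h
  refine ⟨w, hv1.trans h2.le, ?_⟩
  simp only [Fm.subst, Fm.not, Tm.subst, if_true,
    Tm.subst_of_ub_le hv2] at h3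
  have hw : (Fm.eq (.var w) t).In L := ⟨trivial, ht⟩
  have : ¬ ¬ Entails L Γ Δ (.eq (.var w) t) := fun h => h3 ((hΔ.entails_not hw).2 h)
  exact (Dom.mk_eq.2 (not_not.1 this)).symm

theorem holds_model : ∀ (n : ℕ) (A : Fm), A.size = n → A.In L →
    (A.Holds (model L Γ Δ) (asg L Γ Δ) ↔ Entails L Γ Δ A) := by
  intro n
  induction n using Nat.strong_induction_on with
  | _ n ih =>
  intro A hn hA
  cases A with
  | bot => exact ⟨fun h => h.elim, hΔ.con⟩
  | eq t u =>
    simp only [Fm.Holds, eval_model _ hA.1, eval_model _ hA.2]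
    exact Dom.mk_eq
  | rel k i ts =>
    have h : (fun j => (ts j).eval (model L Γ Δ) (asg L Γ Δ)) =
      fun j => Dom.mk L Γ Δ (ts j) (hA.2 j) := funext fun j => eval_model _ (hA.2 j)
    simp only [Fm.Holds, h]
    constructor <;>
    refine leibniz_args (Fm.rel k i) 0 (fun s hs => ⟨hA.1, hs⟩) (fun _ _ _ => trivial)
      (fun _ _ _ _ => rfl) ?_ ?_ ?_
    · exact fun _ => Dom.tm_in _
    · exact hA.2
    · exact fun j => Dom.tm_mk (hA.2 j)
    · exact hA.2
    · exact fun _ => Dom.tm_in _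
    · exact fun j => eq_symm (Dom.tm_mk (hA.2 j))
  | tr a t =>
    simp only [Fm.Holds, eval_model _ hA.2]
    constructor <;>
    refine leibniz_args (k := 1) (ts := fun _ => _) (us := fun _ => _) (fun s => .tr a (s 0)) 0
      (fun s hs => ⟨hA.1, hs 0⟩) (fun _ _ _ => trivial)
      (fun _ _ _ _ => rfl) ?_ ?_ ?_
    · exact fun _ => Dom.tm_in _
    · exact fun _ => hA.2
    · exact fun j => Dom.tm_mk hA.2
    · exact fun _ => hA.2
    · exact fun _ => Dom.tm_in _
    · exact fun j => eq_symm (Dom.tm_mk hA.2)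
  | imp A B =>
    simp only [Fm.size] at hn
    rw [hΔ.entails_imp hA.1 hA.2, ← ih _ (by omega) A rfl hA.1, ← ih _ (by omega) B rfl hA.2]
    rfl
  | all v A =>
    simp only [Fm.size] at hn
    have hA : A.In L := hA
    have key : ∀ w, A.ub ≤ w → (A.Holds (model L Γ Δ)
        (Function.update (asg L Γ Δ) v (asg L Γ Δ w)) ↔
        Entails L Γ Δ (A.subst v (.var w))) := by
      intro w hw
      rw [← ih _ (by omega) (A.subst v (.var w)) (A.size_subst _ _)
        (Fm.in_subst hA (by trivial) v), Fm.holds_subst (Fm.freeFor_var_of_ub_le hw v)]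
      rfl
    constructor
    · intro h
      by_contra hc
      obtain ⟨w, hw, -, h1⟩ := hΔ.exists_witness hA hc
      exact h1 ((key w hw).1 (h _))
    · intro h x
      obtain ⟨w, hw, rfl⟩ := hΔ.exists_var x A.ub
      exact (key w hw).2 (h.inst (by trivial) (Fm.freeFor_var_of_ub_le hw v))

end Saturated

/-- Gödel's completeness theorem. -/
theorem Provable.of_holds {A : Fm} (hA : A.In L)
    (h : ∀ M : Str, (∀ B ∈ Γ, B.In L → ∀ r, B.Holds M r) → ∀ r, A.Holds M r) :
    Provable L Γ A := by
  by_contra hc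
  have hcon : ¬ Entails L Γ {A.not} .bot := by
    intro hb
    refine hc (der_empty (H := provableHilbert L Γ) (Der.by_contra hA ?_))
    exact hb.mono fun B hB hw => Entails.hyp' (Or.inl hB) hw
  obtain ⟨Δ, h1, h2⟩ := exists_saturated (Set.finite_singleton _) hcon
  have hM := h (Saturated.model L Γ Δ) (fun B hB hBL => by
    obtain ⟨C, hC, hs⟩ := B.exists_isUnivClosure
    refine hC.forall_holds.1 fun r => ?_
    rw [hs.holds_iff r (Saturated.asg L Γ Δ), h2.holds_model _ _ rfl (hC.in hBL)]
    exact .th (hC.provable (.ax hB hBL))) (Saturated.asg L Γ Δ)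
  rw [h2.holds_model _ _ rfl hA] at hM
  exact h2.con (hM.mp' (Entails.hyp' (h1 rfl) ⟨hA, trivial⟩))

end Completeness

/-! ### Definability with parameters and induction in models of arithmetic -/

section Definability

variable {M : Str}

theorem Tm.exists_simul_subst {L : Lang} (t : Tm) (ht : t.In L) (g : ℕ → Tm)
    (hg : ∀ i, (g i).In L) :
    ∃ u : Tm, u.In L ∧ ∀ r, u.eval M r = t.eval M fun i => (g i).eval M r := by
  induction t with
  | var v => exact ⟨g v, hg v, fun r => rfl⟩
  | zero => exact ⟨.zero, trivial, fun r => rfl⟩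
  | succ t ih =>
    obtain ⟨u, h1, h2⟩ := ih ht
    exact ⟨.succ u, h1, fun r => by simp only [Tm.eval, h2]⟩
  | add t t' ih ih' =>
    obtain ⟨u, h1, h2⟩ := ih ht.1
    obtain ⟨u', h1', h2'⟩ := ih' ht.2
    exact ⟨.add u u', ⟨h1, h1'⟩, fun r => by simp only [Tm.eval, h2, h2']⟩
  | mul t t' ih ih' =>
    obtain ⟨u, h1, h2⟩ := ih ht.1
    obtain ⟨u', h1', h2'⟩ := ih' ht.2
    exact ⟨.mul u u', ⟨h1, h1'⟩, fun r => by simp only [Tm.eval, h2, h2']⟩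
  | fn k i ts ih =>
    choose us h1 h2 using fun j => ih j (ht.2 j)
    exact ⟨.fn k i us, ⟨ht.1, h1⟩, fun r => by simp only [Tm.eval, h2]⟩

/-- Substitution of terms for all the variables, the bound variables being renamed. -/
theorem Fm.exists_simul_subst {L : Lang} (A : Fm) (hA : A.In L) (g : ℕ → Tm)
    (hg : ∀ i, (g i).In L) :
    ∃ B : Fm, B.In L ∧ ∀ r, B.Holds M r ↔ A.Holds M fun i => (g i).eval M r := by
  have ht := fun t ht => Tm.exists_simul_subst (M := M) (L := L) t ht g hg
  induction A generalizing g with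
  | bot => exact ⟨.bot, trivial, fun r => Iff.rfl⟩
  | eq t u =>
    obtain ⟨t', h1, h2⟩ := ht t hA.1
    obtain ⟨u', h3, h4⟩ := ht u hA.2
    exact ⟨.eq t' u', ⟨h1, h3⟩, fun r => by simp only [Fm.Holds, h2, h4]⟩
  | rel k i ts =>
    choose us h1 h2 using fun j => ht (ts j) (hA.2 j)
    exact ⟨.rel k i us, ⟨hA.1, h1⟩, fun r => by simp only [Fm.Holds, h2]⟩
  | tr a t =>
    obtain ⟨t', h1, h2⟩ := ht t hA.2
    exact ⟨.tr a t', ⟨hA.1, h1⟩, fun r => by simp only [Fm.Holds, h2]⟩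
  | imp A B ihA ihB =>
    obtain ⟨A', h1, h2⟩ := ihA hA.1 g hg ht
    obtain ⟨B', h3, h4⟩ := ihB hA.2 g hg ht
    exact ⟨.imp A' B', ⟨h1, h3⟩, fun r => by simp only [Fm.Holds, h2, h4]⟩
  | all v A ih =>
    clear ht
    obtain ⟨z, hz⟩ : ∃ z, ∀ i < A.ub, (g i).ub ≤ z :=
      ⟨(Finset.range A.ub).sup fun i => (g i).ub, fun i hi =>
        Finset.le_sup (f := fun i => (g i).ub) (Finset.mem_range.2 hi)⟩
    have hg' : ∀ i, (Function.update g v (.var z) i).In L := by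
      intro i
      by_cases hi : i = v
      · simp [hi, Tm.In]
      · simpa [hi] using hg i
    obtain ⟨B, h1, h2⟩ := ih hA (Function.update g v (.var z)) hg'
      fun t ht => Tm.exists_simul_subst t ht _ hg'
    refine ⟨.all z B, h1, fun r => forall_congr' fun x => ?_⟩
    rw [h2]
    refine Fm.holds_congr fun i hi => ?_
    by_cases hiv : i = v
    · simp [hiv, Tm.eval]
    · simp only [ne_eq, hiv, not_false_eq_true, Function.update_of_ne]
      refine Tm.eval_congr fun u hu => ?_
      have h3 := Tm.occ_lt_ub hu
      have h4 := hz i (Fm.free_lt_ub hi)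
      have : u ≠ z := by omega
      simp [this]

end Definability

section Definability

/-- The assignment that interleaves two assignments. -/
def mix {α : Type} (r e : ℕ → α) : ℕ → α := fun n => if n % 2 = 0 then r (n / 2) else e (n / 2)

/-- The assignment with first entry `x` followed by the entries of `r`. -/
def cons {α : Type} (x : α) (r : ℕ → α) : ℕ → α
  | 0 => x
  | n + 1 => r n

/-- The assignment `r` without its first entry. -/
def tail {α : Type} (r : ℕ → α) : ℕ → α := fun n => r (n + 1)

/-- The predicate of assignments is definable in `M` by a formula of `L` with parameters. -/
class DefP (L : Lang) (M : Str) (P : (ℕ → M.C) → Prop) : Prop where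
  out : ∃ A : Fm, A.In L ∧ ∃ e, ∀ r, P r ↔ A.Holds M (mix r e)

/-- The function of assignments is definable in `M` by a formula of `L` with parameters. -/
class DefF (L : Lang) (M : Str) (f : (ℕ → M.C) → M.C) : Prop where
  out : DefP L M fun r => r 0 = f (tail r)

/-- The map `g` of assignments drops some of the first entries. -/
class Drops {α : Type} (g : (ℕ → α) → ℕ → α) : Prop where
  out : ∃ k, ∀ r n, g r n = r (n + k)

instance {α : Type} : Drops (α := α) fun r => r := ⟨0, fun _ _ => rfl⟩

instance {α : Type} : Drops (α := α) tail := ⟨1, fun _ _ => rfl⟩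

instance {α : Type} (g : (ℕ → α) → ℕ → α) [h : Drops g] : Drops fun r => tail (g r) := by
  obtain ⟨k, hk⟩ := h
  exact ⟨k + 1, fun r n => by rw [tail, hk]; congr 1; omega⟩

namespace DefP

variable {L : Lang} {M : Str} {P Q : (ℕ → M.C) → Prop}

theorem congr (h : DefP L M P) (hPQ : ∀ r, P r ↔ Q r) : DefP L M Q :=
  funext (fun r => propext (hPQ r)) ▸ h

theorem of_fm {A : Fm} (hA : A.In L) (h : ∀ r, P r ↔ A.Holds M r) : DefP L M P := by
  obtain ⟨B, h1, h2⟩ := A.exists_simul_subst (M := M) hA (fun i => .var (2 * i)) fun _ => trivial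
  by_cases hne : Nonempty (ℕ → M.C)
  · obtain ⟨e⟩ := hne
    refine ⟨B, h1, e, fun r => ?_⟩
    rw [h, h2]
    simp [mix, Tm.eval]
  · exact (hne ⟨fun _ => M.zero⟩).elim

theorem rename (h : DefP L M P) (ρ : ℕ → ℕ) : DefP L M fun r => P fun i => r (ρ i) := by
  obtain ⟨A, hA, e, h⟩ := h
  obtain ⟨B, h1, h2⟩ := A.exists_simul_subst (M := M) hA
    (fun i => .var (if i % 2 = 0 then 2 * ρ (i / 2) else i)) fun _ => trivial
  refine ⟨B, h1, e, fun r => ?_⟩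
  rw [h, h2]
  refine Fm.holds_congr fun i _ => ?_
  rcases Nat.mod_two_eq_zero_or_one i with hi | hi <;> simp [mix, Tm.eval, hi]

instance false : DefP L M fun _ => False := of_fm (A := .bot) trivial fun _ => Iff.rfl

instance imp [hP : DefP L M P] [hQ : DefP L M Q] : DefP L M fun r => P r → Q r := by
  obtain ⟨A, hA, e, h⟩ := hP
  obtain ⟨B, hB, e', h'⟩ := hQ
  obtain ⟨A', h1, h2⟩ := A.exists_simul_subst (M := M) hA
    (fun i => .var (if i % 2 = 0 then i else 4 * (i / 2) + 1)) fun _ => trivial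
  obtain ⟨B', h3, h4⟩ := B.exists_simul_subst (M := M) hB
    (fun i => .var (if i % 2 = 0 then i else 4 * (i / 2) + 3)) fun _ => trivial
  refine ⟨.imp A' B', ⟨h1, h3⟩, mix e e', fun r => ?_⟩
  simp only [Fm.Holds]
  rw [h, h', h2, h4]
  refine imp_congr (Fm.holds_congr fun i _ => ?_) (Fm.holds_congr fun i _ => ?_)
  · rcases Nat.mod_two_eq_zero_or_one i with hi | hi
    · simp [mix, Tm.eval, hi]
    · have h1 : (4 * (i / 2) + 1) % 2 = 1 := by omega
      have h2 : (4 * (i / 2) + 1) / 2 = 2 * (i / 2) := by omega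
      simp [mix, Tm.eval, hi, h1, h2]
  · rcases Nat.mod_two_eq_zero_or_one i with hi | hi
    · simp [mix, Tm.eval, hi]
    · have h1 : (4 * (i / 2) + 3) % 2 = 1 := by omega
      have h2 : (4 * (i / 2) + 3) / 2 = 2 * (i / 2) + 1 := by omega
      have h3 : (2 * (i / 2) + 1) / 2 = i / 2 := by omega
      simp [mix, Tm.eval, hi, h1, h2, h3]

instance all {P : M.C → (ℕ → M.C) → Prop} [h : DefP L M fun r => P (r 0) (tail r)] :
    DefP L M fun r => ∀ x, P x r := by
  obtain ⟨A, hA, e, h⟩ := h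
  obtain ⟨B, h1, h2⟩ := A.exists_simul_subst (M := M) hA
    (fun i => .var (if i = 0 then A.ub else if i % 2 = 0 then i - 2 else i)) fun i => trivial
  refine ⟨.all A.ub B, h1, e, fun r => forall_congr' fun x => ?_⟩
  rw [h2, show P x r ↔ P (cons x r 0) (tail (cons x r)) from Iff.rfl, h]
  refine Fm.holds_congr fun i hi => ?_
  have := Fm.free_lt_ub hi
  rcases Nat.eq_zero_or_pos i with rfl | h0
  · simp [mix, Tm.eval, cons]
  · have h0' : i ≠ 0 := by omega
    rcases Nat.mod_two_eq_zero_or_one i with h3 | h3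
    · have h4 : i - 2 ≠ A.ub := by omega
      obtain ⟨k, rfl⟩ : ∃ k, i = 2 * k + 2 := ⟨i / 2 - 1, by omega⟩
      simp only [h0', h3, if_true, if_false, Tm.eval, ne_eq, h4, not_false_eq_true,
        Function.update_of_ne, mix]
      have h5 : (2 * k + 2) / 2 = k + 1 := by omega
      simp [h5, cons]
    · have h4 : i ≠ A.ub := by omega
      simp [h0', h3, Tm.eval, h4, mix]

instance not [DefP L M P] : DefP L M fun r => ¬ P r := imp (Q := fun _ => False)

instance and [DefP L M P] [DefP L M Q] : DefP L M fun r => P r ∧ Q r :=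
  (inferInstance : DefP L M fun r => ¬ (P r → ¬ Q r)).congr fun r => by tauto

instance or [DefP L M P] [DefP L M Q] : DefP L M fun r => P r ∨ Q r :=
  (inferInstance : DefP L M fun r => ¬ P r → Q r).congr fun r => by tauto

instance iff [DefP L M P] [DefP L M Q] : DefP L M fun r => P r ↔ Q r :=
  (inferInstance : DefP L M fun r => (P r → Q r) ∧ (Q r → P r)).congr fun r => by tauto

instance ex {P : M.C → (ℕ → M.C) → Prop} [DefP L M fun r => P (r 0) (tail r)] :
    DefP L M fun r => ∃ x, P x r :=
  (inferInstance : DefP L M fun r => ¬ ∀ x, ¬ P x r).congr fun r => by simp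

theorem inst {P : M.C → (ℕ → M.C) → Prop} (hP : DefP L M fun r => P (r 0) (tail r))
    {f : (ℕ → M.C) → M.C} (hf : DefF L M f) : DefP L M fun r => P (f r) r := by
  have := hf.out
  exact (inferInstance : DefP L M fun r => ∃ y, y = f r ∧ P y r).congr fun r => by simp

instance eq_base : DefP L M fun r => r 0 = r 1 :=
  of_fm (A := .eq (.var 0) (.var 1)) ⟨trivial, trivial⟩ fun _ => Iff.rfl

end DefP

namespace DefF

variable {L : Lang} {M : Str} {f g h k : (ℕ → M.C) → M.C}

instance var (g : (ℕ → M.C) → ℕ → M.C) [h : Drops g] (n : ℕ) : DefF L M fun r => g r n := by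
  obtain ⟨k, hk⟩ := h
  exact ⟨(DefP.eq_base.rename fun i => if i = 0 then 0 else n + k + 1).congr fun r => by
    simp [hk, tail]⟩

instance const (c : M.C) : DefF L M fun _ => c := by
  refine ⟨.eq (.var 0) (.var 1), ⟨trivial, trivial⟩, fun _ => c, fun r => ?_⟩
  simp [Fm.Holds, Tm.eval, mix]

theorem tail (hf : DefF L M f) : DefF L M fun r => f (tail r) :=
  ⟨(hf.out.rename fun i => if i = 0 then 0 else i + 1).congr fun r => by
    have : IteratedTruth.tail (fun i => r (if i = 0 then 0 else i + 1)) =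
      IteratedTruth.tail (IteratedTruth.tail r) := by
      funext i; simp [IteratedTruth.tail]
    simp [this]⟩

end DefF

namespace DefP

variable {L : Lang} {M : Str} {f g h k l : (ℕ → M.C) → M.C}

theorem comp1 {P : M.C → Prop} (hP : DefP L M fun r => P (r 0)) (hf : DefF L M f) :
    DefP L M fun r => P (f r) :=
  inst (P := fun x _ => P x) hP hf

theorem comp2 {P : M.C → M.C → Prop} (hP : DefP L M fun r => P (r 0) (r 1)) (hf : DefF L M f)
    (hg : DefF L M g) : DefP L M fun r => P (f r) (g r) :=
  inst (P := fun x r => P x (g r))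
    (inst (P := fun y r => P (r 0) y)
      ((hP.rename fun i => if i = 0 then 1 else 0).congr fun r => by simp [tail]) hg.tail) hf

theorem comp3 {P : M.C → M.C → M.C → Prop} (hP : DefP L M fun r => P (r 0) (r 1) (r 2))
    (hf : DefF L M f) (hg : DefF L M g) (hh : DefF L M h) :
    DefP L M fun r => P (f r) (g r) (h r) :=
  inst (P := fun x r => P x (g r) (h r)) (inst (P := fun y r => P (r 0) y (h (tail r)))
    (inst (P := fun z r => P (r 1) (r 0) z)
      ((hP.rename fun i => 2 - i).congr fun r => by simp [tail]) hh.tail.tail) hg.tail) hf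

theorem comp4 {P : M.C → M.C → M.C → M.C → Prop}
    (hP : DefP L M fun r => P (r 0) (r 1) (r 2) (r 3))
    (hf : DefF L M f) (hg : DefF L M g) (hh : DefF L M h) (hk : DefF L M k) :
    DefP L M fun r => P (f r) (g r) (h r) (k r) :=
  inst (P := fun x r => P x (g r) (h r) (k r))
    (inst (P := fun y r => P (r 0) y (h (tail r)) (k (tail r)))
    (inst (P := fun z r => P (r 1) (r 0) z (k (tail (tail r))))
    (inst (P := fun z r => P (r 2) (r 1) (r 0) z)
      ((hP.rename fun i => 3 - i).congr fun r => by simp [tail]) hk.tail.tail.tail)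
      hh.tail.tail) hg.tail) hf

instance eq [hf : DefF L M f] [hg : DefF L M g] : DefP L M fun r => f r = g r :=
  comp2 eq_base hf hg

end DefP

namespace DefF

variable {L : Lang} {M : Str} {f g h k : (ℕ → M.C) → M.C}

theorem comp1 {F : M.C → M.C} (hF : DefP L M fun r => r 0 = F (r 1)) (hf : DefF L M f) :
    DefF L M fun r => F (f r) :=
  ⟨DefP.comp2 (P := fun x y => x = F y) hF (var (fun r => r) 0) hf.tail⟩

theorem comp2 {F : M.C → M.C → M.C} (hF : DefP L M fun r => r 0 = F (r 1) (r 2))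
    (hf : DefF L M f) (hg : DefF L M g) : DefF L M fun r => F (f r) (g r) :=
  ⟨DefP.comp3 (P := fun x y z => x = F y z) hF (var (fun r => r) 0) hf.tail hg.tail⟩

instance zero : DefF L M fun _ => M.zero := inferInstance

instance succ [hf : DefF L M f] : DefF L M fun r => M.succ (f r) :=
  comp1 (.of_fm (A := .eq (.var 0) (.succ (.var 1))) ⟨trivial, trivial⟩ fun _ => Iff.rfl) hf

instance add [hf : DefF L M f] [hg : DefF L M g] : DefF L M fun r => M.add (f r) (g r) :=
  comp2 (.of_fm (A := .eq (.var 0) (.add (.var 1) (.var 2))) ⟨trivial, trivial, trivial⟩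
    fun _ => Iff.rfl) hf hg

instance mul [hf : DefF L M f] [hg : DefF L M g] : DefF L M fun r => M.mul (f r) (g r) :=
  comp2 (.of_fm (A := .eq (.var 0) (.mul (.var 1) (.var 2))) ⟨trivial, trivial, trivial⟩
    fun _ => Iff.rfl) hf hg

end DefF

/-- A formula in a language containing `T_a` can use `T_a`. -/
theorem DefP.tr {L : Lang} {M : Str} {f : (ℕ → M.C) → M.C} {a : ℕ} (ha : L.tr a)
    (hf : DefF L M f) : DefP L M fun r => M.tr a (f r) :=
  comp1 (.of_fm (A := .tr a (.var 0)) ⟨ha, trivial⟩ fun _ => Iff.rfl) hf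

/-- The structure satisfies the induction scheme for formulas of `L`. -/
class Inductive (L : Lang) (M : Str) : Prop where
  out : ∀ v A, A.In L → ∀ r, (Fm.ind v A).Holds M r

theorem Fm.freeFor_succ (A : Fm) (v : ℕ) : A.FreeFor v (.succ (.var v)) := by
  induction A with
  | imp A B ihA ihB => exact ⟨ihA, ihB⟩
  | all w A ih =>
    by_cases h : w = v
    · exact .inl h
    · exact .inr ⟨ih, fun e => (h e.symm).elim⟩
  | _ => trivial

theorem Fm.freeFor_of_not_occ {t : Tm} (ht : ∀ v, ¬ t.Occ v) (A : Fm) (v : ℕ) :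
    A.FreeFor v t := by
  induction A with
  | imp A B ihA ihB => exact ⟨ihA, ihB⟩
  | all w A ih => exact .inr ⟨ih, fun e => (ht _ e).elim⟩
  | _ => trivial

theorem Fm.holds_ind {M : Str} {v : ℕ} {A : Fm} {r : ℕ → M.C} : (Fm.ind v A).Holds M r ↔
    (A.Holds M (Function.update r v M.zero) →
    (∀ x, A.Holds M (Function.update r v x) → A.Holds M (Function.update r v (M.succ x))) →
    ∀ x, A.Holds M (Function.update r v x)) := by
  simp [Fm.ind, Fm.and, Fm.not, Fm.Holds, Fm.holds_subst (Fm.freeFor_succ A v),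
    Fm.holds_subst (Fm.freeFor_of_not_occ (t := .zero) (fun _ => id) A v), Tm.eval]

theorem Inductive.ind {L : Lang} {M : Str} [h : Inductive L M] {P : M.C → Prop}
    (hP : DefP L M fun r => P (r 0)) (h0 : P M.zero) (hs : ∀ x, P x → P (M.succ x)) (x : M.C) :
    P x := by
  obtain ⟨A, hA, e, hP⟩ := hP
  have key : ∀ x, A.Holds M (Function.update (mix (fun _ => M.zero) e) 0 x) ↔ P x := by
    intro x
    rw [show P x ↔ _ from hP (fun i => if i = 0 then x else M.zero)]
    refine Fm.holds_congr fun i _ => ?_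
    rcases Nat.eq_zero_or_pos i with rfl | h0
    · simp [mix]
    · have h0' : i ≠ 0 := by omega
      rcases Nat.mod_two_eq_zero_or_one i with h3 | h3
      · have : i / 2 ≠ 0 := by omega
        simp [mix, h0', h3, this]
      · simp [mix, h0', h3]
  have := Fm.holds_ind.1 (h.out 0 A hA (mix (fun _ => M.zero) e))
  simp only [key] at this
  exact this h0 hs x

end Definability

/-! ### Models of Peano arithmetic as ordered semirings -/

section Arithmetic

/-- The structure is a model of Peano arithmetic. -/
class PAModel (M : Str) : Prop where
  out : ∀ A ∈ PA, ∀ r, A.Holds M r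

instance (M : Str) [h : PAModel M] : Inductive Lang.arith M :=
  ⟨fun v A hA r => h.out _ (.ind v A hA) r⟩

variable {M : Str}

instance : Zero M.C := ⟨M.zero⟩
instance : One M.C := ⟨M.succ M.zero⟩
instance : Add M.C := ⟨M.add⟩
instance : Mul M.C := ⟨M.mul⟩

instance {L : Lang} {f g : (ℕ → M.C) → M.C} [DefF L M f] [DefF L M g] :
    DefF L M fun r => f r + g r := DefF.add

instance {L : Lang} {f g : (ℕ → M.C) → M.C} [DefF L M f] [DefF L M g] :
    DefF L M fun r => f r * g r := DefF.mul

namespace PAModel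

variable [h : PAModel M]

theorem add_zero' (x : M.C) : x + 0 = x := h.out _ .add_zero (fun _ => x) x

theorem succ_eq (x : M.C) : M.succ x = x + 1 := by
  have := h.out _ .add_succ (fun _ => x) x M.zero
  simp only [Fm.Holds, Tm.eval] at this
  simp at this
  exact ((this.trans (congrArg M.succ (add_zero' x)))).symm

theorem add_succ' (x y : M.C) : x + (y + 1) = x + y + 1 := by
  have := h.out _ .add_succ (fun _ => x) x y
  simp only [Fm.Holds, Tm.eval] at this
  simp at this
  rw [← succ_eq, ← succ_eq]
  exact this

theorem mul_zero' (x : M.C) : x * 0 = 0 := h.out _ .mul_zero (fun _ => x) x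

theorem mul_succ' (x y : M.C) : x * (y + 1) = x * y + x := by
  have := h.out _ .mul_succ (fun _ => x) x y
  simp only [Fm.Holds, Tm.eval] at this
  simp at this
  rw [← succ_eq]
  exact this

theorem succ_ne (x : M.C) : x + 1 ≠ 0 := by
  have := h.out _ .succ_ne (fun _ => x) x
  rw [← succ_eq]
  exact this

theorem succ_inj' {x y : M.C} (e : x + 1 = y + 1) : x = y := by
  have := h.out _ .succ_inj (fun _ => x) x y
  simp only [Fm.Holds, Tm.eval] at this
  simp at this
  rw [← succ_eq, ← succ_eq] at e
  exact this e

/-- Induction for predicates definable with parameters. -/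
theorem ind {L : Lang} [Inductive L M] {P : M.C → Prop}
    (hP : DefP L M fun r => P (r 0)) (h0 : P 0) (hs : ∀ x, P x → P (x + 1)) (x : M.C) :
    P x :=
  Inductive.ind hP h0 (fun x hx => by rw [succ_eq]; exact hs x hx) x

/-- Induction for arithmetical predicates. -/
theorem ind₀ {P : M.C → Prop}
    (hP : DefP Lang.arith M fun r => P (r 0)) (h0 : P 0) (hs : ∀ x, P x → P (x + 1)) (x : M.C) :
    P x :=
  ind hP h0 hs x

theorem zero_add' (x : M.C) : 0 + x = x := by
  refine ind₀ (P := fun x => 0 + x = x) inferInstance (add_zero' 0) (fun x hx => ?_) x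
  rw [add_succ', hx]

theorem succ_add' (x y : M.C) : x + 1 + y = x + y + 1 := by
  refine ind₀ (P := fun y => x + 1 + y = x + y + 1) inferInstance ?_ (fun y hy => ?_) y
  · rw [add_zero', add_zero']
  · rw [add_succ', add_succ', hy]

theorem add_comm' (x y : M.C) : x + y = y + x := by
  refine ind₀ (P := fun y => x + y = y + x) inferInstance ?_ (fun y hy => ?_) y
  · rw [add_zero', zero_add']
  · rw [add_succ', succ_add', hy]

theorem add_assoc' (x y z : M.C) : x + y + z = x + (y + z) := by
  refine ind₀ (P := fun z => x + y + z = x + (y + z)) inferInstance ?_ (fun z hz => ?_) z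
  · rw [add_zero', add_zero']
  · rw [add_succ', add_succ', add_succ', hz]

theorem zero_mul' (x : M.C) : 0 * x = 0 := by
  refine ind₀ (P := fun x => 0 * x = 0) inferInstance (mul_zero' 0) (fun x hx => ?_) x
  rw [mul_succ', hx, add_zero']

theorem succ_mul' (x y : M.C) : (x + 1) * y = x * y + y := by
  refine ind₀ (P := fun y => (x + 1) * y = x * y + y) inferInstance ?_ (fun y hy => ?_) y
  · rw [mul_zero', mul_zero', add_zero']
  · rw [mul_succ', mul_succ', hy, add_succ', add_succ', add_assoc' (x * y), add_comm' y x,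
      ← add_assoc']

theorem mul_comm' (x y : M.C) : x * y = y * x := by
  refine ind₀ (P := fun y => x * y = y * x) inferInstance ?_ (fun y hy => ?_) y
  · rw [mul_zero', zero_mul']
  · rw [mul_succ', succ_mul', hy]

theorem mul_add' (x y z : M.C) : x * (y + z) = x * y + x * z := by
  refine ind₀ (P := fun z => x * (y + z) = x * y + x * z) inferInstance ?_ (fun z hz => ?_) z
  · rw [add_zero', mul_zero', add_zero']
  · rw [add_succ', mul_succ', mul_succ', hz, add_assoc']

theorem mul_assoc' (x y z : M.C) : x * y * z = x * (y * z) := by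
  refine ind₀ (P := fun z => x * y * z = x * (y * z)) inferInstance ?_ (fun z hz => ?_) z
  · rw [mul_zero', mul_zero', mul_zero']
  · rw [mul_succ', mul_succ', mul_add', hz]

theorem mul_one' (x : M.C) : x * 1 = x := by
  rw [← zero_add' 1, mul_succ', mul_zero', zero_add']

instance : CommSemiring M.C where
  add_assoc := add_assoc'
  zero_add := zero_add'
  add_zero := add_zero'
  add_comm := add_comm'
  mul_assoc := mul_assoc'
  one_mul x := by rw [mul_comm', mul_one']
  mul_one := mul_one'
  zero_mul := zero_mul'
  mul_zero := mul_zero'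
  left_distrib := mul_add'
  right_distrib x y z := by rw [mul_comm', mul_add', mul_comm' z, mul_comm' z]
  mul_comm := mul_comm'
  nsmul := nsmulRec

theorem add_right_cancel' {x y z : M.C} (e : x + z = y + z) : x = y := by
  have : x + z = y + z → x = y := by
    refine ind₀ (P := fun z => x + z = y + z → x = y) inferInstance ?_ (fun z hz e => ?_) z
    · simp
    · exact hz (succ_inj' (by rw [← add_assoc, ← add_assoc] at e; exact e))
  exact this e

theorem eq_zero_or_succ (x : M.C) : x = 0 ∨ ∃ y, x = y + 1 :=
  ind₀ (P := fun x => x = 0 ∨ ∃ y, x = y + 1) inferInstance (.inl rfl)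
    (fun x _ => .inr ⟨x, rfl⟩) x

theorem eq_zero_of_add {x y : M.C} (e : x + y = 0) : x = 0 := by
  rcases eq_zero_or_succ x with rfl | ⟨z, rfl⟩
  · rfl
  · exact (succ_ne (z + y) (by rw [← e]; ring)).elim

theorem le_total' (x y : M.C) : (∃ w, x + w = y) ∨ ∃ w, y + w = x := by
  refine ind₀ (P := fun x => (∃ w, x + w = y) ∨ ∃ w, y + w = x) inferInstance
    (.inl ⟨y, zero_add y⟩) (fun x hx => ?_) x
  rcases hx with ⟨w, rfl⟩ | ⟨w, rfl⟩
  · rcases eq_zero_or_succ w with rfl | ⟨z, rfl⟩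
    · exact .inr ⟨1, by ring⟩
    · exact .inl ⟨z, by ring⟩
  · exact .inr ⟨w + 1, by ring⟩

open Classical in
noncomputable instance : LinearOrder M.C where
  le x y := ∃ w, x + w = y
  le_refl x := ⟨0, add_zero x⟩
  le_trans := by
    rintro x _ _ ⟨v, rfl⟩ ⟨w, rfl⟩
    exact ⟨v + w, by ring⟩
  le_antisymm := by
    rintro x _ ⟨v, rfl⟩ ⟨w, e⟩
    have : v + w = 0 := add_right_cancel' (z := x) (by rw [zero_add]; nth_rw 2 [← e]; ring)
    rw [eq_zero_of_add this, add_zero]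
  le_total := le_total'
  toDecidableLE := Classical.decRel _

theorem le_def {x y : M.C} : x ≤ y ↔ ∃ w, x + w = y := Iff.rfl

theorem lt_def {x y : M.C} : x < y ↔ ∃ w, x + 1 + w = y := by
  constructor
  · intro h
    obtain ⟨w, rfl⟩ := h.le
    rcases eq_zero_or_succ w with rfl | ⟨z, rfl⟩
    · simp at h
    · exact ⟨z, by ring⟩
  · rintro ⟨w, rfl⟩
    refine lt_of_le_of_ne ⟨1 + w, by ring⟩ fun e => ?_
    refine succ_ne w (add_right_cancel' (z := x) ?_)
    rw [zero_add]
    nth_rw 2 [e]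
    ring

theorem lt_iff {x y : M.C} : x < y ↔ x + 1 ≤ y := lt_def

instance : IsOrderedAddMonoid M.C where
  add_le_add_left := by
    rintro x _ ⟨w, rfl⟩ z
    exact ⟨w, by ring⟩

instance : IsOrderedCancelAddMonoid M.C where
  le_of_add_le_add_left := by
    rintro x y z ⟨w, e⟩
    exact ⟨w, add_right_cancel' (z := x) (by rw [add_comm z x, ← e]; ring)⟩

instance : IsStrictOrderedRing M.C where
  zero_le_one := ⟨1, zero_add 1⟩
  exists_pair_ne := ⟨0, 1, fun e => succ_ne (M := M) 0 ((zero_add (1 : M.C)).trans e.symm)⟩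
  mul_lt_mul_of_pos_left := by
    intro x hx y z hyz
    obtain ⟨w, rfl⟩ := lt_def.1 hx
    obtain ⟨v, rfl⟩ := lt_def.1 hyz
    exact lt_def.2 ⟨w + v + w * v, by ring⟩
  mul_lt_mul_of_pos_right := by
    intro x hx y z hyz
    obtain ⟨w, rfl⟩ := lt_def.1 hx
    obtain ⟨v, rfl⟩ := lt_def.1 hyz
    exact lt_def.2 ⟨w + v + w * v, by ring⟩

instance : CanonicallyOrderedAdd M.C where
  exists_add_of_le := by rintro x _ ⟨w, rfl⟩; exact ⟨w, rfl⟩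
  le_add_self x y := ⟨y, by ring⟩
  le_self_add x y := ⟨y, rfl⟩

instance {L : Lang} {f g : (ℕ → M.C) → M.C} [DefF L M f] [DefF L M g] :
    DefP L M fun r => f r ≤ g r :=
  (DefP.comp2 (P := fun x y : M.C => ∃ w, x + w = y) inferInstance ‹_› ‹_›)

instance {L : Lang} {f g : (ℕ → M.C) → M.C} [DefF L M f] [DefF L M g] :
    DefP L M fun r => f r < g r :=
  (inferInstance : DefP L M fun r => f r + 1 ≤ g r).congr fun _ => lt_iff.symm

theorem lt_succ {x y : M.C} : x < y + 1 ↔ x ≤ y := by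
  rw [lt_iff]
  exact add_le_add_iff_right 1

/-- Strong induction. -/
theorem strong_ind {L : Lang} [Inductive L M] {P : M.C → Prop}
    (hP : DefP L M fun r => P (r 0)) (hs : ∀ x, (∀ y < x, P y) → P x) (x : M.C) : P x := by
  have hP' := fun f [hf : DefF L M f] => hP.comp1 hf
  have key : ∀ x, ∀ y < x, P y := by
    refine ind (L := L) (P := fun x => ∀ y < x, P y) inferInstance
      (fun y hy => (not_lt_zero hy).elim) fun x hx y hy => ?_
    rcases (lt_succ.1 hy).lt_or_eq with h | rfl
    · exact hx y h
    · exact hs y hx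
  exact hs x (key x)


end PAModel
end Arithmetic

/-! ### Pairing, coding of sequences and generated classes in models of arithmetic -/

section Coding

variable {M : Str} [PAModel M]

open PAModel

/-- The pairing function of a model of arithmetic. -/
noncomputable def pr (x y : M.C) : M.C := if x < y then y * y + x else x * x + x + y

theorem eq_pr_iff {x y z : M.C} :
    z = pr x y ↔ (x < y ∧ z = y * y + x) ∨ (y ≤ x ∧ z = x * x + x + y) := by
  unfold pr
  split_ifs with h
  · simp [h, not_le.2 h]
  · simp [h, not_lt.1 h]

theorem pr_bounds (x y : M.C) :
    max x y * max x y ≤ pr x y ∧ pr x y < (max x y + 1) * (max x y + 1) := by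
  unfold pr
  split_ifs with h
  · rw [max_eq_right h.le]
    obtain ⟨w, rfl⟩ := lt_def.1 h
    exact ⟨le_self_add, lt_def.2 ⟨x + 2 + w + w, by ring⟩⟩
  · obtain ⟨w, rfl⟩ := le_def.1 (not_lt.1 h)
    rw [max_eq_left (not_lt.1 h)]
    exact ⟨le_def.2 ⟨y + w + y, by ring⟩, lt_def.2 ⟨w, by ring⟩⟩

theorem pr_inj {x y x' y' : M.C} : pr x y = pr x' y' ↔ x = x' ∧ y = y' := by
  refine ⟨fun e => ?_, fun ⟨h1, h2⟩ => by rw [h1, h2]⟩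
  have key : ∀ x y x' y' : M.C, pr x y = pr x' y' → ¬ max x y < max x' y' := by
    intro x y x' y' e h
    have h1 := (pr_bounds x y).2
    have h2 := (pr_bounds x' y').1
    rw [e] at h1
    exact absurd (mul_le_mul' (lt_iff.1 h) (lt_iff.1 h)) (not_le.2 (h2.trans_lt h1))
  have hm : max x y = max x' y' :=
    le_antisymm (not_lt.1 (key _ _ _ _ e.symm)) (not_lt.1 (key _ _ _ _ e))
  unfold pr at e
  split_ifs at e with h h' h'
  · rw [max_eq_right h.le, max_eq_right h'.le] at hm
    subst hm
    exact ⟨add_left_cancel e, rfl⟩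
  · rw [max_eq_right h.le, max_eq_left (not_lt.1 h')] at hm
    subst hm
    rw [add_assoc] at e
    have := add_left_cancel e
    rw [this] at h
    exact absurd h (not_lt.2 le_self_add)
  · rw [max_eq_left (not_lt.1 h), max_eq_right h'.le] at hm
    subst hm
    rw [add_assoc] at e
    have := add_left_cancel e
    rw [← this] at h'
    exact absurd h' (not_lt.2 le_self_add)
  · rw [max_eq_left (not_lt.1 h), max_eq_left (not_lt.1 h')] at hm
    subst hm
    exact ⟨rfl, add_left_cancel e⟩

theorem natCast_pair (m n : ℕ) : ((Nat.pair m n : ℕ) : M.C) = pr (m : M.C) n := by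
  unfold pr Nat.pair
  simp only [Nat.cast_lt]
  split_ifs <;> push_cast <;> rfl

instance {L : Lang} {f g : (ℕ → M.C) → M.C} [hf : DefF L M f] [hg : DefF L M g] :
    DefF L M fun r => pr (f r) (g r) :=
  DefF.comp2 (F := pr) ((inferInstance : DefP L M fun r : ℕ → M.C =>
    (r 1 < r 2 ∧ r 0 = r 2 * r 2 + r 1) ∨ (r 2 ≤ r 1 ∧ r 0 = r 1 * r 1 + r 1 + r 2)).congr
    fun _ => eq_pr_iff.symm) hf hg

/-- `y` is the `i`-th entry of the sequence coded by `p, q`. -/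
def Beta (p q i y : M.C) : Prop :=
  y ≤ (i + 1) * q ∧ ∃ w, p = w * ((i + 1) * q + 1) + y

instance {L : Lang} {f g h k : (ℕ → M.C) → M.C} [hf : DefF L M f] [hg : DefF L M g]
    [hh : DefF L M h] [hk : DefF L M k] : DefP L M fun r => Beta (f r) (g r) (h r) (k r) :=
  DefP.comp4 (P := Beta) (inferInstance : DefP L M fun r : ℕ → M.C =>
    r 3 ≤ (r 2 + 1) * r 1 ∧ ∃ w, r 0 = w * ((r 2 + 1) * r 1 + 1) + r 3) hf hg hh hk

theorem Beta.unique {p q i y y' : M.C} (h : Beta p q i y) (h' : Beta p q i y') : y = y' := by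
  have key : ∀ w y w' y' m : M.C, y ≤ m → y' ≤ m → w * (m + 1) + y = w' * (m + 1) + y' →
      ¬ w < w' := by
    intro w y w' y' m h h' e hw
    obtain ⟨v, rfl⟩ := lt_def.1 hw
    obtain ⟨z, rfl⟩ := le_def.1 h
    have : y = (y + z + 1) + (v * (y + z + 1) + y') :=
      add_left_cancel (a := w * (y + z + 1)) (by rw [e]; ring)
    have h1 : y < y + z + 1 := lt_succ.2 le_self_add
    exact absurd this (h1.trans_le le_self_add).ne
  obtain ⟨h1, w, hw⟩ := h
  obtain ⟨h1', w', hw'⟩ := h'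
  have e := hw.symm.trans hw'
  have : w = w' := le_antisymm (not_lt.1 (key _ _ _ _ _ h1' h1 e.symm))
    (not_lt.1 (key _ _ _ _ _ h1 h1' e))
  subst this
  exact add_left_cancel e

/-- The moduli used by the beta function are invertible modulo each other. -/
theorem exists_modular_inverse {q k d e : M.C} (hq : q = d * e) :
    ∃ u w : M.C, u * ((k + 1) * q + 1) = w * ((k + d + 1) * q + 1) + 1 := by
  rcases eq_zero_or_succ ((k + d + 1) * q) with h | ⟨s, hs⟩
  · have hq0 : q = 0 := by
      rcases mul_eq_zero.1 h with h | h
      · exact (succ_ne _ h).elim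
      · exact h
    exact ⟨1, 0, by rw [hq0]; ring⟩
  · refine ⟨(s + 1) * (k + d + 1) * (k + d + 1) * e,
      (s + 1) * (k + d + 1) * (k + 1) * e + s, ?_⟩
    have h1 : (k + d + 1) * e * ((k + 1) * q + 1) = (k + 1) * e * ((k + d + 1) * q + 1) + q := by
      rw [hq]; ring
    calc (s + 1) * (k + d + 1) * (k + d + 1) * e * ((k + 1) * q + 1)
        = (s + 1) * (k + d + 1) * ((k + d + 1) * e * ((k + 1) * q + 1)) := by ring
      _ = (s + 1) * (k + d + 1) * (k + 1) * e * ((k + d + 1) * q + 1) +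
          (s + 1) * ((k + d + 1) * q) := by rw [h1]; ring
      _ = (s + 1) * (k + d + 1) * (k + 1) * e * ((k + d + 1) * q + 1) +
          (s * ((k + d + 1) * q + 1) + 1) := by rw [hs]; ring
      _ = _ := by ring

/-- Every definable sequence is coded: a definable relation has a choice function on an initial
segment that is given by the beta function. -/
theorem exists_beta {L : Lang} [Inductive L M] {R : M.C → M.C → Prop}
    (hR : DefP L M fun r => R (r 0) (r 1)) {n : M.C} (h : ∀ i < n, ∃ y, R i y) :
    ∃ p q, ∀ i < n, ∃ y, Beta p q i y ∧ R i y := by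
  have hR' := fun f g [hf : DefF L M f] [hg : DefF L M g] => hR.comp2 hf hg
  -- a common bound for the entries
  obtain ⟨B, hB⟩ : ∃ B, ∀ i < n, ∃ y ≤ B, R i y := by
    have : ∀ k, k ≤ n → ∃ B, ∀ i < k, ∃ y ≤ B, R i y := by
      refine ind (L := L) (P := fun k => k ≤ n → ∃ B, ∀ i < k, ∃ y ≤ B, R i y) inferInstance
        (fun _ => ⟨0, fun i hi => (not_lt_zero hi).elim⟩) fun k ih hk => ?_
      obtain ⟨B, hB⟩ := ih ((le_def.2 ⟨1, rfl⟩).trans hk)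
      obtain ⟨y, hy⟩ := h k (lt_iff.2 hk)
      refine ⟨max B y, fun i hi => ?_⟩
      rcases (lt_succ.1 hi).lt_or_eq with h1 | rfl
      · obtain ⟨z, h2, h3⟩ := hB i h1
        exact ⟨z, le_max_of_le_left h2, h3⟩
      · exact ⟨y, le_max_right _ _, hy⟩
    exact this n le_rfl
  -- a common multiple of the differences of indices
  obtain ⟨q, hq, hd⟩ : ∃ q, B ≤ q ∧ ∀ j, 0 < j → j ≤ n → ∃ e, q = j * e := by
    refine ind (L := L) (P := fun n => ∃ q, B ≤ q ∧ ∀ j, 0 < j → j ≤ n → ∃ e, q = j * e)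
      inferInstance ⟨B, le_rfl, fun j h0 h1 => absurd h0 (not_lt.2 h1)⟩ (fun k hk => ?_) n
    obtain ⟨q, h1, h2⟩ := hk
    refine ⟨q * (k + 1), h1.trans (le_def.2 ⟨q * k, by ring⟩), fun j h3 h4 => ?_⟩
    rcases h4.lt_or_eq with h5 | rfl
    · obtain ⟨e, rfl⟩ := h2 j h3 (lt_succ.1 h5)
      exact ⟨e * (k + 1), by ring⟩
    · exact ⟨q, by ring⟩
  -- the Chinese remainder theorem, one modulus at a time
  have key : ∀ k, k ≤ n → ∃ p N, (∀ i < k, ∃ y ≤ B, R i y ∧ ∃ w, p = w * ((i + 1) * q + 1) + y) ∧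
      (∀ i < k, ∃ w, N = w * ((i + 1) * q + 1)) ∧
      ∀ j, k ≤ j → j < n → ∃ u w, u * N = w * ((j + 1) * q + 1) + 1 := by
    refine ind (L := L) (P := fun k => k ≤ n → ∃ p N,
      (∀ i < k, ∃ y ≤ B, R i y ∧ ∃ w, p = w * ((i + 1) * q + 1) + y) ∧
      (∀ i < k, ∃ w, N = w * ((i + 1) * q + 1)) ∧
      ∀ j, k ≤ j → j < n → ∃ u w, u * N = w * ((j + 1) * q + 1) + 1) inferInstance
      (fun _ => ⟨0, 1, fun i hi => (not_lt_zero hi).elim, fun i hi => (not_lt_zero hi).elim,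
        fun j _ _ => ⟨1, 0, by ring⟩⟩) fun k ih hk => ?_
    obtain ⟨p, N, h1, h2, h3⟩ := ih ((le_def.2 ⟨1, rfl⟩).trans hk)
    have hk' := lt_iff.2 hk
    obtain ⟨y, hyB, hy⟩ := hB k hk'
    obtain ⟨u, w, hu⟩ := h3 k le_rfl hk'
    refine ⟨p + u * (y + p * ((k + 1) * q)) * N, N * ((k + 1) * q + 1), fun i hi => ?_,
      fun i hi => ?_, fun j hj hjn => ?_⟩
    · rcases (lt_succ.1 hi).lt_or_eq with h4 | rfl
      · obtain ⟨z, h5, h6, v, h7⟩ := h1 i h4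
        obtain ⟨v', h8⟩ := h2 i h4
        exact ⟨z, h5, h6, v + u * (y + p * ((k + 1) * q)) * v', by rw [h8, h7]; ring⟩
      · refine ⟨y, hyB, hy, p + w * (y + p * ((i + 1) * q)), ?_⟩
        rw [show p + u * (y + p * ((i + 1) * q)) * N = p + (y + p * ((i + 1) * q)) * (u * N) by
          ring, hu]
        ring
    · rcases (lt_succ.1 hi).lt_or_eq with h4 | rfl
      · obtain ⟨v', h8⟩ := h2 i h4
        exact ⟨v' * ((k + 1) * q + 1), by rw [h8]; ring⟩
      · exact ⟨N, rfl⟩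
    · obtain ⟨d, hd'⟩ := lt_def.1 (lt_iff.2 hj)
      have hj' : j = k + (1 + d) := by rw [← hd']; ring
      obtain ⟨e, he⟩ := hd (1 + d) (by rw [add_comm]; exact lt_succ.2 zero_le)
        (le_trans (by rw [hj']; exact le_add_self) hjn.le)
      obtain ⟨u', w', h4⟩ := exists_modular_inverse (k := k) he
      rw [← hj'] at h4
      obtain ⟨u'', w'', h5⟩ := h3 j ((le_def.2 ⟨1, rfl⟩).trans hj) hjn
      refine ⟨u'' * u', w'' * (w' * ((j + 1) * q + 1)) + w'' + w', ?_⟩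
      rw [show u'' * u' * (N * ((k + 1) * q + 1)) = (u'' * N) * (u' * ((k + 1) * q + 1)) by ring,
        h4, h5]
      ring
  obtain ⟨p, N, h1, -, -⟩ := key n le_rfl
  refine ⟨p, q, fun i hi => ?_⟩
  obtain ⟨y, h2, h3, h4⟩ := h1 i hi
  exact ⟨y, ⟨(h2.trans hq).trans (le_def.2 ⟨i * q, by ring⟩), h4⟩, h3⟩

/-- `x` is the last entry of a sequence each of whose entries satisfies `B` or comes from two
earlier entries by `St`. -/
def Gen (B : M.C → Prop) (St : M.C → M.C → M.C → Prop) (x : M.C) : Prop :=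
  ∃ p q l, Beta p q l x ∧ ∀ i ≤ l, ∃ y, Beta p q i y ∧
    (B y ∨ ∃ j k u w, j < i ∧ k < i ∧ Beta p q j u ∧ Beta p q k w ∧ St u w y)

namespace Gen

variable {B B' : M.C → Prop} {St St' : M.C → M.C → M.C → Prop}

theorem base {x : M.C} (h : B x) : Gen B St x := by
  obtain ⟨p, q, hpq⟩ := exists_beta (L := Lang.arith) (R := fun _ y => y = x) inferInstance
    (n := 1) fun i _ => ⟨x, rfl⟩
  have h1 : ∀ i ≤ 0, Beta p q i x := fun i hi => by
    obtain ⟨y, h1, rfl⟩ := hpq i (hi.trans_lt zero_lt_one)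
    exact h1
  exact ⟨p, q, 0, h1 0 le_rfl, fun i hi => ⟨x, h1 i hi, .inl h⟩⟩

/-- Generated classes are closed: two sequences can be concatenated and extended by one entry. -/
theorem step {u w x : M.C} (hu : Gen B St u) (hw : Gen B St w) (h : St u w x) :
    Gen B St x := by
  obtain ⟨p₁, q₁, l₁, hu, h₁⟩ := hu
  obtain ⟨p₂, q₂, l₂, hw, h₂⟩ := hw
  obtain ⟨p, q, hpq⟩ := exists_beta (L := Lang.arith)
    (R := fun i y => (i ≤ l₁ ∧ Beta p₁ q₁ i y) ∨ (∃ k, i = l₁ + 1 + k ∧ k ≤ l₂ ∧ Beta p₂ q₂ k y) ∨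
      (i = l₁ + 1 + (l₂ + 1) ∧ y = x)) inferInstance (n := l₁ + 1 + (l₂ + 1) + 1) fun i hi => by
    rcases le_or_gt i l₁ with h1 | h1
    · obtain ⟨y, hy, -⟩ := h₁ i h1
      exact ⟨y, .inl ⟨h1, hy⟩⟩
    · obtain ⟨k, rfl⟩ := lt_def.1 h1
      have hk : k ≤ l₂ + 1 := (add_le_add_iff_left _).1 (lt_succ.1 hi)
      rcases hk.lt_or_eq with h2 | rfl
      · obtain ⟨y, hy, -⟩ := h₂ k (lt_succ.1 h2)
        exact ⟨y, .inr (.inl ⟨k, rfl, lt_succ.1 h2, hy⟩)⟩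
      · exact ⟨x, .inr (.inr ⟨rfl, rfl⟩)⟩
  have hlt : ∀ k, l₁ < l₁ + 1 + k := fun k => lt_def.2 ⟨k, rfl⟩
  have t1 : ∀ i ≤ l₁, ∀ y, Beta p₁ q₁ i y → Beta p q i y := by
    intro i hi y hy
    obtain ⟨z, hz, ⟨-, h1⟩ | ⟨k, rfl, -⟩ | ⟨rfl, -⟩⟩ := hpq i
      (hi.trans_lt ((hlt _).trans (lt_succ.2 le_rfl)))
    · rwa [hy.unique h1]
    · exact absurd hi (not_le.2 (hlt _))
    · exact absurd hi (not_le.2 (hlt _))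
  have t2 : ∀ i ≤ l₂, ∀ y, Beta p₂ q₂ i y → Beta p q (l₁ + 1 + i) y := by
    intro i hi y hy
    obtain ⟨z, hz, ⟨h1, -⟩ | ⟨k, h1, h2, h3⟩ | ⟨h1, -⟩⟩ := hpq (l₁ + 1 + i)
      (lt_succ.2 ((add_le_add_iff_left _).2 (hi.trans (le_def.2 ⟨1, rfl⟩))))
    · exact absurd h1 (not_le.2 (hlt _))
    · rw [← add_left_cancel h1] at h3
      rwa [hy.unique h3]
    · rw [add_left_cancel h1] at hi
      exact absurd hi (not_le.2 (lt_succ.2 le_rfl))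
  have t3 : Beta p q (l₁ + 1 + (l₂ + 1)) x := by
    obtain ⟨z, hz, ⟨h1, -⟩ | ⟨k, h1, h2, h3⟩ | ⟨h1, rfl⟩⟩ := hpq (l₁ + 1 + (l₂ + 1))
      (lt_succ.2 le_rfl)
    · exact absurd h1 (not_le.2 (hlt _))
    · rw [← add_left_cancel h1] at h2
      exact absurd h2 (not_le.2 (lt_succ.2 le_rfl))
    · exact hz
  refine ⟨p, q, l₁ + 1 + (l₂ + 1), t3, fun i hi => ?_⟩
  rcases le_or_gt i l₁ with h1 | h1
  · obtain ⟨y, hy, h2⟩ := h₁ i h1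
    refine ⟨y, t1 i h1 y hy, h2.imp_right ?_⟩
    rintro ⟨j, k, u, w, h3, h4, h5, h6, h7⟩
    exact ⟨j, k, u, w, h3, h4, t1 _ (h3.le.trans h1) _ h5, t1 _ (h4.le.trans h1) _ h6, h7⟩
  · obtain ⟨i, rfl⟩ := lt_def.1 h1
    have hk : i ≤ l₂ + 1 := (add_le_add_iff_left _).1 hi
    rcases hk.lt_or_eq with h2 | rfl
    · have h2 := lt_succ.1 h2
      obtain ⟨y, hy, h3⟩ := h₂ i h2
      refine ⟨y, t2 i h2 y hy, h3.imp_right ?_⟩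
      rintro ⟨j, k, u, w, h3, h4, h5, h6, h7⟩
      exact ⟨l₁ + 1 + j, l₁ + 1 + k, u, w, (add_lt_add_iff_left _).2 h3,
        (add_lt_add_iff_left _).2 h4, t2 _ (h3.le.trans h2) _ h5, t2 _ (h4.le.trans h2) _ h6, h7⟩
    · exact ⟨x, t3, .inr ⟨l₁, l₁ + 1 + l₂, u, w, hlt _,
        (add_lt_add_iff_left _).2 (lt_succ.2 le_rfl), t1 _ le_rfl _ hu, t2 _ le_rfl _ hw, h⟩⟩

/-- Every entry of a generating sequence is generated. -/
theorem entry {p q l : M.C} (h : ∀ i ≤ l, ∃ y, Beta p q i y ∧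
    (B y ∨ ∃ j k u w, j < i ∧ k < i ∧ Beta p q j u ∧ Beta p q k w ∧ St u w y))
    {i y : M.C} (hi : i ≤ l) (hy : Beta p q i y) : Gen B St y :=
  ⟨p, q, i, hy, fun j hj => h j (hj.trans hi)⟩

theorem cases {x : M.C} (h : Gen B St x) :
    B x ∨ ∃ u w, Gen B St u ∧ Gen B St w ∧ St u w x := by
  obtain ⟨p, q, l, hx, h⟩ := h
  obtain ⟨y, hy, h1⟩ := h l le_rfl
  obtain rfl := hx.unique hy
  refine h1.imp_right ?_
  rintro ⟨j, k, u, w, h3, h4, h5, h6, h7⟩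
  exact ⟨u, w, entry h h3.le h5, entry h h4.le h6, h7⟩

/-- Induction on generated classes, for definable properties. -/
theorem induct {L : Lang} [Inductive L M] {Q : M.C → Prop} (hQ : DefP L M fun r => Q (r 0))
    (hB : ∀ x, B x → Q x)
    (hS : ∀ u w x, Gen B St u → Q u → Gen B St w → Q w → St u w x → Q x)
    {x : M.C} (h : Gen B St x) : Q x := by
  have hQ' := fun f [hf : DefF L M f] => hQ.comp1 hf
  obtain ⟨p, q, l, hx, h⟩ := h
  have key : ∀ i, i ≤ l → ∀ y, Beta p q i y → Q y := by
    refine strong_ind (L := L) (P := fun i => i ≤ l → ∀ y, Beta p q i y → Q y) inferInstance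
      fun i ih hi y hy => ?_
    obtain ⟨z, hz, h1⟩ := h i hi
    obtain rfl := hy.unique hz
    rcases h1 with h1 | ⟨j, k, u, w, h3, h4, h5, h6, h7⟩
    · exact hB _ h1
    · exact hS u w y (entry h (h3.le.trans hi) h5) (ih j h3 (h3.le.trans hi) u h5)
        (entry h (h4.le.trans hi) h6) (ih k h4 (h4.le.trans hi) w h6) h7
  exact key l le_rfl x hx

theorem mono {x : M.C} (hB : ∀ x, B x → B' x) (hS : ∀ u w x, St u w x → St' u w x)
    (h : Gen B St x) : Gen B' St' x := by
  obtain ⟨p, q, l, hx, h⟩ := h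
  refine ⟨p, q, l, hx, fun i hi => ?_⟩
  obtain ⟨y, hy, h1⟩ := h i hi
  refine ⟨y, hy, h1.imp (hB y) ?_⟩
  rintro ⟨j, k, u, w, h3, h4, h5, h6, h7⟩
  exact ⟨j, k, u, w, h3, h4, h5, h6, hS _ _ _ h7⟩

end Gen
end Coding

open Bld (all ex app1 app2)

/-! ### Evaluation of the arithmetized syntax: basic notions -/

section Evaluation

variable {M : Str}

theorem Tm.eval_update {t : Tm} {d : ℕ} (h : t.ub ≤ d) (r : ℕ → M.C) (x : M.C) :
    t.eval M (Function.update r d x) = t.eval M r :=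
  Tm.eval_congr fun v hv => by
    have := Tm.occ_lt_ub hv
    have : v ≠ d := by omega
    simp [this]

theorem Tm.eval_agree {t : Tm} {d : ℕ} (h : t.ub ≤ d) {r r' : ℕ → M.C}
    (hr : ∀ v < d, r' v = r v) : t.eval M r' = t.eval M r :=
  Tm.eval_congr fun v hv => hr v ((Tm.occ_lt_ub hv).trans_le h)

@[simp] theorem ub_num (n : ℕ) : (num n).ub = 0 := by
  induction n with
  | zero => rfl
  | succ n ih => exact ih

section

variable {d : ℕ} {r : ℕ → M.C}

@[simp] theorem eval_var (v : ℕ) : (Tm.var v).eval M r = r v := rfl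

@[simp] theorem holds_imp (A B : Fm) : (Fm.imp A B).Holds M r ↔ (A.Holds M r → B.Holds M r) :=
  Iff.rfl

@[simp] theorem holds_all (v : ℕ) (A : Fm) :
    (Fm.all v A).Holds M r ↔ ∀ x, A.Holds M (Function.update r v x) := Iff.rfl

@[simp] theorem holds_iff (A B : Fm) : (Fm.iff A B).Holds M r ↔ (A.Holds M r ↔ B.Holds M r) := by
  simp only [Fm.iff, Fm.and, Fm.not, Fm.Holds]
  tauto

@[simp] theorem holds_tr (a : ℕ) (t : Tm) : (Fm.tr a t).Holds M r ↔ M.tr a (t.eval M r) := Iff.rfl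

@[simp] theorem holds_ball (f : Tm → Bld) :
    (Bld.all f d).Holds M r ↔ ∀ x, (f (.var d) (d + 1)).Holds M (Function.update r d x) := Iff.rfl

@[simp] theorem holds_bex (f : Tm → Bld) :
    (Bld.ex f d).Holds M r ↔ ∃ x, (f (.var d) (d + 1)).Holds M (Function.update r d x) := by
  simp [Bld.ex, Fm.ex, Fm.not, Fm.Holds]

@[simp] theorem holds_beq (t u : Tm) : ((t =ₐ u) d).Holds M r ↔ t.eval M r = u.eval M r := Iff.rfl

@[simp] theorem holds_btr (a : ℕ) (t : Tm) : (Bld.tr a t d).Holds M r ↔ M.tr a (t.eval M r) :=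
  Iff.rfl

@[simp] theorem holds_bbot : (Bld.bot d).Holds M r ↔ False := Iff.rfl

@[simp] theorem holds_bnot (A : Bld) : (Bld.not A d).Holds M r ↔ ¬ (A d).Holds M r := Iff.rfl

@[simp] theorem holds_bimp (A B : Bld) :
    ((A →ₐ B) d).Holds M r ↔ ((A d).Holds M r → (B d).Holds M r) := Iff.rfl

@[simp] theorem holds_band (A B : Bld) :
    ((A ∧ₐ B) d).Holds M r ↔ ((A d).Holds M r ∧ (B d).Holds M r) := by
  simp [Bld.and, Fm.and, Fm.not, Fm.Holds]

@[simp] theorem holds_bor (A B : Bld) :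
    ((A ∨ₐ B) d).Holds M r ↔ ((A d).Holds M r ∨ (B d).Holds M r) := by
  simp only [Bld.or, Fm.or, Fm.not, Fm.Holds]
  tauto

@[simp] theorem holds_biff (A B : Bld) :
    ((A ↔ₐ B) d).Holds M r ↔ ((A d).Holds M r ↔ (B d).Holds M r) :=
  holds_iff _ _

end

variable [PAModel M]

section

variable {r : ℕ → M.C}

omit [PAModel M] in
@[simp] theorem eval_zero : Tm.zero.eval M r = 0 := rfl
@[simp] theorem eval_succ (t : Tm) : t.succ.eval M r = t.eval M r + 1 := PAModel.succ_eq _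
omit [PAModel M] in
@[simp] theorem eval_add (t u : Tm) : (t.add u).eval M r = t.eval M r + u.eval M r := rfl
omit [PAModel M] in
@[simp] theorem eval_mul (t u : Tm) : (t.mul u).eval M r = t.eval M r * u.eval M r := rfl

@[simp] theorem eval_num (n : ℕ) : (num n).eval M r = (n : M.C) := by
  induction n with
  | zero => exact Nat.cast_zero.symm
  | succ n ih => rw [num, eval_succ, ih, Nat.cast_succ]

end

theorem holds_leA {x y : Tm} {d : ℕ} {r : ℕ → M.C} (hx : x.ub ≤ d) (hy : y.ub ≤ d) :
    (leA x y d).Holds M r ↔ x.eval M r ≤ y.eval M r := by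
  simp [leA, Tm.eval_update hx, Tm.eval_update hy, PAModel.le_def]

theorem holds_ltA {x y : Tm} {d : ℕ} {r : ℕ → M.C} (hx : x.ub ≤ d) (hy : y.ub ≤ d) :
    (ltA x y d).Holds M r ↔ x.eval M r < y.eval M r := by
  rw [ltA, holds_leA (x := x.succ) hx hy, eval_succ, PAModel.lt_iff]

theorem holds_pairA {x y z : Tm} {d : ℕ} {r : ℕ → M.C} (hx : x.ub ≤ d) (hy : y.ub ≤ d) :
    (pairA x y z d).Holds M r ↔ z.eval M r = pr (x.eval M r) (y.eval M r) := by
  simp [pairA, holds_leA hy hx, holds_ltA hx hy, eq_pr_iff]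

theorem holds_betaA {p q i y : Tm} {d : ℕ} {r : ℕ → M.C} (hp : p.ub ≤ d) (hq : q.ub ≤ d)
    (hi : i.ub ≤ d) (hy : y.ub ≤ d) : (betaA p q i y d).Holds M r ↔
      Beta (p.eval M r) (q.eval M r) (i.eval M r) (y.eval M r) := by
  simp [betaA, holds_leA (x := y) (y := .mul (.succ i) q) hy (by simp only [Tm.ub]; omega), Beta,
    Tm.eval_update hp, Tm.eval_update hq, Tm.eval_update hi, Tm.eval_update hy]

/-- The value of a construction `base` of formulas is the property `B`, wherever it is used in
the scope of the first `d` variables, which have the values `r`. -/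
def Rep1 (M : Str) (d : ℕ) (r : ℕ → M.C) (base : Tm → Bld) (B : M.C → Prop) : Prop :=
  ∀ d' r' t, d ≤ d' → (∀ v < d, r' v = r v) → t.ub ≤ d' →
    ((base t d').Holds M r' ↔ B (t.eval M r'))

/-- The analogue of `Rep1` for constructions with three arguments. -/
def Rep3 (M : Str) (d : ℕ) (r : ℕ → M.C) (step : Tm → Tm → Tm → Bld)
    (St : M.C → M.C → M.C → Prop) : Prop :=
  ∀ d' r' t u w, d ≤ d' → (∀ v < d, r' v = r v) → t.ub ≤ d' → u.ub ≤ d' → w.ub ≤ d' →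
    ((step t u w d').Holds M r' ↔ St (t.eval M r') (u.eval M r') (w.eval M r'))

omit [PAModel M] in
theorem Rep1.mono {d d' : ℕ} {r r' : ℕ → M.C} {base : Tm → Bld} {B : M.C → Prop}
    (h : Rep1 M d r base B) (hd : d ≤ d') (hr : ∀ v < d, r' v = r v) : Rep1 M d' r' base B :=
  fun d'' r'' t h1 h2 h3 => h d'' r'' t (hd.trans h1)
    (fun v hv => (h2 v (hv.trans_le hd)).trans (hr v hv)) h3

theorem holds_genA {base : Tm → Bld} {step : Tm → Tm → Tm → Bld} {B : M.C → Prop}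
    {St : M.C → M.C → M.C → Prop} {x : Tm} {d : ℕ} {r : ℕ → M.C} (hB : Rep1 M d r base B)
    (hS : Rep3 M d r step St) (hx : x.ub ≤ d) :
    (genA base step x d).Holds M r ↔ Gen B St (x.eval M r) := by
  have ag : ∀ {r' : ℕ → M.C} {d' y}, (∀ v < d, r' v = r v) → d ≤ d' →
      ∀ v < d, Function.update r' d' y v = r v := by
    intro r' d' y h h' v hv
    rw [Function.update_of_ne (by omega), h v hv]
  simp only [genA, Gen, holds_bex, holds_ball, holds_bimp, holds_band, holds_bor]
  refine exists_congr fun p => exists_congr fun q => exists_congr fun l => and_congr ?_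
    (forall_congr' fun i => imp_congr ?_ (exists_congr fun y => and_congr ?_ (or_congr ?_
    (exists_congr fun j => exists_congr fun k => exists_congr fun u => exists_congr fun w =>
    and_congr ?_ (and_congr ?_ (and_congr ?_ (and_congr ?_ ?_)))))))
  · rw [holds_betaA (by simp [Tm.ub]) (by simp [Tm.ub]) (by simp [Tm.ub]) (by omega),
      Tm.eval_update (t := x) (by omega),
      Tm.eval_update (t := x) (by omega), Tm.eval_update (t := x) (by omega)]
    simp (disch := omega) only [Function.update_self, Function.update_of_ne, eval_var]
  · rw [holds_leA (by simp [Tm.ub]) (by simp [Tm.ub])]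
    simp (disch := omega) only [Function.update_self, Function.update_of_ne, eval_var]
  · rw [holds_betaA (by simp [Tm.ub]) (by simp [Tm.ub]) (by simp [Tm.ub]) (by simp [Tm.ub])]
    simp (disch := omega) only [Function.update_self, Function.update_of_ne, eval_var]
  · rw [hB _ _ _ (by omega) _ (by simp [Tm.ub])]
    · simp only [Function.update_self, eval_var]
    · repeat' first | exact fun _ _ => rfl | refine ag ?_ (by omega)
  · rw [holds_ltA (by simp [Tm.ub]) (by simp [Tm.ub])]
    simp (disch := omega) only [Function.update_self, Function.update_of_ne, eval_var]
  · rw [holds_ltA (by simp [Tm.ub]) (by simp [Tm.ub])]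
    simp (disch := omega) only [Function.update_self, Function.update_of_ne, eval_var]
  · rw [holds_betaA (by simp [Tm.ub]) (by simp [Tm.ub]) (by simp [Tm.ub]) (by simp [Tm.ub])]
    simp (disch := omega) only [Function.update_self, Function.update_of_ne, eval_var]
  · rw [holds_betaA (by simp [Tm.ub]) (by simp [Tm.ub]) (by simp [Tm.ub]) (by simp [Tm.ub])]
    simp (disch := omega) only [Function.update_self, Function.update_of_ne, eval_var]
  · rw [hS _ _ _ _ _ (by omega) _ (by simp [Tm.ub]) (by simp [Tm.ub]) (by simp [Tm.ub])]
    · simp (disch := omega) only [Function.update_self, Function.update_of_ne, eval_var]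
    · repeat' first | exact fun _ _ => rfl | refine ag ?_ (by omega)

/-- The value of an expression for codes. -/
noncomputable def Cd.eval (M : Str) [PAModel M] (r : ℕ → M.C) : Cd → M.C
  | .tm t => t.eval M r
  | .pr c d => IteratedTruth.pr (c.eval M r) (d.eval M r)

/-- A strict upper bound for the indices of the variables of an expression for codes. -/
def Cd.ub : Cd → ℕ
  | .tm t => t.ub
  | .pr c d => max c.ub d.ub

theorem Cd.eval_update {c : Cd} {d : ℕ} (h : c.ub ≤ d) (r : ℕ → M.C) (x : M.C) :
    c.eval M (Function.update r d x) = c.eval M r := by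
  induction c with
  | tm t => exact Tm.eval_update h r x
  | pr c e ihc ihe =>
    simp only [Cd.ub, max_le_iff] at h
    simp only [Cd.eval, ihc h.1, ihe h.2]

theorem holds_isA {x : Tm} {c : Cd} {d : ℕ} {r : ℕ → M.C} (hx : x.ub ≤ d) (hc : c.ub ≤ d) :
    (isA x c d).Holds M r ↔ x.eval M r = c.eval M r := by
  induction c generalizing x d r with
  | tm t => rfl
  | pr c e ihc ihe =>
    simp only [Cd.ub, max_le_iff] at hc
    simp only [isA, holds_bex, holds_band]
    simp only [ihc (x := .var d) (d := d + 1 + 1) (by simp [Tm.ub]) (by omega),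
      ihe (x := .var (d + 1)) (d := d + 1 + 1) (by simp [Tm.ub]) (by omega),
      holds_pairA (x := .var d) (y := .var (d + 1)) (d := d + 1 + 1) (z := x)
        (by simp [Tm.ub]) (by simp [Tm.ub]),
      Cd.eval_update (show c.ub ≤ d by omega), Cd.eval_update (show c.ub ≤ d + 1 by omega),
      Cd.eval_update (show e.ub ≤ d by omega), Cd.eval_update (show e.ub ≤ d + 1 by omega),
      Tm.eval_update (show x.ub ≤ d by omega), Tm.eval_update (show x.ub ≤ d + 1 by omega),
      eval_var, Cd.eval]
    simp

/-- The pair of the standard number `i` and `c`. -/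
noncomputable def tag (i : ℕ) (c : M.C) : M.C := pr (i : M.C) c

@[simp] theorem tag_inj {i j : ℕ} {c e : M.C} : tag i c = tag j e ↔ i = j ∧ c = e := by
  simp [tag, pr_inj]

/-- The binders of the formula have index at least `d`. -/
def Fm.BindersGe (d : ℕ) : Fm → Prop
  | .imp A B => A.BindersGe d ∧ B.BindersGe d
  | .all w A => d ≤ w ∧ A.BindersGe d
  | _ => True

theorem Fm.bindersGe_shift (d : ℕ) (A : Fm) : (A.shift d).BindersGe d := by
  induction A with
  | imp A B ihA ihB => exact ⟨ihA, ihB⟩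
  | all w A ih => exact ⟨Nat.le_add_left _ _, ih⟩
  | _ => trivial

theorem Fm.BindersGe.subst {d : ℕ} {A : Fm} (h : A.BindersGe d) (v : ℕ) (t : Tm) :
    (A.subst v t).BindersGe d := by
  induction A with
  | imp A B ihA ihB => exact ⟨ihA h.1, ihB h.2⟩
  | all w A ih =>
    by_cases hw : w = v
    · simpa [Fm.subst, hw] using h
    · simp only [Fm.subst, hw, if_false]
      exact ⟨h.1, ih h.2⟩
  | _ => trivial

theorem Fm.BindersGe.freeFor {d : ℕ} {A : Fm} (h : A.BindersGe d) {t : Tm} (ht : t.ub ≤ d)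
    (v : ℕ) : A.FreeFor v t := by
  induction A with
  | imp A B ihA ihB => exact ⟨ihA h.1, ihB h.2⟩
  | all w A ih =>
    exact .inr ⟨ih h.2, fun ho => absurd (Tm.occ_lt_ub ho) (by have := h.1; omega)⟩
  | _ => trivial

omit [PAModel M] in
theorem Tm.eval_shift (t : Tm) (d : ℕ) (r : ℕ → M.C) :
    (t.shift d).eval M r = t.eval M fun i => r (i + d) := by
  induction t with
  | var v => rfl
  | zero => rfl
  | succ t ih => simp only [Tm.shift, Tm.eval, ih]
  | add t u iht ihu => simp only [Tm.shift, Tm.eval, iht, ihu]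
  | mul t u iht ihu => simp only [Tm.shift, Tm.eval, iht, ihu]
  | fn k i ts ih => simp only [Tm.shift, Tm.eval, ih]

omit [PAModel M] in
theorem Fm.holds_shift (A : Fm) (d : ℕ) (r : ℕ → M.C) :
    (A.shift d).Holds M r ↔ A.Holds M fun i => r (i + d) := by
  induction A generalizing r with
  | bot => rfl
  | eq t u => simp only [Fm.shift, Fm.Holds, Tm.eval_shift]
  | rel k i ts => simp only [Fm.shift, Fm.Holds, Tm.eval_shift]
  | tr a t => simp only [Fm.shift, Fm.Holds, Tm.eval_shift]
  | imp A B ihA ihB => simp only [Fm.shift, Fm.Holds, ihA, ihB]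
  | all w A ih =>
    simp only [Fm.shift, Fm.Holds, ih]
    refine forall_congr' fun x => iff_of_eq (congrArg (fun s => A.Holds M s) (funext fun i => ?_))
    by_cases h : i = w <;> simp [h]

/-- The property expressed by an arithmetical formula with one free variable. -/
def ArithFm.prop (M : Str) (A : ArithFm 1) (x : M.C) : Prop := A.fm.Holds M fun _ => x

/-- The relation expressed by an arithmetical formula with two free variables. -/
def ArithFm.rel (M : Str) (A : ArithFm 2) (x y : M.C) : Prop :=
  A.fm.Holds M fun j => if j = 0 then x else y

omit [PAModel M] in
theorem holds_app1 {A : ArithFm 1} {t : Tm} {d : ℕ} {r : ℕ → M.C} (ht : t.ub ≤ d) :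
    (app1 A t d).Holds M r ↔ A.prop M (t.eval M r) := by
  rw [app1, Fm.holds_subst ((Fm.bindersGe_shift d _).freeFor ht _), Fm.holds_shift, ArithFm.prop]
  refine Fm.holds_congr fun v hv => ?_
  obtain rfl : v = 0 := by have := A.free v hv; omega
  simp

omit [PAModel M] in
theorem holds_app2 {A : ArithFm 2} {t u : Tm} {d : ℕ} {r : ℕ → M.C} (ht : t.ub ≤ d)
    (hu : u.ub ≤ d) : (app2 A t u d).Holds M r ↔ A.rel M (t.eval M r) (u.eval M r) := by
  rw [app2, Fm.holds_subst (((Fm.bindersGe_shift d _).subst _ _).freeFor hu _),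
    Fm.holds_subst ((Fm.bindersGe_shift d _).freeFor ht _), Fm.holds_shift, ArithFm.rel]
  refine Fm.holds_congr fun v hv => ?_
  have := A.free v hv
  obtain rfl | rfl : v = 0 ∨ v = 1 := by omega
  · simp [Tm.eval_update (show t.ub ≤ d + 1 by omega)]
  · simp [Nat.add_comm 1 d]

end Evaluation

/-! ### Evaluation of the arithmetized syntax: terms, formulas and substitution -/

section EvaluationSyntax

variable {M : Str} [PAModel M]

/-- The code of the variable with index `v`. -/
noncomputable abbrev cVar (v : M.C) : M.C := tag 0 v
/-- The code of the term `0`. -/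
noncomputable abbrev cZero : M.C := tag 1 0
/-- The code of the successor of the term with code `t`. -/
noncomputable abbrev cSucc (t : M.C) : M.C := tag 2 t
/-- The code of the sum of the terms with codes `t` and `u`. -/
noncomputable abbrev cAdd (t u : M.C) : M.C := tag 3 (pr t u)
/-- The code of the product of the terms with codes `t` and `u`. -/
noncomputable abbrev cMul (t u : M.C) : M.C := tag 4 (pr t u)
/-- The code of the term that applies the function symbol with code `f` to the list with code `l`. -/
noncomputable abbrev cFn (f l : M.C) : M.C := tag 5 (pr f l)
/-- The code of the empty list of terms. -/
noncomputable abbrev cNil : M.C := tag 6 0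
/-- The code of the list with first entry `t`, followed by the list with code `l`. -/
noncomputable abbrev cCons (t l : M.C) : M.C := tag 7 (pr t l)
/-- The code of falsity. -/
noncomputable abbrev cBot : M.C := tag 8 0
/-- The code of the equation of the terms with codes `t` and `u`. -/
noncomputable abbrev cEq (t u : M.C) : M.C := tag 9 (pr t u)
/-- The code of the atomic formula that applies the relation symbol with code `f` to the list with
code `l`. -/
noncomputable abbrev cRel (f l : M.C) : M.C := tag 10 (pr f l)
/-- The code of the atomic formula `T_a(t)`; here `a` may be any element of the model. -/
noncomputable abbrev cTr (a t : M.C) : M.C := tag 11 (pr a t)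
/-- The code of the implication from `A` to `B`. -/
noncomputable abbrev cImp (A B : M.C) : M.C := tag 12 (pr A B)
/-- The code of the universal quantification of `A` over the variable with index `v`. -/
noncomputable abbrev cAll (v A : M.C) : M.C := tag 13 (pr v A)
/-- The code of the negation of `A`. -/
noncomputable abbrev cNot (A : M.C) : M.C := cImp A cBot
/-- The code of the conjunction of `A` and `B`. -/
noncomputable abbrev cAnd (A B : M.C) : M.C := cNot (cImp A (cNot B))
/-- The code of the equivalence of `A` and `B`. -/
noncomputable abbrev cIff (A B : M.C) : M.C := cAnd (cImp A B) (cImp B A)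

/-- Initial pairs of a kind and an expression of that kind. -/
def WfBase (y : M.C) : Prop :=
  (∃ v, y = tag 0 (cVar v)) ∨ y = tag 0 cZero ∨ y = tag 1 cBot ∨ y = tag 2 cNil

/-- Formation of expressions from simpler ones. -/
def WfStep (S : Thy) (D : M.C → Prop) (u w y : M.C) : Prop :=
  (∃ t, u = tag 0 t ∧ y = tag 0 (cSucc t)) ∨
  (∃ t t', u = tag 0 t ∧ w = tag 0 t' ∧
    (y = tag 0 (cAdd t t') ∨ y = tag 0 (cMul t t') ∨ y = tag 1 (cEq t t'))) ∨
  (∃ t k l, u = tag 0 t ∧ w = pr (k + 1 + 1) l ∧ y = pr (k + 1 + 1 + 1) (cCons t l)) ∨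
  (∃ k i l, u = pr (k + 1 + 1) l ∧
    ((S.funSym.rel M k i ∧ y = tag 0 (cFn (pr k i) l)) ∨
      (S.relSym.rel M k i ∧ y = tag 1 (cRel (pr k i) l)))) ∨
  (∃ e t, u = tag 0 t ∧ D e ∧ y = tag 1 (cTr e t)) ∨
  (∃ A B, u = tag 1 A ∧ w = tag 1 B ∧ y = tag 1 (cImp A B)) ∨
  ∃ v A, u = tag 1 A ∧ y = tag 1 (cAll v A)

/-- `x` is an expression of kind `s` of the internal language given by `S` and `D`: a term for
`s = 0`, a formula for `s = 1`, a list of `k` terms for `s = k + 2`. -/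
def Wf (S : Thy) (D : M.C → Prop) (s x : M.C) : Prop := Gen WfBase (WfStep S D) (pr s x)

theorem ub_tag (i : ℕ) (c : Cd) : (Cd.tag i c).ub = c.ub := by
  simp [Cd.tag, Cd.ub]

theorem eval_tag (i : ℕ) (c : Cd) (r : ℕ → M.C) : (Cd.tag i c).eval M r = tag i (c.eval M r) := by
  simp [Cd.tag, Cd.eval, tag]

/-- The bounds for the constructors of expressions. -/
theorem ub_cd :
    (∀ c, (Cd.var c).ub = c.ub) ∧ (∀ c, (Cd.succ c).ub = c.ub) ∧ (∀ c, (Cd.not c).ub = c.ub) ∧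
    Cd.zero.ub = 0 ∧ Cd.nil.ub = 0 ∧ Cd.bot.ub = 0 ∧ (∀ c e, (Cd.add c e).ub = max c.ub e.ub) ∧
    (∀ c e, (Cd.mul c e).ub = max c.ub e.ub) ∧ (∀ c e, (Cd.fn c e).ub = max c.ub e.ub) ∧
    (∀ c e, (Cd.cons c e).ub = max c.ub e.ub) ∧ (∀ c e, (Cd.eq c e).ub = max c.ub e.ub) ∧
    (∀ c e, (Cd.rel c e).ub = max c.ub e.ub) ∧ (∀ c e, (Cd.tr c e).ub = max c.ub e.ub) ∧
    (∀ c e, (Cd.imp c e).ub = max c.ub e.ub) ∧ (∀ c e, (Cd.all c e).ub = max c.ub e.ub) ∧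
    (∀ c e, (Cd.and c e).ub = max c.ub e.ub) ∧ (∀ c e, (Cd.iff c e).ub = max c.ub e.ub) ∧
    (∀ c e, (Cd.pr c e).ub = max c.ub e.ub) ∧ (∀ t, (Cd.tm t).ub = t.ub) ∧
    (∀ i c, (Cd.tag i c).ub = c.ub) ∧ (∀ v, (Tm.var v).ub = v + 1) ∧ Tm.zero.ub = 0 ∧
    (∀ t, (Tm.succ t).ub = t.ub) ∧ (∀ t u, (Tm.add t u).ub = max t.ub u.ub) ∧
    (∀ t u, (Tm.mul t u).ub = max t.ub u.ub) ∧ (∀ n, (num n).ub = 0) := by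
  simp [Cd.var, Cd.zero, Cd.bot, Cd.nil, Cd.succ, Cd.add, Cd.mul, Cd.eq, Cd.cons, Cd.fn, Cd.rel,
    Cd.tr, Cd.imp, Cd.all, Cd.not, Cd.and, Cd.iff, ub_tag, Cd.ub, Tm.ub, max_comm]

/-- The values of the constructors of expressions. -/
theorem eval_cd (M : Str) [PAModel M] :
    (∀ r c, (Cd.var c).eval M r = cVar (c.eval M r)) ∧
    (∀ r c, (Cd.succ c).eval M r = cSucc (c.eval M r)) ∧
    (∀ r c, (Cd.not c).eval M r = cNot (c.eval M r)) ∧ (∀ r, Cd.zero.eval M r = cZero) ∧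
    (∀ r, Cd.nil.eval M r = cNil) ∧ (∀ r, Cd.bot.eval M r = cBot) ∧
    (∀ r c e, (Cd.add c e).eval M r = cAdd (c.eval M r) (e.eval M r)) ∧
    (∀ r c e, (Cd.mul c e).eval M r = cMul (c.eval M r) (e.eval M r)) ∧
    (∀ r c e, (Cd.fn c e).eval M r = cFn (c.eval M r) (e.eval M r)) ∧
    (∀ r c e, (Cd.cons c e).eval M r = cCons (c.eval M r) (e.eval M r)) ∧
    (∀ r c e, (Cd.eq c e).eval M r = cEq (c.eval M r) (e.eval M r)) ∧
    (∀ r c e, (Cd.rel c e).eval M r = cRel (c.eval M r) (e.eval M r)) ∧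
    (∀ r c e, (Cd.tr c e).eval M r = cTr (c.eval M r) (e.eval M r)) ∧
    (∀ r c e, (Cd.imp c e).eval M r = cImp (c.eval M r) (e.eval M r)) ∧
    (∀ r c e, (Cd.all c e).eval M r = cAll (c.eval M r) (e.eval M r)) ∧
    (∀ r c e, (Cd.and c e).eval M r = cAnd (c.eval M r) (e.eval M r)) ∧
    (∀ r c e, (Cd.iff c e).eval M r = cIff (c.eval M r) (e.eval M r)) ∧
    (∀ r c e, (Cd.pr c e).eval M r = pr (c.eval M r) (e.eval M r)) ∧
    (∀ r t, (Cd.tm t).eval M r = t.eval M r) ∧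
    (∀ r i c, (Cd.tag i c).eval M r = tag i (c.eval M r)) ∧ (∀ r v, (Tm.var v).eval M r = r v) ∧
    (∀ r, Tm.zero.eval M r = 0) ∧ (∀ r t, (Tm.succ t).eval M r = t.eval M r + 1) ∧
    (∀ r t u, (Tm.add t u).eval M r = t.eval M r + u.eval M r) ∧
    (∀ r t u, (Tm.mul t u).eval M r = t.eval M r * u.eval M r) ∧
    (∀ r n, (num n).eval M r = (n : M.C)) := by
  simp [Cd.var, Cd.zero, Cd.bot, Cd.nil, Cd.succ, Cd.add, Cd.mul, Cd.eq, Cd.cons, Cd.fn, Cd.rel,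
    Cd.tr, Cd.imp, Cd.all, Cd.not, Cd.and, Cd.iff, eval_tag, Cd.eval]

/-- Satisfaction of formulas built by connectives and quantifiers. -/
theorem holds_conn (M : Str) :
    (∀ (d : ℕ) (r : ℕ → M.C) f, (Bld.all f d).Holds M r ↔
      ∀ x, (f (.var d) (d + 1)).Holds M (Function.update r d x)) ∧
    (∀ (d : ℕ) (r : ℕ → M.C) f, (Bld.ex f d).Holds M r ↔
      ∃ x, (f (.var d) (d + 1)).Holds M (Function.update r d x)) ∧
    (∀ (d : ℕ) (r : ℕ → M.C) t u, ((t =ₐ u) d).Holds M r ↔ t.eval M r = u.eval M r) ∧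
    (∀ (d : ℕ) (r : ℕ → M.C) a t, (Bld.tr a t d).Holds M r ↔ M.tr a (t.eval M r)) ∧
    (∀ (d : ℕ) (r : ℕ → M.C), (Bld.bot d).Holds M r ↔ False) ∧
    (∀ (d : ℕ) (r : ℕ → M.C) A, (Bld.not A d).Holds M r ↔ ¬ (A d).Holds M r) ∧
    (∀ (d : ℕ) (r : ℕ → M.C) A B,
      ((A →ₐ B) d).Holds M r ↔ ((A d).Holds M r → (B d).Holds M r)) ∧
    (∀ (d : ℕ) (r : ℕ → M.C) A B,
      ((A ∧ₐ B) d).Holds M r ↔ ((A d).Holds M r ∧ (B d).Holds M r)) ∧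
    (∀ (d : ℕ) (r : ℕ → M.C) A B,
      ((A ∨ₐ B) d).Holds M r ↔ ((A d).Holds M r ∨ (B d).Holds M r)) ∧
    (∀ (d : ℕ) (r : ℕ → M.C) A B,
      ((A ↔ₐ B) d).Holds M r ↔ ((A d).Holds M r ↔ (B d).Holds M r)) :=
  ⟨fun _ _ => holds_ball, fun _ _ => holds_bex, fun _ _ => holds_beq, fun _ _ => holds_btr,
    fun _ _ => holds_bbot, fun _ _ => holds_bnot, fun _ _ => holds_bimp, fun _ _ => holds_band,
    fun _ _ => holds_bor, fun _ _ => holds_biff⟩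

theorem holds_wfA {S : Thy} {D : Tm → Bld} {Ds : M.C → Prop} {s x : Tm} {d : ℕ} {r : ℕ → M.C}
    (hD : Rep1 M d r D Ds) (hs : s.ub ≤ d) (hx : x.ub ≤ d) :
    (wfA S D s x d).Holds M r ↔ Wf S Ds (s.eval M r) (x.eval M r) := by
  unfold wfA
  simp (disch := first | omega | simp only [ub_cd] <;> omega) only [holds_conn, holds_isA, eval_cd,
    Tm.eval_update, Function.update_self, exists_eq_left]
  rw [holds_genA (B := WfBase) (St := WfStep S Ds) ?_ ?_ (by simp [Tm.ub]), Wf, eval_var,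
    Function.update_self]
  · intro d' r' t h1 h2 h3
    simp (disch := first | omega | simp only [ub_cd] <;> omega) only [holds_conn, holds_isA,
      eval_cd, Tm.eval_update, Function.update_self, WfBase]
  · intro d' r' t u w h1 h2 h3 h4 h5
    have h2' : ∀ v < d, r' v = r v := fun v hv => by
      rw [h2 v (by omega), Function.update_of_ne (by omega)]
    have hD' := hD.mono (by omega : d ≤ d') h2'
    unfold Rep1 at hD'
    simp (disch := first | omega | (simp only [ub_cd] <;> omega) |
        (intro v hv; simp (disch := omega) only [Function.update_of_ne])) only
      [holds_conn, holds_isA, eval_cd, holds_app2,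
      Tm.eval_update, Function.update_self, Function.update_of_ne, WfStep, hD']

theorem holds_tmA {S : Thy} {D : Tm → Bld} {Ds : M.C → Prop} {x : Tm} {d : ℕ} {r : ℕ → M.C}
    (hD : Rep1 M d r D Ds) (hx : x.ub ≤ d) :
    (tmA S D x d).Holds M r ↔ Wf S Ds 0 (x.eval M r) := by
  rw [tmA, holds_wfA hD (by simp) hx, eval_num, Nat.cast_zero]

theorem holds_fmA {S : Thy} {D : Tm → Bld} {Ds : M.C → Prop} {x : Tm} {d : ℕ} {r : ℕ → M.C}
    (hD : Rep1 M d r D Ds) (hx : x.ub ≤ d) :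
    (fmA S D x d).Holds M r ↔ Wf S Ds 1 (x.eval M r) := by
  rw [fmA, holds_wfA hD (by simp) hx, eval_num, Nat.cast_one]

/-- Initial pairs of an expression and its substitution instance. -/
def ReplBase (v t y : M.C) : Prop :=
  y = pr (cVar v) t ∨ (∃ u, ¬ u = v ∧ y = pr (cVar u) (cVar u)) ∨ y = pr cZero cZero ∨
  y = pr cNil cNil ∨ y = pr cBot cBot ∨ ∃ A, y = pr (cAll v A) (cAll v A)

/-- Formation of pairs of an expression and its substitution instance from simpler ones. -/
def ReplStep (ok : M.C → Prop) (v u w y : M.C) : Prop :=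
  ∃ c c', u = pr c c' ∧ (y = pr (cSucc c) (cSucc c') ∨
    (∃ e, y = pr (cFn e c) (cFn e c') ∨ y = pr (cRel e c) (cRel e c') ∨
      y = pr (cTr e c) (cTr e c') ∨
      (¬ e = v ∧ (ok e ∨ c = c') ∧ y = pr (cAll e c) (cAll e c'))) ∨
    ∃ b b', w = pr b b' ∧ (y = pr (cAdd c b) (cAdd c' b') ∨ y = pr (cMul c b) (cMul c' b') ∨
      y = pr (cCons c b) (cCons c' b') ∨ y = pr (cEq c b) (cEq c' b') ∨
      y = pr (cImp c b) (cImp c' b')))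

/-- `x'` is the result of substituting `t` for the free occurrences of `v` in `x`, where `ok z`
holds for the quantified variables `z` into whose scope `t` is substituted. -/
def Repl (ok : M.C → Prop) (v t x x' : M.C) : Prop :=
  Gen (ReplBase v t) (ReplStep ok v) (pr x x')

theorem holds_replA {ok : Tm → Bld} {ok' : M.C → Prop} {v t x x' : Tm} {d : ℕ} {r : ℕ → M.C}
    (hok : Rep1 M d r ok ok') (hv : v.ub ≤ d) (ht : t.ub ≤ d) (hx : x.ub ≤ d) (hx' : x'.ub ≤ d) :
    (replA ok v t x x' d).Holds M r ↔
      Repl ok' (v.eval M r) (t.eval M r) (x.eval M r) (x'.eval M r) := by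
  unfold replA
  simp (disch := first | omega | simp only [ub_cd] <;> omega) only [holds_conn, holds_isA, eval_cd,
    Tm.eval_update, Function.update_self, exists_eq_left]
  rw [holds_genA (B := ReplBase (v.eval M r) (t.eval M r)) (St := ReplStep ok' (v.eval M r)) ?_ ?_
    (by simp [Tm.ub]), Repl, eval_var, Function.update_self]
  · intro d' r' y h1 h2 h3
    have h2' : ∀ v < d, r' v = r v := fun v hv => by
      rw [h2 v (by omega), Function.update_of_ne (by omega)]
    simp (disch := first | omega | simp only [ub_cd] <;> omega) only [holds_conn, holds_isA,
      eval_cd, Tm.eval_update, Function.update_self, ReplBase, Tm.eval_agree hv h2',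
      Tm.eval_agree ht h2']
  · intro d' r' y u w h1 h2 h3 h4 h5
    have h2' : ∀ v < d, r' v = r v := fun v hv => by
      rw [h2 v (by omega), Function.update_of_ne (by omega)]
    have hok' := hok.mono (by omega : d ≤ d') h2'
    unfold Rep1 at hok'
    simp (disch := first | omega | (simp only [ub_cd] <;> omega) |
        (intro v hv; simp (disch := omega) only [Function.update_of_ne])) only
      [holds_conn, holds_isA, eval_cd, Tm.eval_update, Function.update_self,
      Function.update_of_ne, ReplStep, hok', Tm.eval_agree hv h2']

/-- The variable `v` does not occur free in the expression `x`. -/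
def NotFree (v x : M.C) : Prop := Repl (fun _ => True) v cZero x x

theorem holds_notFreeA {v x : Tm} {d : ℕ} {r : ℕ → M.C} (hv : v.ub ≤ d) (hx : x.ub ≤ d) :
    (notFreeA v x d).Holds M r ↔ NotFree (v.eval M r) (x.eval M r) := by
  unfold notFreeA
  simp (disch := first | omega | simp only [ub_cd] <;> omega) only [holds_conn, holds_isA, eval_cd,
    Function.update_self, exists_eq_left]
  rw [holds_replA (ok' := fun _ => True) (fun _ _ _ _ _ _ => by simp) (by omega) (by simp [Tm.ub])
    (by omega) (by omega), Tm.eval_update hv, Tm.eval_update hx, NotFree, eval_var,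
    Function.update_self]

/-- `x'` is `x(t/v)`, and `t` is free for `v` in `x`. -/
def Sub (v t x x' : M.C) : Prop := Repl (fun z => NotFree z t) v t x x'

theorem holds_subA {v t x x' : Tm} {d : ℕ} {r : ℕ → M.C} (hv : v.ub ≤ d) (ht : t.ub ≤ d)
    (hx : x.ub ≤ d) (hx' : x'.ub ≤ d) : (subA v t x x' d).Holds M r ↔
      Sub (v.eval M r) (t.eval M r) (x.eval M r) (x'.eval M r) :=
  holds_replA (fun d' r' z h1 h2 h3 => by
    rw [holds_notFreeA h3 (by omega), Tm.eval_agree ht h2]) hv ht hx hx'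

/-- `m` is the code of the numeral for `n`. -/
def IsNum (n m : M.C) : Prop :=
  Gen (fun y => y = pr 0 cZero)
    (fun u _ y => ∃ k c, u = pr k c ∧ y = pr (k + 1) (cSucc c)) (pr n m)

theorem holds_numA {n m : Tm} {d : ℕ} {r : ℕ → M.C} (hn : n.ub ≤ d) (hm : m.ub ≤ d) :
    (numA n m d).Holds M r ↔ IsNum (n.eval M r) (m.eval M r) := by
  unfold numA
  simp (disch := first | omega | simp only [ub_cd] <;> omega) only [holds_conn, holds_isA, eval_cd,
    Tm.eval_update, Function.update_self, exists_eq_left]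
  rw [holds_genA (B := fun y => y = pr 0 cZero)
    (St := fun u _ y => ∃ k c, u = pr k c ∧ y = pr (k + 1) (cSucc c)) ?_ ?_ (by simp [Tm.ub]),
    IsNum, eval_var, Function.update_self]
  · intro d' r' t h1 h2 h3
    simp (disch := first | omega | simp only [ub_cd] <;> omega) only [holds_isA, eval_cd]
  · intro d' r' t u w h1 h2 h3 h4 h5
    simp (disch := first | omega | (simp only [ub_cd] <;> omega)) only
      [holds_conn, holds_isA, eval_cd, Tm.eval_update, Function.update_self, Function.update_of_ne]

/-- `B` arises from `A` by quantifying free variables. -/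
def Pre (A B : M.C) : Prop :=
  Gen (fun y => y = A) (fun u _ y => ∃ v, ¬ NotFree v u ∧ y = cAll v u) B

/-- `B` is a universal closure of `A`. -/
def Clos (A B : M.C) : Prop := Pre A B ∧ ∀ v, NotFree v B

theorem holds_closureA {A B : Tm} {d : ℕ} {r : ℕ → M.C} (hA : A.ub ≤ d) (hB : B.ub ≤ d) :
    (closureA A B d).Holds M r ↔ Clos (A.eval M r) (B.eval M r) := by
  simp (disch := first | omega | simp only [ub_cd] <;> omega) only [closureA, holds_conn, Clos,
    holds_notFreeA, Tm.eval_update, eval_cd, Function.update_self]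
  rw [holds_genA (B := fun y => y = A.eval M r)
    (St := fun u _ y => ∃ v, ¬ NotFree v u ∧ y = cAll v u) ?_ ?_ hB, Pre]
  · intro d' r' t h1 h2 h3
    simp only [holds_conn, Tm.eval_agree hA h2]
  · intro d' r' t u w h1 h2 h3 h4 h5
    simp (disch := first | omega | (simp only [ub_cd] <;> omega)) only
      [holds_conn, holds_isA, holds_notFreeA, eval_cd, Tm.eval_update, Function.update_self]

/-- `x` is the induction axiom for the formula `A` and the variable `v`. -/
def IsInd (v A x : M.C) : Prop :=
  ∃ A₀ A₁, Sub v cZero A A₀ ∧ Sub v (cSucc (cVar v)) A A₁ ∧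
    x = cImp (cAnd A₀ (cAll v (cImp A A₁))) (cAll v A)

theorem holds_indA {v A x : Tm} {d : ℕ} {r : ℕ → M.C} (hv : v.ub ≤ d) (hA : A.ub ≤ d)
    (hx : x.ub ≤ d) :
    (indA v A x d).Holds M r ↔ IsInd (v.eval M r) (A.eval M r) (x.eval M r) := by
  simp (disch := first | omega | (simp only [ub_cd] <;> omega)) only
      [indA, holds_conn, holds_isA, holds_subA, eval_cd, Tm.eval_update, Function.update_self,
      Function.update_of_ne, IsInd]
  exact ⟨fun ⟨z, s, a, b, h1, h2, h3, h4, h5⟩ => ⟨a, b, h1 ▸ h3, h2 ▸ h4, h5⟩,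
    fun ⟨a, b, h3, h4, h5⟩ => ⟨_, _, a, b, rfl, rfl, h3, h4, h5⟩⟩

/-- `x` has the shape of a logical axiom. -/
def IsLogAx (S : Thy) (D : M.C → Prop) (x : M.C) : Prop :=
  (∃ A B, x = cImp A (cImp B A)) ∨
  (∃ A B C, x = cImp (cImp A (cImp B C)) (cImp (cImp A B) (cImp A C))) ∨
  (∃ A, x = cImp (cNot (cNot A)) A) ∨
  (∃ v t A B, Wf S D 0 t ∧ Sub v t A B ∧ x = cImp (cAll v A) B) ∨
  (∃ v A B, NotFree v A ∧ x = cImp (cAll v (cImp A B)) (cImp A (cAll v B))) ∨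
  (∃ t, x = cEq t t) ∨
  (∃ v t u A B C, Wf S D 1 A ∧ Sub v t A B ∧ Sub v u A C ∧
    x = cImp (cEq t u) (cImp B C))

theorem holds_logAxA {S : Thy} {D : Tm → Bld} {Ds : M.C → Prop} {x : Tm} {d : ℕ} {r : ℕ → M.C}
    (hD : Rep1 M d r D Ds) (hx : x.ub ≤ d) :
    (logAxA S D x d).Holds M r ↔ IsLogAx S Ds (x.eval M r) := by
  have htm : ∀ d' r' t, d ≤ d' → (∀ v < d, r' v = r v) → t.ub ≤ d' →
      ((tmA S D t d').Holds M r' ↔ Wf S Ds 0 (t.eval M r')) :=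
    fun d' r' t h1 h2 h3 => holds_tmA (hD.mono h1 h2) h3
  have hfm : ∀ d' r' t, d ≤ d' → (∀ v < d, r' v = r v) → t.ub ≤ d' →
      ((fmA S D t d').Holds M r' ↔ Wf S Ds 1 (t.eval M r')) :=
    fun d' r' t h1 h2 h3 => holds_fmA (hD.mono h1 h2) h3
  simp (disch := first | omega | (simp only [ub_cd] <;> omega) |
        (intro v hv; simp (disch := omega) only [Function.update_of_ne])) only
      [logAxA, holds_conn, holds_isA, holds_subA, holds_notFreeA, eval_cd, Tm.eval_update,
      Function.update_self, Function.update_of_ne, IsLogAx, htm, hfm]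

/-- `z` follows from `x` and `y` by modus ponens, or from `x` by generalization. -/
def Infers (x y z : M.C) : Prop := y = cImp x z ∨ ∃ v, z = cAll v x

theorem holds_inferA {x y z : Tm} {d : ℕ} {r : ℕ → M.C} (hx : x.ub ≤ d) (hy : y.ub ≤ d)
    (hz : z.ub ≤ d) :
    (inferA x y z d).Holds M r ↔ Infers (x.eval M r) (y.eval M r) (z.eval M r) := by
  simp (disch := first | omega | (simp only [ub_cd] <;> omega)) only
      [inferA, holds_conn, holds_isA, eval_cd, Tm.eval_update, Function.update_self, Infers]

theorem holds_ruleA {S : Thy} {D : Tm → Bld} {Ds : M.C → Prop} {x y z : Tm} {d : ℕ}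
    {r : ℕ → M.C} (hD : Rep1 M d r D Ds) (hx : x.ub ≤ d) (hy : y.ub ≤ d) (hz : z.ub ≤ d) :
    (ruleA S D x y z d).Holds M r ↔
      (IsLogAx S Ds (z.eval M r) ∨ Infers (x.eval M r) (y.eval M r) (z.eval M r)) := by
  rw [ruleA, holds_bor, holds_logAxA hD hz, holds_inferA hx hy hz]

theorem holds_trueA {a : ℕ} {c : Cd} {d : ℕ} {r : ℕ → M.C} (hc : c.ub ≤ d) :
    (trueA a c d).Holds M r ↔ M.tr a (c.eval M r) := by
  simp (disch := first | omega | (simp only [ub_cd] <;> omega)) only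
      [trueA, holds_conn, holds_isA, eval_cd, Cd.eval_update, Function.update_self,
      exists_eq_left]

end EvaluationSyntax

/-! ### Languages and free variables of the arithmetized syntax -/

section Languages

variable {L : Lang}

theorem Tm.In.mono {L' : Lang} {t : Tm} (h : t.In L) (hf : ∀ k i, L.fn k i → L'.fn k i) :
    t.In L' := by
  induction t with
  | var v => trivial
  | zero => trivial
  | succ t ih => exact ih h
  | add t u iht ihu => exact ⟨iht h.1, ihu h.2⟩
  | mul t u iht ihu => exact ⟨iht h.1, ihu h.2⟩
  | fn k i ts ih => exact ⟨hf _ _ h.1, fun j => ih j (h.2 j)⟩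

theorem Fm.In.mono {L' : Lang} {A : Fm} (h : A.In L) (hf : ∀ k i, L.fn k i → L'.fn k i)
    (hr : ∀ k i, L.rel k i → L'.rel k i) (ht : ∀ a, L.tr a → L'.tr a) : A.In L' := by
  induction A with
  | bot => trivial
  | eq t u => exact ⟨h.1.mono hf, h.2.mono hf⟩
  | rel k i ts => exact ⟨hr _ _ h.1, fun j => (h.2 j).mono hf⟩
  | tr a t => exact ⟨ht _ h.1, h.2.mono hf⟩
  | imp A B ihA ihB => exact ⟨ihA h.1, ihB h.2⟩
  | all v A ih => exact ih h

theorem Fm.In.of_arith {A : Fm} (h : A.In Lang.arith) : A.In L :=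
  h.mono (fun _ _ h => h.elim) (fun _ _ h => h.elim) (fun _ h => h.elim)

theorem Tm.in_shift {t : Tm} (h : t.In L) (d : ℕ) : (t.shift d).In L := by
  induction t with
  | var v => trivial
  | zero => trivial
  | succ t ih => exact ih h
  | add t u iht ihu => exact ⟨iht h.1, ihu h.2⟩
  | mul t u iht ihu => exact ⟨iht h.1, ihu h.2⟩
  | fn k i ts ih => exact ⟨h.1, fun j => ih j (h.2 j)⟩

theorem Fm.in_shift {A : Fm} (h : A.In L) (d : ℕ) : (A.shift d).In L := by
  induction A with
  | bot => trivial
  | eq t u => exact ⟨Tm.in_shift h.1 d, Tm.in_shift h.2 d⟩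
  | rel k i ts => exact ⟨h.1, fun j => Tm.in_shift (h.2 j) d⟩
  | tr a t => exact ⟨h.1, Tm.in_shift h.2 d⟩
  | imp A B ihA ihB => exact ⟨ihA h.1, ihB h.2⟩
  | all v A ih => exact ih h

theorem in_var (v : ℕ) : (Tm.var v).In L := trivial

theorem in_num (n : ℕ) : (num n).In L := by
  induction n with
  | zero => trivial
  | succ n ih => exact ih

/-- The terms in the expression belong to the language. -/
def Cd.In (L : Lang) : Cd → Prop
  | .tm t => t.In L
  | .pr c d => c.In L ∧ d.In L

theorem in_cd (L : Lang) :
    (∀ c, (Cd.var c).In L ↔ c.In L) ∧ (∀ c, (Cd.succ c).In L ↔ c.In L) ∧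
    (∀ c, (Cd.not c).In L ↔ c.In L) ∧ Cd.zero.In L ∧ Cd.nil.In L ∧ Cd.bot.In L ∧
    (∀ c e, (Cd.add c e).In L ↔ c.In L ∧ e.In L) ∧
    (∀ c e, (Cd.mul c e).In L ↔ c.In L ∧ e.In L) ∧
    (∀ c e, (Cd.fn c e).In L ↔ c.In L ∧ e.In L) ∧
    (∀ c e, (Cd.cons c e).In L ↔ c.In L ∧ e.In L) ∧
    (∀ c e, (Cd.eq c e).In L ↔ c.In L ∧ e.In L) ∧
    (∀ c e, (Cd.rel c e).In L ↔ c.In L ∧ e.In L) ∧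
    (∀ c e, (Cd.tr c e).In L ↔ c.In L ∧ e.In L) ∧
    (∀ c e, (Cd.imp c e).In L ↔ c.In L ∧ e.In L) ∧
    (∀ c e, (Cd.all c e).In L ↔ c.In L ∧ e.In L) ∧
    (∀ c e, (Cd.and c e).In L ↔ c.In L ∧ e.In L) ∧
    (∀ c e, (Cd.iff c e).In L ↔ c.In L ∧ e.In L) ∧
    (∀ c e, (Cd.pr c e).In L ↔ c.In L ∧ e.In L) ∧ (∀ t, (Cd.tm t).In L ↔ t.In L) ∧
    (∀ i c, (Cd.tag i c).In L ↔ c.In L) ∧ (∀ v, (Tm.var v).In L) ∧ Tm.zero.In L ∧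
    (∀ t, (Tm.succ t).In L ↔ t.In L) ∧
    (∀ t u, (Tm.add t u).In L ↔ t.In L ∧ u.In L) ∧
    (∀ t u, (Tm.mul t u).In L ↔ t.In L ∧ u.In L) ∧ (∀ n, (num n).In L) := by
  simp [Cd.var, Cd.zero, Cd.bot, Cd.nil, Cd.succ, Cd.add, Cd.mul, Cd.eq, Cd.cons, Cd.fn, Cd.rel,
    Cd.tr, Cd.imp, Cd.all, Cd.not, Cd.and, Cd.iff, Cd.tag, Cd.In, Tm.In, in_num]
  tauto

theorem in_conn (L : Lang) :
    (∀ (d : ℕ) f, (Bld.all f d).In L ↔ (f (.var d) (d + 1)).In L) ∧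
    (∀ (d : ℕ) f, (Bld.ex f d).In L ↔ (f (.var d) (d + 1)).In L) ∧
    (∀ (d : ℕ) t u, ((t =ₐ u) d).In L ↔ t.In L ∧ u.In L) ∧
    (∀ (d : ℕ) a t, (Bld.tr a t d).In L ↔ L.tr a ∧ t.In L) ∧
    (∀ (d : ℕ), (Bld.bot d).In L) ∧
    (∀ (d : ℕ) A, (Bld.not A d).In L ↔ (A d).In L) ∧
    (∀ (d : ℕ) A B, ((A →ₐ B) d).In L ↔ (A d).In L ∧ (B d).In L) ∧
    (∀ (d : ℕ) A B, ((A ∧ₐ B) d).In L ↔ (A d).In L ∧ (B d).In L) ∧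
    (∀ (d : ℕ) A B, ((A ∨ₐ B) d).In L ↔ (A d).In L ∧ (B d).In L) ∧
    (∀ (d : ℕ) A B, ((A ↔ₐ B) d).In L ↔ (A d).In L ∧ (B d).In L) := by
  simp only [Bld.all, Bld.ex, Bld.eq, Bld.tr, Bld.bot, Bld.not, Bld.imp, Bld.and, Bld.or, Bld.iff,
    Fm.ex, Fm.not, Fm.and, Fm.or, Fm.iff, Fm.In]
  tauto

theorem in_app1 {A : ArithFm 1} {t : Tm} (ht : t.In L) (d : ℕ) : (app1 A t d).In L :=
  Fm.in_subst (Fm.in_shift A.arith.of_arith d) ht d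

theorem in_app2 {A : ArithFm 2} {t u : Tm} (ht : t.In L) (hu : u.In L) (d : ℕ) :
    (app2 A t u d).In L :=
  Fm.in_subst (Fm.in_subst (Fm.in_shift A.arith.of_arith d) ht d) hu (d + 1)

theorem in_leA {x y : Tm} (hx : x.In L) (hy : y.In L) (d : ℕ) : (leA x y d).In L := by
  simp only [leA, in_conn, in_cd, *, and_self]

theorem in_ltA {x y : Tm} (hx : x.In L) (hy : y.In L) (d : ℕ) : (ltA x y d).In L :=
  in_leA (x := x.succ) hx hy d

theorem in_pairA {x y z : Tm} (hx : x.In L) (hy : y.In L) (hz : z.In L) (d : ℕ) :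
    (pairA x y z d).In L := by
  simp only [pairA, in_conn, in_cd, in_leA hy hx, in_ltA hx hy, *, and_self]

theorem in_betaA {p q i y : Tm} (hp : p.In L) (hq : q.In L) (hi : i.In L) (hy : y.In L)
    (d : ℕ) : (betaA p q i y d).In L := by
  simp only [betaA, in_conn, in_cd, in_leA (x := y) (y := .mul (.succ i) q) hy ⟨hi, hq⟩, *,
    and_self]

theorem in_isA {x : Tm} {c : Cd} (hx : x.In L) (hc : c.In L) (d : ℕ) : (isA x c d).In L := by
  induction c generalizing x d with
  | tm t => exact ⟨hx, hc⟩
  | pr c e ihc ihe =>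
    simp only [isA, in_conn]
    exact ⟨ihc (in_var _) hc.1 _, ihe (in_var _) hc.2 _, in_pairA (in_var _) (in_var _) hx _⟩

theorem in_genA {base : Tm → Bld} {step : Tm → Tm → Tm → Bld} {x : Tm}
    (hB : ∀ t d, t.In L → (base t d).In L)
    (hS : ∀ t u w d, t.In L → u.In L → w.In L → (step t u w d).In L) (hx : x.In L) (d : ℕ) :
    (genA base step x d).In L := by
  simp (disch := simp only [in_cd, *]) only [genA, in_conn, in_betaA, in_leA, in_ltA, hB, hS,
    and_self]

theorem in_wfA {S : Thy} {D : Tm → Bld} {s x : Tm} (hD : ∀ t d, t.In L → (D t d).In L)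
    (hs : s.In L) (hx : x.In L) (d : ℕ) : (wfA S D s x d).In L := by
  simp (disch := simp only [in_cd, *, and_self]) only [wfA, in_conn, in_isA, true_and]
  refine in_genA (fun t d ht => ?_) (fun t u w d ht hu hw => ?_) (in_var _) _
  · simp (disch := simp only [in_cd, *, and_self]) only [in_conn, in_isA, and_self]
  · simp (disch := simp only [in_cd, *, and_self]) only [in_conn, in_isA, in_app2, hD, and_self]

theorem in_tmA {S : Thy} {D : Tm → Bld} {x : Tm} (hD : ∀ t d, t.In L → (D t d).In L)
    (hx : x.In L) (d : ℕ) : (tmA S D x d).In L := in_wfA hD (in_num 0) hx d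

theorem in_fmA {S : Thy} {D : Tm → Bld} {x : Tm} (hD : ∀ t d, t.In L → (D t d).In L)
    (hx : x.In L) (d : ℕ) : (fmA S D x d).In L := in_wfA hD (in_num 1) hx d

theorem in_replA {ok : Tm → Bld} {v t x x' : Tm} (hok : ∀ t d, t.In L → (ok t d).In L)
    (hv : v.In L) (ht : t.In L) (hx : x.In L) (hx' : x'.In L) (d : ℕ) :
    (replA ok v t x x' d).In L := by
  simp (disch := simp only [in_cd, *, and_self]) only [replA, in_conn, in_isA, true_and]
  refine in_genA (fun t d ht => ?_) (fun t u w d ht hu hw => ?_) (in_var _) _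
  · simp (disch := simp only [in_cd, *, and_self]) only [in_conn, in_isA, in_cd, hv, and_self]
  · simp (disch := simp only [in_cd, *, and_self]) only [in_conn, in_isA, in_cd, hv, hok, and_self]

theorem in_notFreeA {v x : Tm} (hv : v.In L) (hx : x.In L) (d : ℕ) : (notFreeA v x d).In L := by
  simp only [notFreeA, in_conn]
  exact ⟨in_isA (in_var _) (by simp only [in_cd]) _,
    in_replA (fun _ _ _ => by exact ⟨trivial, trivial⟩) hv (in_var _) hx hx _⟩

theorem in_subA {v t x x' : Tm} (hv : v.In L) (ht : t.In L) (hx : x.In L) (hx' : x'.In L)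
    (d : ℕ) : (subA v t x x' d).In L :=
  in_replA (fun _ d h => in_notFreeA h ht d) hv ht hx hx' d

theorem in_numA {n m : Tm} (hn : n.In L) (hm : m.In L) (d : ℕ) : (numA n m d).In L := by
  simp (disch := simp only [in_cd, *, and_self]) only [numA, in_conn, in_isA, true_and]
  refine in_genA (fun t d ht => ?_) (fun t u w d ht hu hw => ?_) (in_var _) _
  · simp (disch := simp only [in_cd, *, and_self]) only [in_isA]
  · simp (disch := simp only [in_cd, *, and_self]) only [in_conn, in_isA, and_self]

theorem in_closureA {A B : Tm} (hA : A.In L) (hB : B.In L) (d : ℕ) : (closureA A B d).In L := by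
  simp only [closureA, in_conn]
  refine ⟨in_genA (fun t d ht => ?_) (fun t u w d ht hu hw => ?_) hB _,
    in_notFreeA (in_var _) hB _⟩
  · simp only [in_conn, ht, hA, and_self]
  · simp (disch := simp only [in_cd, *, and_self]) only [in_conn, in_isA, in_notFreeA, and_self]

theorem in_indA {v A x : Tm} (hv : v.In L) (hA : A.In L) (hx : x.In L) (d : ℕ) :
    (indA v A x d).In L := by
  simp (disch := simp only [in_cd, *, and_self]) only [indA, in_conn, in_isA, in_subA, and_self]

theorem in_logAxA {S : Thy} {D : Tm → Bld} {x : Tm} (hD : ∀ t d, t.In L → (D t d).In L)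
    (hx : x.In L) (d : ℕ) : (logAxA S D x d).In L := by
  have htm := fun t ht d => in_tmA (S := S) (x := t) hD ht d
  have hfm := fun t ht d => in_fmA (S := S) (x := t) hD ht d
  simp (disch := simp only [in_cd, *, and_self]) only [logAxA, in_conn, in_isA, in_subA,
    in_notFreeA, htm, hfm, and_self]

theorem in_inferA {x y z : Tm} (hx : x.In L) (hy : y.In L) (hz : z.In L) (d : ℕ) :
    (inferA x y z d).In L := by
  simp (disch := simp only [in_cd, *, and_self]) only [inferA, in_conn, in_isA, and_self]

theorem in_ruleA {S : Thy} {D : Tm → Bld} {x y z : Tm} (hD : ∀ t d, t.In L → (D t d).In L)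
    (hx : x.In L) (hy : y.In L) (hz : z.In L) (d : ℕ) : (ruleA S D x y z d).In L := by
  simp only [ruleA, in_conn, in_logAxA hD hz, in_inferA hx hy hz, and_self]

theorem in_trueA {a : ℕ} {c : Cd} (ha : L.tr a) (hc : c.In L) (d : ℕ) : (trueA a c d).In L := by
  simp (disch := simp only [in_cd, *, and_self]) only [trueA, in_conn, in_isA, in_cd, ha, and_self]

theorem in_below {lt : ArithFm 2} {c e : Tm} (hc : c.In L) (he : e.In L) (d : ℕ) :
    (below lt c e d).In L := in_app2 he hc d

theorem in_upTo {lt : ArithFm 2} {c e : Tm} (hc : c.In L) (he : e.In L) (d : ℕ) :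
    (upTo lt c e d).In L := by
  simp only [upTo, in_conn, in_app2 he hc, *, and_self]

theorem in_baseA {S : Thy} {x : Tm} (hx : x.In L) (d : ℕ) : (baseA S x d).In L :=
  in_fmA (fun _ _ _ => by trivial) hx d

theorem in_inLA {S : Thy} {lt : ArithFm 2} {a : ℕ} {x : Tm} (hx : x.In L) (d : ℕ) :
    (inLA S lt a x d).In L := in_fmA (fun _ d h => in_below (in_num a) h d) hx d

theorem in_inLsuccA {S : Thy} {lt : ArithFm 2} {a : ℕ} {x : Tm} (hx : x.In L) (d : ℕ) :
    (inLsuccA S lt a x d).In L := in_fmA (fun _ d h => in_upTo (in_num a) h d) hx d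

theorem in_inLFm (S : Thy) (lt : ArithFm 2) : (inLFm S lt).In L :=
  in_fmA (fun _ d h => in_below (in_var _) h d) (in_var _) 2

section

variable (S : Thy) (lt : ArithFm 2) {a : ℕ}

theorem in_axAxioms (ha : L.tr a) : (axAxioms S a).In L := by
  simp (disch := simp only [in_cd]) only [axAxioms, in_conn, in_baseA, in_app1, in_cd, ha, and_self]

theorem in_axRules (ha : L.tr a) : (axRules S lt a).In L := by
  have h := fun x y z hx hy hz d => in_ruleA (L := L) (S := S) (D := below lt (num a)) (x := x)
    (y := y) (z := z) (fun _ d h => in_below (in_num a) h d) hx hy hz d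
  simp (disch := simp only [in_cd]) only [axRules, in_conn, in_inLA, h, in_cd, ha, and_self]

theorem in_axInd (ha : L.tr a) : (axInd S lt a).In L := by
  simp (disch := simp only [in_cd]) only [axInd, in_conn, in_inLA, in_indA, in_cd, ha, and_self]

theorem in_axOmega (ha : L.tr a) : (axOmega S lt a).In L := by
  simp (disch := simp only [in_cd, ha, and_self]) only [axOmega, in_conn, in_inLA, in_notFreeA,
    in_numA, in_subA, in_trueA, in_cd, ha, and_self]

theorem in_axDefs (ha : L.tr a) : (axDefs S lt a).In L := by
  have h := fun c x hc hx d => in_fmA (L := L) (S := S) (D := below lt c) (x := x)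
    (fun _ d h => in_below hc h d) hx d
  simp (disch := simp only [in_cd, ha, and_self]) only [axDefs, in_conn, in_app2, h, in_closureA,
    in_numA, in_trueA, and_self]

theorem in_axAgree (ha : L.tr a) {b : ℕ} (hb : L.tr b) : (axAgree S lt a b).In L := by
  have h : ((inLFm S lt).subst 0 (num b)).In L := Fm.in_subst (in_inLFm S lt) (in_num b) 0
  exact ⟨h, ⟨⟨⟨hb, trivial⟩, ha, trivial⟩, ⟨⟨ha, trivial⟩, hb, trivial⟩, trivial⟩, trivial⟩

theorem in_axA {x : Tm} (hx : x.In L) (d : ℕ) : (axA S lt a x d).In L := by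
  simp (disch := simp only [in_cd, *, and_self]) only [axA, in_conn, in_baseA, in_app1, in_app2,
    in_inLA, in_inLsuccA, in_indA, in_closureA, in_numA, in_subA, in_isA, in_cd, hx, and_self]

theorem in_thmA {x : Tm} (hx : x.In L) (d : ℕ) : (thmA S lt a x d).In L := by
  refine in_genA (fun t d ht => ?_) (fun t u w d ht hu hw => ?_) hx d
  · simp only [in_conn, in_inLsuccA ht, in_axA S lt ht,
      in_logAxA (fun _ d h => in_upTo (in_num a) h d) ht, and_self]
  · simp only [in_conn, in_inLsuccA hw, in_inferA ht hu hw, and_self]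

end

theorem in_theoremsTrue (S : Thy) (lt : ArithFm 2) {a : ℕ} (ha : L.tr a) (b : ℕ) :
    (theoremsTrue S lt a b).In L := by
  simp (disch := simp only [in_cd]) only [theoremsTrue, in_conn, in_thmA, in_cd, ha, and_self]

end Languages

/-! ### Internal syntax in models of arithmetic -/

section InternalSyntax

set_option synthInstance.maxHeartbeats 400000
set_option synthInstance.maxSize 1000

variable {M : Str} [PAModel M] {L : Lang}

instance DefP.true : DefP L M fun _ => True := .of_fm (A := .imp .bot .bot) (by exact ⟨trivial, trivial⟩)
  fun _ => iff_of_true trivial id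

instance (i : ℕ) (f : (ℕ → M.C) → M.C) [DefF L M f] : DefF L M fun r => tag i (f r) := by
  unfold tag; infer_instance

/-- Generated classes are definable, uniformly in parameters. -/
theorem Gen.defP {B : (ℕ → M.C) → M.C → Prop} {St : (ℕ → M.C) → M.C → M.C → M.C → Prop}
    (hB : DefP L M fun r => B (tail r) (r 0))
    (hS : DefP L M fun r => St (tail (tail (tail r))) (r 0) (r 1) (r 2)) :
    DefP L M fun r => Gen (B (tail r)) (St (tail r)) (r 0) := by
  have hB' : DefP L M fun r => B (tail (tail (tail (tail (tail (tail r)))))) (r 0) :=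
    (hB.rename fun i => if i = 0 then 0 else i + 5).congr fun r => by
      have : tail (fun i => r (if i = 0 then 0 else i + 5)) =
        tail (tail (tail (tail (tail (tail r))))) := by funext i; simp [tail]
      simp only [this, if_true]
  have hS' : DefP L M fun r => St (tail (tail (tail (tail (tail (tail (tail (tail (tail
      (tail r)))))))))) (tail r 0) (r 0) (tail (tail (tail (tail r))) 0) :=
    (hS.rename fun i => if i = 0 then 1 else if i = 1 then 0 else if i = 2 then 4 else
      i + 7).congr fun r => by
      have : tail (tail (tail (fun i => r (if i = 0 then 1 else if i = 1 then 0 else if i = 2 then 4 else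
        i + 7)))) = tail (tail (tail (tail (tail (tail (tail (tail (tail
          (tail r))))))))) := by funext i; simp [tail]
      simp only [this]
      simp [tail]
  unfold Gen
  infer_instance

instance ArithFm.defP_rel (A : ArithFm 2) (f g : (ℕ → M.C) → M.C) [hf : DefF L M f]
    [hg : DefF L M g] : DefP L M fun r => A.rel M (f r) (g r) :=
  .comp2 (P := A.rel M) (.of_fm (A := A.fm) A.arith.of_arith fun r => Fm.holds_congr fun v hv => by
    have := A.free v hv
    interval_cases v <;> rfl) hf hg

/-- The predicate is definable, whatever the language. -/
class ArithDef (D : M.C → Prop) : Prop where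
  out : ∀ L, DefP L M fun r => D (r 0)

instance : ArithDef (M := M) fun _ => False := ⟨fun _ => inferInstance⟩

instance : ArithDef (M := M) fun _ => True := ⟨fun _ => inferInstance⟩

instance (A : ArithFm 2) (c : M.C) : ArithDef fun e => A.rel M e c := ⟨fun _ => inferInstance⟩

/-- Internal expressions form a definable class. -/
instance Wf.defP (S : Thy) (D : M.C → Prop) [hD : ArithDef D]
    (f g : (ℕ → M.C) → M.C) [hf : DefF L M f] [hg : DefF L M g] :
    DefP L M fun r => Wf S D (f r) (g r) := by
  have hD' := fun f [hf : DefF L M f] => (hD.out L).comp1 hf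
  have : DefP L M fun r => Gen WfBase (WfStep S D) (r 0) :=
    Gen.defP (B := fun _ => WfBase) (St := fun _ => WfStep S D)
      (by unfold WfBase; infer_instance) (by unfold WfStep; infer_instance)
  exact .comp2 (P := Wf S D) (this.comp1 (f := fun r => pr (r 0) (r 1)) inferInstance) hf hg

instance Repl.defP (ok : M.C → Prop) [hok : ArithDef ok] (f g h k : (ℕ → M.C) → M.C)
    [hf : DefF L M f] [hg : DefF L M g] [hh : DefF L M h] [hk : DefF L M k] :
    DefP L M fun r => Repl ok (f r) (g r) (h r) (k r) := by
  have hok' := fun f [hf : DefF L M f] => (hok.out L).comp1 hf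
  have : DefP L M fun r => Gen (ReplBase (tail r 0) (tail r 1)) (ReplStep ok (tail r 0)) (r 0) :=
    Gen.defP (B := fun r => ReplBase (r 0) (r 1)) (St := fun r => ReplStep ok (r 0))
      (by unfold ReplBase; infer_instance) (by unfold ReplStep; infer_instance)
  refine .comp4 (P := Repl ok) ?_ hf hg hh hk
  exact this.inst (P := fun x r => Gen (ReplBase (r 0) (r 1)) (ReplStep ok (r 0)) x)
    (f := fun r => pr (r 2) (r 3)) inferInstance

instance NotFree.defP (f g : (ℕ → M.C) → M.C) [DefF L M f] [DefF L M g] :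
    DefP L M fun r => NotFree (f r) (g r) := by
  unfold NotFree; infer_instance

instance Pre.defP (f g : (ℕ → M.C) → M.C) [hf : DefF L M f] [hg : DefF L M g] :
    DefP L M fun r => Pre (f r) (g r) := by
  have : DefP L M fun r => Gen (fun y => y = tail r 0)
      (fun u _ y => ∃ v, ¬ NotFree v u ∧ y = cAll v u) (r 0) :=
    Gen.defP (B := fun r y => y = r 0) (St := fun r u _ y => ∃ v, ¬ NotFree v u ∧ y = cAll v u)
      inferInstance inferInstance
  exact .comp2 (P := fun x y => Pre y x) this hg hf

instance IsNum.defP (f g : (ℕ → M.C) → M.C) [hf : DefF L M f] [hg : DefF L M g] :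
    DefP L M fun r => IsNum (f r) (g r) := by
  have : DefP L M fun r => Gen (fun y => y = pr 0 cZero)
      (fun u _ y => ∃ k c, u = pr k c ∧ y = pr (k + 1) (cSucc c)) (r 0) :=
    Gen.defP (B := fun r y => y = pr 0 cZero) (St := fun r u _ y => ∃ k c, u = pr k c ∧ y = pr (k + 1) (cSucc c))
      inferInstance inferInstance
  exact .comp2 (P := IsNum) (this.comp1 (f := fun r => pr (r 0) (r 1)) inferInstance) hf hg

/-! ### Constructors and inversions of internal expressions -/

theorem pr_eq_tag {s x y : M.C} {i : ℕ} : pr s x = tag i y ↔ s = i ∧ x = y := by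
  rw [tag, pr_inj]

section

variable {S : Thy} {D : M.C → Prop} {s : M.C}

theorem wf_iff {x : M.C} : Wf S D s x ↔
    (s = 0 ∧ ((∃ v, x = cVar v) ∨ x = cZero ∨ (∃ t, Wf S D 0 t ∧ x = cSucc t) ∨
      (∃ t u, Wf S D 0 t ∧ Wf S D 0 u ∧ (x = cAdd t u ∨ x = cMul t u)) ∨
      ∃ k i l, Wf S D (k + 1 + 1) l ∧ S.funSym.rel M k i ∧ x = cFn (pr k i) l)) ∨
    (s = 1 ∧ (x = cBot ∨ (∃ t u, Wf S D 0 t ∧ Wf S D 0 u ∧ x = cEq t u) ∨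
      (∃ k i l, Wf S D (k + 1 + 1) l ∧ S.relSym.rel M k i ∧ x = cRel (pr k i) l) ∨
      (∃ e t, Wf S D 0 t ∧ D e ∧ x = cTr e t) ∨
      (∃ A B, Wf S D 1 A ∧ Wf S D 1 B ∧ x = cImp A B) ∨ ∃ v A, Wf S D 1 A ∧ x = cAll v A)) ∨
    (s = 1 + 1 ∧ x = cNil) ∨
    ∃ k t l, s = k + 1 + 1 + 1 ∧ Wf S D 0 t ∧ Wf S D (k + 1 + 1) l ∧ x = cCons t l := by
  have e0 : ∀ y : M.C, tag 0 y = pr 0 y := fun y => by rw [tag, Nat.cast_zero]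
  have e1 : ∀ y : M.C, tag 1 y = pr 1 y := fun y => by rw [tag, Nat.cast_one]
  constructor
  · intro h
    rcases Gen.cases h with h | ⟨u, w, hu, hw, h⟩
    · rcases h with ⟨v, h⟩ | h | h | h <;> rw [pr_eq_tag] at h <;> obtain ⟨rfl, rfl⟩ := h
      · simp
      · simp
      · simp
      · simp [one_add_one_eq_two]
    · rcases h with ⟨t, rfl, h⟩ | ⟨t, t', rfl, rfl, h | h | h⟩ | ⟨t, k, l, rfl, rfl, h⟩ |
        ⟨k, i, l, rfl, ⟨h', h⟩ | ⟨h', h⟩⟩ | ⟨e, t, rfl, h', h⟩ | ⟨A, B, rfl, rfl, h⟩ | ⟨v, A, rfl, h⟩ <;>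
      simp only [pr_eq_tag, pr_inj, Nat.cast_zero, Nat.cast_one] at h <;> obtain ⟨rfl, rfl⟩ := h <;>
      try simp only [e0, e1] at hu hw
      · exact .inl ⟨rfl, .inr (.inr (.inl ⟨t, hu, rfl⟩))⟩
      · exact .inl ⟨rfl, .inr (.inr (.inr (.inl ⟨t, t', hu, hw, .inl rfl⟩)))⟩
      · exact .inl ⟨rfl, .inr (.inr (.inr (.inl ⟨t, t', hu, hw, .inr rfl⟩)))⟩
      · exact .inr (.inl ⟨rfl, .inr (.inl ⟨t, t', hu, hw, rfl⟩)⟩)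
      · exact .inr (.inr (.inr ⟨k, t, l, rfl, hu, hw, rfl⟩))
      · exact .inl ⟨rfl, .inr (.inr (.inr (.inr ⟨k, i, l, hu, h', rfl⟩)))⟩
      · exact .inr (.inl ⟨rfl, .inr (.inr (.inl ⟨k, i, l, hu, h', rfl⟩))⟩)
      · exact .inr (.inl ⟨rfl, .inr (.inr (.inr (.inl ⟨e, t, hu, h', rfl⟩)))⟩)
      · exact .inr (.inl ⟨rfl, .inr (.inr (.inr (.inr (.inl ⟨A, B, hu, hw, rfl⟩))))⟩)
      · exact .inr (.inl ⟨rfl, .inr (.inr (.inr (.inr (.inr ⟨v, A, hu, rfl⟩))))⟩)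
  · have e2 : (1 + 1 : M.C) = ((2 : ℕ) : M.C) := by push_cast; ring
    rintro (⟨rfl, ⟨v, rfl⟩ | rfl | ⟨t, ht, rfl⟩ | ⟨t, u, ht, hu, rfl | rfl⟩ | ⟨k, i, l, hl, h, rfl⟩⟩ |
      ⟨rfl, rfl | ⟨t, u, ht, hu, rfl⟩ | ⟨k, i, l, hl, h, rfl⟩ | ⟨e, t, ht, h, rfl⟩ |
        ⟨A, B, hA, hB, rfl⟩ | ⟨v, A, hA, rfl⟩⟩ | ⟨rfl, rfl⟩ | ⟨k, t, l, rfl, ht, hl, rfl⟩)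
    · exact .base (.inl ⟨v, (e0 _).symm⟩)
    · exact .base (.inr (.inl (e0 _).symm))
    · exact .step ht ht (.inl ⟨t, (e0 _).symm, (e0 _).symm⟩)
    · exact .step ht hu (.inr (.inl ⟨t, u, (e0 _).symm, (e0 _).symm, .inl (e0 _).symm⟩))
    · exact .step ht hu (.inr (.inl ⟨t, u, (e0 _).symm, (e0 _).symm, .inr (.inl (e0 _).symm)⟩))
    · exact .step hl hl (.inr (.inr (.inr (.inl ⟨k, i, l, rfl, .inl ⟨h, (e0 _).symm⟩⟩))))
    · exact .base (.inr (.inr (.inl (e1 _).symm)))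
    · exact .step ht hu (.inr (.inl ⟨t, u, (e0 _).symm, (e0 _).symm, .inr (.inr (e1 _).symm)⟩))
    · exact .step hl hl (.inr (.inr (.inr (.inl ⟨k, i, l, rfl, .inr ⟨h, (e1 _).symm⟩⟩))))
    · exact .step ht ht (.inr (.inr (.inr (.inr (.inl ⟨e, t, (e0 _).symm, h, (e1 _).symm⟩)))))
    · exact .step hA hB (.inr (.inr (.inr (.inr (.inr (.inl
        ⟨A, B, (e1 _).symm, (e1 _).symm, (e1 _).symm⟩))))))
    · exact .step hA hA (.inr (.inr (.inr (.inr (.inr (.inr ⟨v, A, (e1 _).symm, (e1 _).symm⟩))))))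
    · exact .base (.inr (.inr (.inr (by rw [e2]; rfl))))
    · exact .step ht hl (.inr (.inr (.inl ⟨t, k, l, (e0 _).symm, rfl, rfl⟩)))

theorem wf_var {v : M.C} : Wf S D s (cVar v) ↔ s = 0 := by
  rw [wf_iff]; simp

theorem wf_zero : Wf S D s cZero ↔ s = 0 := by
  rw [wf_iff]; simp

theorem wf_succ {t : M.C} : Wf S D s (cSucc t) ↔ s = 0 ∧ Wf S D 0 t := by
  rw [wf_iff]; simp

theorem wf_add {t u : M.C} : Wf S D s (cAdd t u) ↔ s = 0 ∧ Wf S D 0 t ∧ Wf S D 0 u := by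
  rw [wf_iff]; simp [pr_inj]

theorem wf_mul {t u : M.C} : Wf S D s (cMul t u) ↔ s = 0 ∧ Wf S D 0 t ∧ Wf S D 0 u := by
  rw [wf_iff]; simp [pr_inj]

theorem wf_fn {f l : M.C} : Wf S D s (cFn f l) ↔
    s = 0 ∧ ∃ k i, f = pr k i ∧ Wf S D (k + 1 + 1) l ∧ S.funSym.rel M k i := by
  rw [wf_iff]
  simp [pr_inj]
  grind

theorem wf_bot : Wf S D s cBot ↔ s = 1 := by
  rw [wf_iff]; simp

theorem wf_eq {t u : M.C} : Wf S D s (cEq t u) ↔ s = 1 ∧ Wf S D 0 t ∧ Wf S D 0 u := by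
  rw [wf_iff]; simp [pr_inj]

theorem wf_rel {f l : M.C} : Wf S D s (cRel f l) ↔
    s = 1 ∧ ∃ k i, f = pr k i ∧ Wf S D (k + 1 + 1) l ∧ S.relSym.rel M k i := by
  rw [wf_iff]
  simp [pr_inj]
  grind

theorem wf_tr {e t : M.C} : Wf S D s (cTr e t) ↔ s = 1 ∧ D e ∧ Wf S D 0 t := by
  rw [wf_iff]; simp [pr_inj, and_comm]

theorem wf_imp {A B : M.C} : Wf S D s (cImp A B) ↔ s = 1 ∧ Wf S D 1 A ∧ Wf S D 1 B := by
  rw [wf_iff]; simp [pr_inj]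

theorem wf_all {v A : M.C} : Wf S D s (cAll v A) ↔ s = 1 ∧ Wf S D 1 A := by
  rw [wf_iff]; simp [pr_inj]

theorem wf_cons {t l : M.C} : Wf S D s (cCons t l) ↔
    ∃ k, s = k + 1 + 1 + 1 ∧ Wf S D 0 t ∧ Wf S D (k + 1 + 1) l := by
  rw [wf_iff]; simp [pr_inj]

theorem Wf.mono {D' : M.C → Prop} (hD : ∀ e, D e → D' e) {x : M.C} (h : Wf S D s x) :
    Wf S D' s x := by
  refine Gen.mono (fun _ h => h) (fun u w y h => ?_) h
  rcases h with h | h | h | h | ⟨e, t, h1, h2, h3⟩ | h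
  · exact .inl h
  · exact .inr (.inl h)
  · exact .inr (.inr (.inl h))
  · exact .inr (.inr (.inr (.inl h)))
  · exact .inr (.inr (.inr (.inr (.inl ⟨e, t, h1, hD e h2, h3⟩))))
  · exact .inr (.inr (.inr (.inr (.inr h))))

end

section

variable {ok : M.C → Prop} {v t x' : M.C}

theorem repl_iff {x : M.C} : Repl ok v t x x' ↔
    (x = cVar v ∧ x' = t) ∨ (∃ u, u ≠ v ∧ x = cVar u ∧ x' = cVar u) ∨
    (x = cZero ∧ x' = cZero) ∨ (x = cNil ∧ x' = cNil) ∨ (x = cBot ∧ x' = cBot) ∨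
    (∃ A, x = cAll v A ∧ x' = cAll v A) ∨
    ∃ c c', Repl ok v t c c' ∧ ((x = cSucc c ∧ x' = cSucc c') ∨
      (∃ e, (x = cFn e c ∧ x' = cFn e c') ∨ (x = cRel e c ∧ x' = cRel e c') ∨
        (x = cTr e c ∧ x' = cTr e c') ∨ (e ≠ v ∧ (ok e ∨ c = c') ∧ x = cAll e c ∧ x' = cAll e c')) ∨
      ∃ b b', Repl ok v t b b' ∧ ((x = cAdd c b ∧ x' = cAdd c' b') ∨
        (x = cMul c b ∧ x' = cMul c' b') ∨ (x = cCons c b ∧ x' = cCons c' b') ∨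
        (x = cEq c b ∧ x' = cEq c' b') ∨ (x = cImp c b ∧ x' = cImp c' b'))) := by
  constructor
  · intro h
    rcases Gen.cases h with h | ⟨u, w, hu, hw, c, c', rfl, h⟩
    · rcases h with h | ⟨u, hu, h⟩ | h | h | h | ⟨A, h⟩ <;> obtain ⟨rfl, rfl⟩ := pr_inj.1 h
      · exact .inl ⟨rfl, rfl⟩
      · exact .inr (.inl ⟨u, hu, rfl, rfl⟩)
      · exact .inr (.inr (.inl ⟨rfl, rfl⟩))
      · exact .inr (.inr (.inr (.inl ⟨rfl, rfl⟩)))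
      · exact .inr (.inr (.inr (.inr (.inl ⟨rfl, rfl⟩))))
      · exact .inr (.inr (.inr (.inr (.inr (.inl ⟨A, rfl, rfl⟩)))))
    · refine .inr (.inr (.inr (.inr (.inr (.inr ⟨c, c', hu, ?_⟩)))))
      simp only [pr_inj] at h
      refine h.imp_right (Or.imp_right ?_)
      rintro ⟨b, b', rfl, h'⟩
      exact ⟨b, b', hw, h'⟩
  · rintro (⟨rfl, rfl⟩ | ⟨u, hu, rfl, rfl⟩ | ⟨rfl, rfl⟩ | ⟨rfl, rfl⟩ | ⟨rfl, rfl⟩ | ⟨A, rfl, rfl⟩ |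
      ⟨c, c', hc, ⟨rfl, rfl⟩ | h | ⟨b, b', hb, h⟩⟩)
    · exact .base (.inl rfl)
    · exact .base (.inr (.inl ⟨u, hu, rfl⟩))
    · exact .base (.inr (.inr (.inl rfl)))
    · exact .base (.inr (.inr (.inr (.inl rfl))))
    · exact .base (.inr (.inr (.inr (.inr (.inl rfl)))))
    · exact .base (.inr (.inr (.inr (.inr (.inr ⟨A, rfl⟩)))))
    · exact .step hc hc ⟨c, c', rfl, .inl rfl⟩
    · refine .step hc hc ⟨c, c', rfl, .inr (.inl ?_)⟩
      simpa only [pr_inj] using h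
    · refine .step hc hb ⟨c, c', rfl, .inr (.inr ⟨b, b', rfl, ?_⟩)⟩
      simpa only [pr_inj] using h

theorem repl_var {u : M.C} :
    Repl ok v t (cVar u) x' ↔ (u = v ∧ x' = t) ∨ (u ≠ v ∧ x' = cVar u) := by
  rw [repl_iff]; simp

theorem repl_zero : Repl ok v t cZero x' ↔ x' = cZero := by
  rw [repl_iff]; simp

theorem repl_nil : Repl ok v t cNil x' ↔ x' = cNil := by
  rw [repl_iff]; simp

theorem repl_bot : Repl ok v t cBot x' ↔ x' = cBot := by
  rw [repl_iff]; simp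

theorem repl_succ {c : M.C} :
    Repl ok v t (cSucc c) x' ↔ ∃ c', Repl ok v t c c' ∧ x' = cSucc c' := by
  rw [repl_iff]; simp

theorem repl_fn {e c : M.C} :
    Repl ok v t (cFn e c) x' ↔ ∃ c', Repl ok v t c c' ∧ x' = cFn e c' := by
  rw [repl_iff]; simp [pr_inj]

theorem repl_rel {e c : M.C} :
    Repl ok v t (cRel e c) x' ↔ ∃ c', Repl ok v t c c' ∧ x' = cRel e c' := by
  rw [repl_iff]; simp [pr_inj]

theorem repl_tr {e c : M.C} :
    Repl ok v t (cTr e c) x' ↔ ∃ c', Repl ok v t c c' ∧ x' = cTr e c' := by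
  rw [repl_iff]; simp [pr_inj]

theorem repl_add {c b : M.C} : Repl ok v t (cAdd c b) x' ↔
    ∃ c' b', Repl ok v t c c' ∧ Repl ok v t b b' ∧ x' = cAdd c' b' := by
  rw [repl_iff]; simp [pr_inj]

theorem repl_mul {c b : M.C} : Repl ok v t (cMul c b) x' ↔
    ∃ c' b', Repl ok v t c c' ∧ Repl ok v t b b' ∧ x' = cMul c' b' := by
  rw [repl_iff]; simp [pr_inj]

theorem repl_cons {c b : M.C} : Repl ok v t (cCons c b) x' ↔
    ∃ c' b', Repl ok v t c c' ∧ Repl ok v t b b' ∧ x' = cCons c' b' := by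
  rw [repl_iff]; simp [pr_inj]

theorem repl_eq {c b : M.C} : Repl ok v t (cEq c b) x' ↔
    ∃ c' b', Repl ok v t c c' ∧ Repl ok v t b b' ∧ x' = cEq c' b' := by
  rw [repl_iff]; simp [pr_inj]

theorem repl_imp {c b : M.C} : Repl ok v t (cImp c b) x' ↔
    ∃ c' b', Repl ok v t c c' ∧ Repl ok v t b b' ∧ x' = cImp c' b' := by
  rw [repl_iff]; simp [pr_inj]

theorem repl_all {e c : M.C} : Repl ok v t (cAll e c) x' ↔ (e = v ∧ x' = cAll e c) ∨
    (e ≠ v ∧ ∃ c', Repl ok v t c c' ∧ (ok e ∨ c = c') ∧ x' = cAll e c') := by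
  rw [repl_iff]; simp [pr_inj]; grind

end
end InternalSyntax

/-! ### Properties of the internal syntax -/

section InternalProperties

set_option synthInstance.maxHeartbeats 400000
set_option synthInstance.maxSize 1000

variable {M : Str} [PAModel M]

open PAModel

theorem Repl.mono {ok ok' : M.C → Prop} {v t x x' : M.C} (hok : ∀ z, ok z → ok' z)
    (h : Repl ok v t x x') : Repl ok' v t x x' := by
  refine Gen.mono (fun _ h => h) (fun u w y h => ?_) h
  obtain ⟨c, c', rfl, h | ⟨e, h | h | h | ⟨h1, h2, h3⟩⟩ | h⟩ := h
  · exact ⟨c, c', rfl, .inl h⟩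
  · exact ⟨c, c', rfl, .inr (.inl ⟨e, .inl h⟩)⟩
  · exact ⟨c, c', rfl, .inr (.inl ⟨e, .inr (.inl h)⟩)⟩
  · exact ⟨c, c', rfl, .inr (.inl ⟨e, .inr (.inr (.inl h))⟩)⟩
  · exact ⟨c, c', rfl, .inr (.inl ⟨e, .inr (.inr (.inr ⟨h1, h2.imp_left (hok e), h3⟩))⟩)⟩
  · exact ⟨c, c', rfl, .inr (.inr h)⟩

theorem Repl.unique {ok ok' : M.C → Prop} {v t x a b : M.C} (ha : Repl ok v t x a)
    (hb : Repl ok' v t x b) : a = b := by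
  have hb := hb.mono (ok' := fun _ => True) fun _ _ => trivial
  have key : ∀ c c' c'', pr x a = pr c c' → Repl (fun _ => True) v t c c'' → c' = c'' := by
    refine Gen.induct (L := Lang.arith) (Q := fun z => ∀ c c' c'', z = pr c c' →
      Repl (fun _ => True) v t c c'' → c' = c'') (by infer_instance) ?_ ?_ ha
    · rintro y hy c c' c'' rfl hc
      rcases hy with h | ⟨u, hu, h⟩ | h | h | h | ⟨A, h⟩ <;> obtain ⟨rfl, rfl⟩ := pr_inj.1 h
      · simpa [repl_var, eq_comm] using hc
      · simpa [repl_var, hu, eq_comm] using hc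
      · exact (repl_zero.1 hc).symm
      · exact (repl_nil.1 hc).symm
      · exact (repl_bot.1 hc).symm
      · simpa [repl_all, eq_comm] using hc
    · rintro u w y - hu - hw ⟨c, c', rfl, h⟩ x x' x'' rfl hx
      simp only [pr_inj] at h
      rcases h with ⟨rfl, rfl⟩ | ⟨e, ⟨rfl, rfl⟩ | ⟨rfl, rfl⟩ | ⟨rfl, rfl⟩ | ⟨he, -, rfl, rfl⟩⟩ |
        ⟨b, b', rfl, ⟨rfl, rfl⟩ | ⟨rfl, rfl⟩ | ⟨rfl, rfl⟩ | ⟨rfl, rfl⟩ | ⟨rfl, rfl⟩⟩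
      · obtain ⟨d, hd, rfl⟩ := repl_succ.1 hx
        rw [hu _ _ _ rfl hd]
      · obtain ⟨d, hd, rfl⟩ := repl_fn.1 hx
        rw [hu _ _ _ rfl hd]
      · obtain ⟨d, hd, rfl⟩ := repl_rel.1 hx
        rw [hu _ _ _ rfl hd]
      · obtain ⟨d, hd, rfl⟩ := repl_tr.1 hx
        rw [hu _ _ _ rfl hd]
      · obtain ⟨h, -⟩ | ⟨-, d, hd, -, rfl⟩ := repl_all.1 hx
        · exact (he h).elim
        · rw [hu _ _ _ rfl hd]
      · obtain ⟨d, f, hd, hf, rfl⟩ := repl_add.1 hx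
        rw [hu _ _ _ rfl hd, hw _ _ _ rfl hf]
      · obtain ⟨d, f, hd, hf, rfl⟩ := repl_mul.1 hx
        rw [hu _ _ _ rfl hd, hw _ _ _ rfl hf]
      · obtain ⟨d, f, hd, hf, rfl⟩ := repl_cons.1 hx
        rw [hu _ _ _ rfl hd, hw _ _ _ rfl hf]
      · obtain ⟨d, f, hd, hf, rfl⟩ := repl_eq.1 hx
        rw [hu _ _ _ rfl hd, hw _ _ _ rfl hf]
      · obtain ⟨d, f, hd, hf, rfl⟩ := repl_imp.1 hx
        rw [hu _ _ _ rfl hd, hw _ _ _ rfl hf]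
  exact key x a b rfl hb

/-- Substitution of a term leads from expressions to expressions. -/
theorem Repl.wf {S : Thy} {D : M.C → Prop} [ArithDef D]
    {ok : M.C → Prop} {v t s x x' : M.C} (h : Repl ok v t x x') (hx : Wf S D s x)
    (ht : Wf S D 0 t) : Wf S D s x' := by
  have key : ∀ c c' s, pr x x' = pr c c' → Wf S D s c → Wf S D s c' := by
    refine Gen.induct (L := Lang.arith) (Q := fun z => ∀ c c' s, z = pr c c' → Wf S D s c → Wf S D s c')
      (by infer_instance)
      ?_ ?_ h
    · rintro y hy c c' s rfl hc
      rcases hy with h | ⟨u, hu, h⟩ | h | h | h | ⟨A, h⟩ <;> obtain ⟨rfl, rfl⟩ := pr_inj.1 h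
      · rw [wf_var] at hc
        rwa [hc]
      all_goals exact hc
    · rintro u w y - hu - hw ⟨c, c', rfl, h⟩ x x' s rfl hx
      simp only [pr_inj] at h
      rcases h with ⟨rfl, rfl⟩ | ⟨e, ⟨rfl, rfl⟩ | ⟨rfl, rfl⟩ | ⟨rfl, rfl⟩ | ⟨-, -, rfl, rfl⟩⟩ | ⟨b, b', rfl, ⟨rfl, rfl⟩ | ⟨rfl, rfl⟩ | ⟨rfl, rfl⟩ | ⟨rfl, rfl⟩ | ⟨rfl, rfl⟩⟩
      · rw [wf_succ] at hx ⊢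
        exact ⟨hx.1, hu _ _ _ rfl hx.2⟩
      · rw [wf_fn] at hx ⊢
        obtain ⟨h1, k, i, h2, h3, h4⟩ := hx
        exact ⟨h1, k, i, h2, hu _ _ _ rfl h3, h4⟩
      · rw [wf_rel] at hx ⊢
        obtain ⟨h1, k, i, h2, h3, h4⟩ := hx
        exact ⟨h1, k, i, h2, hu _ _ _ rfl h3, h4⟩
      · rw [wf_tr] at hx ⊢
        exact ⟨hx.1, hx.2.1, hu _ _ _ rfl hx.2.2⟩
      · rw [wf_all] at hx ⊢
        exact ⟨hx.1, hu _ _ _ rfl hx.2⟩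
      · rw [wf_add] at hx ⊢
        exact ⟨hx.1, hu _ _ _ rfl hx.2.1, hw _ _ _ rfl hx.2.2⟩
      · rw [wf_mul] at hx ⊢
        exact ⟨hx.1, hu _ _ _ rfl hx.2.1, hw _ _ _ rfl hx.2.2⟩
      · rw [wf_cons] at hx ⊢
        obtain ⟨k, h1, h2, h3⟩ := hx
        exact ⟨k, h1, hu _ _ _ rfl h2, hw _ _ _ rfl h3⟩
      · rw [wf_eq] at hx ⊢
        exact ⟨hx.1, hu _ _ _ rfl hx.2.1, hw _ _ _ rfl hx.2.2⟩
      · rw [wf_imp] at hx ⊢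
        exact ⟨hx.1, hu _ _ _ rfl hx.2.1, hw _ _ _ rfl hx.2.2⟩
  exact key x x' s rfl hx

section NotFree

variable {v : M.C}

theorem notFree_var {u : M.C} : NotFree v (cVar u) ↔ u ≠ v := by
  rw [NotFree, repl_var]; simp

theorem notFree_zero : NotFree v cZero := by
  rw [NotFree, repl_zero]

theorem notFree_nil : NotFree v cNil := by
  rw [NotFree, repl_nil]

theorem notFree_bot : NotFree v cBot := by
  rw [NotFree, repl_bot]

theorem notFree_succ {t : M.C} : NotFree v (cSucc t) ↔ NotFree v t := by
  rw [NotFree, repl_succ]; simp [NotFree]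

theorem notFree_fn {e t : M.C} : NotFree v (cFn e t) ↔ NotFree v t := by
  rw [NotFree, repl_fn]; simp [NotFree, pr_inj]

theorem notFree_rel {e t : M.C} : NotFree v (cRel e t) ↔ NotFree v t := by
  rw [NotFree, repl_rel]; simp [NotFree, pr_inj]

theorem notFree_tr {e t : M.C} : NotFree v (cTr e t) ↔ NotFree v t := by
  rw [NotFree, repl_tr]; simp [NotFree, pr_inj]

theorem notFree_add {t u : M.C} : NotFree v (cAdd t u) ↔ NotFree v t ∧ NotFree v u := by
  rw [NotFree, repl_add]; simp [NotFree, pr_inj]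

theorem notFree_mul {t u : M.C} : NotFree v (cMul t u) ↔ NotFree v t ∧ NotFree v u := by
  rw [NotFree, repl_mul]; simp [NotFree, pr_inj]

theorem notFree_cons {t u : M.C} : NotFree v (cCons t u) ↔ NotFree v t ∧ NotFree v u := by
  rw [NotFree, repl_cons]; simp [NotFree, pr_inj]

theorem notFree_eq {t u : M.C} : NotFree v (cEq t u) ↔ NotFree v t ∧ NotFree v u := by
  rw [NotFree, repl_eq]; simp [NotFree, pr_inj]

theorem notFree_imp {t u : M.C} : NotFree v (cImp t u) ↔ NotFree v t ∧ NotFree v u := by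
  rw [NotFree, repl_imp]; simp [NotFree, pr_inj]

theorem notFree_all {e t : M.C} : NotFree v (cAll e t) ↔ e = v ∨ NotFree v t := by
  rw [NotFree, repl_all]; simp [NotFree, pr_inj]; tauto

end NotFree

/-- A substitution for a variable that is not free changes nothing. -/
theorem NotFree.repl {ok : M.C → Prop} {v t x : M.C} (h : NotFree v x) : Repl ok v t x x := by
  have key : ∀ c, pr x x = pr c c → Repl (fun _ => False) v t c c := by
    refine Gen.induct (L := Lang.arith)
      (Q := fun z => ∀ c, z = pr c c → Repl (fun _ => False) v t c c) (by infer_instance) ?_ ?_ h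
    · rintro y hy c rfl
      rcases hy with h | ⟨u, hu, h⟩ | h | h | h | ⟨A, h⟩ <;> obtain ⟨h, h'⟩ := pr_inj.1 h
      · simp [h] at h'
      · exact h ▸ repl_var.2 (.inr ⟨hu, rfl⟩)
      · exact h ▸ repl_zero.2 rfl
      · exact h ▸ repl_nil.2 rfl
      · exact h ▸ repl_bot.2 rfl
      · exact h ▸ repl_all.2 (.inl ⟨rfl, rfl⟩)
    · rintro u w y - hu - hw ⟨c, c', rfl, h⟩ x rfl
      simp only [pr_inj] at h
      rcases h with ⟨rfl, h⟩ | ⟨e, ⟨rfl, h⟩ | ⟨rfl, h⟩ | ⟨rfl, h⟩ | ⟨he, -, rfl, h⟩⟩ |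
        ⟨b, b', rfl, ⟨rfl, h⟩ | ⟨rfl, h⟩ | ⟨rfl, h⟩ | ⟨rfl, h⟩ | ⟨rfl, h⟩⟩ <;>
      simp only [tag_inj, pr_inj, true_and] at h
      · exact repl_succ.2 ⟨_, hu c (h ▸ rfl), rfl⟩
      · exact repl_fn.2 ⟨_, hu c (h ▸ rfl), rfl⟩
      · exact repl_rel.2 ⟨_, hu c (h ▸ rfl), rfl⟩
      · exact repl_tr.2 ⟨_, hu c (h ▸ rfl), rfl⟩
      · exact repl_all.2 (.inr ⟨he, _, hu c (h ▸ rfl), .inr rfl, rfl⟩)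
      · exact repl_add.2 ⟨_, _, hu c (h.1 ▸ rfl), hw b (h.2 ▸ rfl), rfl⟩
      · exact repl_mul.2 ⟨_, _, hu c (h.1 ▸ rfl), hw b (h.2 ▸ rfl), rfl⟩
      · exact repl_cons.2 ⟨_, _, hu c (h.1 ▸ rfl), hw b (h.2 ▸ rfl), rfl⟩
      · exact repl_eq.2 ⟨_, _, hu c (h.1 ▸ rfl), hw b (h.2 ▸ rfl), rfl⟩
      · exact repl_imp.2 ⟨_, _, hu c (h.1 ▸ rfl), hw b (h.2 ▸ rfl), rfl⟩
  exact (key x rfl).mono fun _ h => h.elim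

/-- Only boundedly many variables occur free in an expression. -/
theorem Wf.exists_bound {S : Thy} {D : M.C → Prop} {s x : M.C} (h : Wf S D s x) :
    ∃ k, ∀ v ≥ k, NotFree v x := by
  have key : ∀ c c', pr s x = pr c c' → ∃ k, ∀ v ≥ k, NotFree v c' := by
    refine Gen.induct (L := Lang.arith)
      (Q := fun z => ∀ c c', z = pr c c' → ∃ k, ∀ v ≥ k, NotFree v c') inferInstance ?_ ?_ h
    · rintro y (⟨v, h⟩ | h | h | h) c c' rfl <;> rw [pr_eq_tag] at h <;> obtain ⟨-, rfl⟩ := h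
      · exact ⟨v + 1, fun u hu => notFree_var.2 fun e => absurd hu (not_le.2 (e ▸ lt_succ.2 le_rfl))⟩
      · exact ⟨0, fun u _ => notFree_zero⟩
      · exact ⟨0, fun u _ => notFree_bot⟩
      · exact ⟨0, fun u _ => notFree_nil⟩
    · rintro u w y - hu - hw h x x' rfl
      rcases h with ⟨t, rfl, h⟩ | ⟨t, t', rfl, rfl, h | h | h⟩ | ⟨t, k, l, rfl, rfl, h⟩ |
        ⟨k, i, l, rfl, ⟨h', h⟩ | ⟨h', h⟩⟩ | ⟨e, t, rfl, h', h⟩ | ⟨A, B, rfl, rfl, h⟩ | ⟨v, A, rfl, h⟩ <;>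
      simp only [pr_eq_tag, pr_inj] at h <;> obtain ⟨-, rfl⟩ := h <;>
      obtain ⟨k₁, h₁⟩ := hu _ _ rfl
      · exact ⟨k₁, fun v hv => notFree_succ.2 (h₁ v hv)⟩
      · obtain ⟨k₂, h₂⟩ := hw _ _ rfl
        exact ⟨max k₁ k₂, fun v hv => notFree_add.2 ⟨h₁ v ((le_max_left _ _).trans hv), h₂ v ((le_max_right _ _).trans hv)⟩⟩
      · obtain ⟨k₂, h₂⟩ := hw _ _ rfl
        exact ⟨max k₁ k₂, fun v hv => notFree_mul.2 ⟨h₁ v ((le_max_left _ _).trans hv), h₂ v ((le_max_right _ _).trans hv)⟩⟩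
      · obtain ⟨k₂, h₂⟩ := hw _ _ rfl
        exact ⟨max k₁ k₂, fun v hv => notFree_eq.2 ⟨h₁ v ((le_max_left _ _).trans hv), h₂ v ((le_max_right _ _).trans hv)⟩⟩
      · obtain ⟨k₂, h₂⟩ := hw _ _ rfl
        exact ⟨max k₁ k₂, fun v hv => notFree_cons.2 ⟨h₁ v ((le_max_left _ _).trans hv), h₂ v ((le_max_right _ _).trans hv)⟩⟩
      · exact ⟨k₁, fun v hv => notFree_fn.2 (h₁ v hv)⟩
      · exact ⟨k₁, fun v hv => notFree_rel.2 (h₁ v hv)⟩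
      · exact ⟨k₁, fun v hv => notFree_tr.2 (h₁ v hv)⟩
      · obtain ⟨k₂, h₂⟩ := hw _ _ rfl
        exact ⟨max k₁ k₂, fun v hv => notFree_imp.2 ⟨h₁ v ((le_max_left _ _).trans hv), h₂ v ((le_max_right _ _).trans hv)⟩⟩
      · exact ⟨k₁, fun v hv => notFree_all.2 (.inr (h₁ v hv))⟩
  exact key s x rfl

/-- Every formula has a universal closure. -/
theorem Wf.exists_clos {S : Thy} {D : M.C → Prop} {s x : M.C} (h : Wf S D s x) :
    ∃ B, Clos x B := by
  obtain ⟨k, hk⟩ := h.exists_bound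
  obtain ⟨B, h1, h2, h3⟩ := ind₀ (P := fun j => ∃ B, Pre x B ∧ (∀ v < j, NotFree v B) ∧
    ∀ v ≥ k, NotFree v B) inferInstance ⟨x, .base rfl, fun v hv => (not_lt.2 zero_le hv).elim, hk⟩ (by
      rintro j ⟨B, h1, h2, h3⟩
      by_cases hj : NotFree j B
      · refine ⟨B, h1, fun v hv => ?_, h3⟩
        rcases (lt_succ.1 hv).lt_or_eq with h | rfl
        · exact h2 v h
        · exact hj
      · refine ⟨cAll j B, .step h1 h1 ⟨j, hj, rfl⟩, fun v hv => ?_,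
          fun v hv => notFree_all.2 (.inr (h3 v hv))⟩
        rcases (lt_succ.1 hv).lt_or_eq with h | rfl
        · exact notFree_all.2 (.inr (h2 v h))
        · exact notFree_all.2 (.inl rfl)) k
  exact ⟨B, h1, fun v => (lt_or_ge v k).elim (h2 v) (h3 v)⟩

theorem Pre.wf {S : Thy} {D : M.C → Prop} [ArithDef D] {A B : M.C}
    (h : Pre A B) (hA : Wf S D 1 A) : Wf S D 1 B := by
  refine Gen.induct (L := Lang.arith) (Q := fun z => Wf S D 1 z) inferInstance ?_ ?_ h
  · rintro y rfl
    exact hA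
  · rintro u w y - hu - - ⟨v, -, rfl⟩
    exact wf_all.2 ⟨rfl, hu⟩

/-! ### Internal numerals -/

theorem isNum_iff {n m : M.C} :
    IsNum n m ↔ (n = 0 ∧ m = cZero) ∨ ∃ k c, IsNum k c ∧ n = k + 1 ∧ m = cSucc c := by
  constructor
  · intro h
    rcases Gen.cases h with h | ⟨u, w, hu, hw, k, c, rfl, h⟩
    · exact .inl (pr_inj.1 h)
    · exact .inr ⟨k, c, hu, pr_inj.1 h⟩
  · rintro (⟨rfl, rfl⟩ | ⟨k, c, h, rfl, rfl⟩)
    · exact .base rfl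
    · exact .step h h ⟨k, c, rfl, rfl⟩

theorem existsUnique_isNum (n : M.C) : ∃! m, IsNum n m := by
  have h1 : ∃ m, IsNum n m := ind₀ (P := fun n : M.C => ∃ m, IsNum n m) inferInstance
    ⟨cZero, isNum_iff.2 (.inl ⟨rfl, rfl⟩)⟩
    (fun n ⟨m, h⟩ => ⟨cSucc m, isNum_iff.2 (.inr ⟨n, m, h, rfl, rfl⟩)⟩) n
  obtain ⟨m, hm⟩ := h1
  refine ⟨m, hm, fun m' hm' => ?_⟩
  refine ind₀ (P := fun n => ∀ m m', IsNum n m → IsNum n m' → m' = m) inferInstance ?_ ?_ n m m' hm hm'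
  · intro m m' h h'
    rw [isNum_iff] at h h'
    rcases h with ⟨-, rfl⟩ | ⟨k, c, -, h, -⟩
    · rcases h' with ⟨-, rfl⟩ | ⟨k, c, -, h, -⟩
      · rfl
      · exact (succ_ne _ h.symm).elim
    · exact (succ_ne _ h.symm).elim
  · intro n ih m m' h h'
    rw [isNum_iff] at h h'
    obtain ⟨h, -⟩ | ⟨k, c, h1, h2, rfl⟩ := h
    · exact (succ_ne _ h).elim
    obtain ⟨h, -⟩ | ⟨k', c', h1', h2', rfl⟩ := h'
    · exact (succ_ne _ h).elim
    obtain rfl := succ_inj' h2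
    obtain rfl := succ_inj' h2'
    rw [ih c c' h1 h1']

/-- The code of the numeral for an element of the model. -/
noncomputable def cNum (n : M.C) : M.C := (existsUnique_isNum n).choose

theorem isNum_iff_eq {n m : M.C} : IsNum n m ↔ m = cNum n :=
  ⟨fun h => (existsUnique_isNum n).choose_spec.2 m h,
    fun h => h ▸ (existsUnique_isNum n).choose_spec.1⟩

theorem isNum_cNum (n : M.C) : IsNum n (cNum n) := isNum_iff_eq.2 rfl

theorem cNum_zero : cNum (0 : M.C) = cZero :=
  (isNum_iff_eq.1 (isNum_iff.2 (.inl ⟨rfl, rfl⟩))).symm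

theorem cNum_succ (n : M.C) : cNum (n + 1) = cSucc (cNum n) :=
  (isNum_iff_eq.1 (isNum_iff.2 (.inr ⟨n, _, isNum_cNum n, rfl, rfl⟩))).symm

instance {L : Lang} (f : (ℕ → M.C) → M.C) [hf : DefF L M f] : DefF L M fun r => cNum (f r) :=
  DefF.comp1 (F := cNum) ((inferInstance : DefP L M fun r : ℕ → M.C => IsNum (r 1) (r 0)).congr
    fun _ => isNum_iff_eq) hf

/-- Codes of closed terms without function symbols other than the arithmetical ones. -/
structure IsClosedTm (S : Thy) (t : M.C) : Prop where
  wf : Wf S (fun _ => False) 0 t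
  notFree : ∀ u, NotFree u t

theorem isClosedTm_cNum (S : Thy) (n : M.C) : IsClosedTm S (cNum n) := by
  constructor
  · refine ind₀ (P := fun n : M.C => Wf S (fun _ => False) 0 (cNum n)) inferInstance ?_ (fun n h => ?_) n
    · rw [cNum_zero]; exact wf_zero.2 rfl
    · rw [cNum_succ]; exact wf_succ.2 ⟨rfl, h⟩
  · refine ind₀ (P := fun n : M.C => ∀ u, NotFree u (cNum n)) inferInstance ?_ (fun n h u => ?_) n
    · rw [cNum_zero]; exact fun u => notFree_zero
    · rw [cNum_succ]; exact notFree_succ.2 (h u)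

end InternalProperties

/-! ### Internal codes of arithmetical formulas with parameters -/

section ParametrizedCodes

variable {M : Str} [PAModel M]

/-- The code of the term, certain variables `v` being replaced by the term with the code `σ v`. -/
noncomputable def cdT (σ : ℕ → Option M.C) : Tm → M.C
  | .var v => (σ v).getD (cVar (v : M.C))
  | .zero => cZero
  | .succ t => cSucc (cdT σ t)
  | .add t u => cAdd (cdT σ t) (cdT σ u)
  | .mul t u => cMul (cdT σ t) (cdT σ u)
  | .fn k i ts => ((Tm.fn k i ts).code : ℕ)

/-- The code of the arithmetical formula, free occurrences of certain variables `v` being replaced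
by the term with the code `σ v`.  (The value is irrelevant for formulas that are not
arithmetical.) -/
noncomputable def cdF (σ : ℕ → Option M.C) : Fm → M.C
  | .bot => cBot
  | .eq t u => cEq (cdT σ t) (cdT σ u)
  | .rel k i ts => ((Fm.rel k i ts).code : ℕ)
  | .tr a t => ((Fm.tr a t).code : ℕ)
  | .imp A B => cImp (cdF σ A) (cdF σ B)
  | .all v A => cAll (v : M.C) (cdF (Function.update σ v none) A)

theorem cdT_none (t : Tm) : cdT (fun _ => none : ℕ → Option M.C) t = (t.code : ℕ) := by
  induction t with
  | var v => simp [cdT, Tm.code, natCast_pair, tag]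
  | zero => simp [cdT, Tm.code, natCast_pair, tag]
  | succ t ih => simp [cdT, Tm.code, natCast_pair, tag, ih]
  | add t u iht ihu => simp [cdT, Tm.code, natCast_pair, tag, iht, ihu]
  | mul t u iht ihu => simp [cdT, Tm.code, natCast_pair, tag, iht, ihu]
  | fn k i ts ih => rfl

theorem cdF_none (A : Fm) : cdF (fun _ => none : ℕ → Option M.C) A = (A.code : ℕ) := by
  induction A with
  | bot => simp [cdF, Fm.code, natCast_pair, tag]
  | eq t u => simp [cdF, Fm.code, natCast_pair, tag, cdT_none]
  | rel k i ts => rfl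
  | tr a t => rfl
  | imp A B ihA ihB => simp [cdF, Fm.code, natCast_pair, tag, ihA, ihB]
  | all v A ih =>
    simp [cdF, Fm.code, natCast_pair, tag, ih]

/-- The values are codes of closed terms. -/
def ClosedAsg (S : Thy) (σ : ℕ → Option M.C) : Prop := ∀ v t, σ v = some t → IsClosedTm S t

theorem closedAsg_none (S : Thy) : ClosedAsg S (fun _ => none : ℕ → Option M.C) := by
  intro v t h
  cases h

variable {S : Thy} {σ : ℕ → Option M.C}

theorem ClosedAsg.update (hσ : ClosedAsg S σ) (v : ℕ) {o : Option M.C}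
    (ho : ∀ t, o = some t → IsClosedTm S t) : ClosedAsg S (Function.update σ v o) := by
  intro w t h
  by_cases hw : w = v
  · subst hw; rw [Function.update_self] at h; exact ho t h
  · rw [Function.update_of_ne hw] at h; exact hσ w t h

theorem ClosedAsg.update_none (hσ : ClosedAsg S σ) (v : ℕ) :
    ClosedAsg S (Function.update σ v none) := hσ.update v (fun t h => by cases h)

theorem ClosedAsg.update_some (hσ : ClosedAsg S σ) (v : ℕ) {t : M.C} (ht : IsClosedTm S t) :
    ClosedAsg S (Function.update σ v (some t)) := hσ.update v (fun u h => by cases h; exact ht)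

theorem cdT_congr {τ : ℕ → Option M.C} {t : Tm} (h : ∀ v, t.Occ v → σ v = τ v) :
    cdT σ t = cdT τ t := by
  induction t with
  | var v => simp only [cdT]; rw [h v rfl]
  | zero => rfl
  | succ t ih => simp only [cdT]; rw [ih h]
  | add t u iht ihu =>
    simp only [cdT]; rw [iht fun v hv => h v (.inl hv), ihu fun v hv => h v (.inr hv)]
  | mul t u iht ihu =>
    simp only [cdT]; rw [iht fun v hv => h v (.inl hv), ihu fun v hv => h v (.inr hv)]
  | fn k i ts ih => rfl

theorem cdF_congr {τ : ℕ → Option M.C} {A : Fm} (h : ∀ v, A.Free v → σ v = τ v) :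
    cdF σ A = cdF τ A := by
  induction A generalizing σ τ with
  | bot => rfl
  | eq t u =>
    simp only [cdF]
    rw [cdT_congr fun v hv => h v (.inl hv), cdT_congr fun v hv => h v (.inr hv)]
  | rel k i ts => rfl
  | tr a t => rfl
  | imp A B ihA ihB =>
    simp only [cdF]; rw [ihA fun v hv => h v (.inl hv), ihB fun v hv => h v (.inr hv)]
  | all v A ih =>
    simp only [cdF]
    rw [ih fun w hw => ?_]
    by_cases hwv : w = v
    · subst hwv; simp
    · rw [Function.update_of_ne hwv, Function.update_of_ne hwv]
      exact h w ⟨fun e => hwv e.symm, hw⟩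

theorem wf_cdT (hσ : ClosedAsg S σ) {t : Tm} (ht : t.In Lang.arith) (D : M.C → Prop) :
    Wf S D 0 (cdT σ t) := by
  induction t with
  | var v =>
    cases h : σ v with
    | none => simp only [cdT, h, Option.getD_none]; exact wf_var.2 rfl
    | some t =>
      simp only [cdT, h, Option.getD_some]
      exact (hσ v t h).wf.mono fun _ h => h.elim
  | zero => exact wf_zero.2 rfl
  | succ t ih => exact wf_succ.2 ⟨rfl, ih ht⟩
  | add t u iht ihu => exact wf_add.2 ⟨rfl, iht ht.1, ihu ht.2⟩
  | mul t u iht ihu => exact wf_mul.2 ⟨rfl, iht ht.1, ihu ht.2⟩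
  | fn k i ts ih => exact ht.1.elim

theorem wf_cdF (hσ : ClosedAsg S σ) {A : Fm} (hA : A.In Lang.arith) (D : M.C → Prop) :
    Wf S D 1 (cdF σ A) := by
  induction A generalizing σ with
  | bot => exact wf_bot.2 rfl
  | eq t u => exact wf_eq.2 ⟨rfl, wf_cdT hσ hA.1 D, wf_cdT hσ hA.2 D⟩
  | rel k i ts => exact hA.1.elim
  | tr a t => exact hA.1.elim
  | imp A B ihA ihB => exact wf_imp.2 ⟨rfl, ihA hσ hA.1, ihB hσ hA.2⟩
  | all v A ih => exact wf_all.2 ⟨rfl, ih (hσ.update_none v) hA⟩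

theorem notFree_cdT (hσ : ClosedAsg S σ) {t : Tm} (ht : t.In Lang.arith) (u : M.C) :
    NotFree u (cdT σ t) ↔ ∀ v, t.Occ v → σ v = none → (v : M.C) ≠ u := by
  induction t with
  | var v =>
    cases h : σ v with
    | none => simp [cdT, h, notFree_var, Tm.Occ]
    | some t =>
      simp [cdT, h, (hσ v t h).notFree, Tm.Occ]
  | zero => exact iff_of_true notFree_zero fun v h => h.elim
  | succ t ih => exact notFree_succ.trans (ih ht)
  | add t u iht ihu =>
    simp only [cdT]
    rw [notFree_add, iht ht.1, ihu ht.2]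
    exact ⟨fun h v hv => hv.elim (h.1 v) (h.2 v), fun h =>
      ⟨fun v hv => h v (.inl hv), fun v hv => h v (.inr hv)⟩⟩
  | mul t u iht ihu =>
    simp only [cdT]
    rw [notFree_mul, iht ht.1, ihu ht.2]
    exact ⟨fun h v hv => hv.elim (h.1 v) (h.2 v), fun h =>
      ⟨fun v hv => h v (.inl hv), fun v hv => h v (.inr hv)⟩⟩
  | fn k i ts ih => exact ht.1.elim

theorem notFree_cdF (hσ : ClosedAsg S σ) {A : Fm} (hA : A.In Lang.arith) (u : M.C) :
    NotFree u (cdF σ A) ↔ ∀ v, A.Free v → σ v = none → (v : M.C) ≠ u := by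
  induction A generalizing σ with
  | bot => exact iff_of_true notFree_bot fun v h => h.elim
  | eq t t' =>
    simp only [cdF]
    rw [notFree_eq, notFree_cdT hσ hA.1, notFree_cdT hσ hA.2]
    exact ⟨fun h v hv => hv.elim (h.1 v) (h.2 v), fun h =>
      ⟨fun v hv => h v (.inl hv), fun v hv => h v (.inr hv)⟩⟩
  | rel k i ts => exact hA.1.elim
  | tr a t => exact hA.1.elim
  | imp A B ihA ihB =>
    simp only [cdF]
    rw [notFree_imp, ihA hσ hA.1, ihB hσ hA.2]
    exact ⟨fun h v hv => hv.elim (h.1 v) (h.2 v), fun h =>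
      ⟨fun v hv => h v (.inl hv), fun v hv => h v (.inr hv)⟩⟩
  | all w A ih =>
    simp only [cdF]
    rw [notFree_all, ih (hσ.update_none w) hA]
    constructor
    · rintro (rfl | h) v ⟨h1, h2⟩ h3
      · exact fun e => h1 (Nat.cast_injective e).symm
      · exact h v h2 (by rwa [Function.update_of_ne (Ne.symm h1)])
    · intro h
      by_cases hw : (w : M.C) = u
      · exact .inl hw
      · refine .inr fun v h1 h2 => ?_
        by_cases hv : v = w
        · subst hv; exact hw
        · exact h v ⟨fun e => hv e.symm, h1⟩ (by rwa [Function.update_of_ne hv] at h2)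

theorem repl_cdT {ok : M.C → Prop} {t : Tm} (ht : t.In Lang.arith) {v : ℕ} {s : M.C}
    (hσ : ClosedAsg S σ) (hv : σ v = none) :
    Repl ok v s (cdT σ t) (cdT (Function.update σ v (some s)) t) := by
  induction t with
  | var w =>
    by_cases hw : w = v
    · subst hw
      simp only [cdT, hv, Function.update_self, Option.getD_none, Option.getD_some]
      exact repl_var.2 (.inl ⟨rfl, rfl⟩)
    · simp only [cdT, Function.update_of_ne hw]
      cases h : σ w with
      | none =>
        exact repl_var.2 (.inr ⟨fun e => hw (Nat.cast_injective e), rfl⟩)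
      | some t => exact ((hσ w t h).notFree _).repl
  | zero => exact repl_zero.2 rfl
  | succ t ih => exact repl_succ.2 ⟨_, ih ht, rfl⟩
  | add t u iht ihu => exact repl_add.2 ⟨_, _, iht ht.1, ihu ht.2, rfl⟩
  | mul t u iht ihu => exact repl_mul.2 ⟨_, _, iht ht.1, ihu ht.2, rfl⟩
  | fn k i ts ih => exact ht.1.elim

theorem repl_cdF {ok : M.C → Prop} (hok : ∀ z, ok z) {A : Fm} (hA : A.In Lang.arith) {v : ℕ}
    {s : M.C} (hσ : ClosedAsg S σ) (hv : σ v = none) :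
    Repl ok v s (cdF σ A) (cdF (Function.update σ v (some s)) A) := by
  induction A generalizing σ with
  | bot => exact repl_bot.2 rfl
  | eq t u => exact repl_eq.2 ⟨_, _, repl_cdT hA.1 hσ hv, repl_cdT hA.2 hσ hv, rfl⟩
  | rel k i ts => exact hA.1.elim
  | tr a t => exact hA.1.elim
  | imp A B ihA ihB => exact repl_imp.2 ⟨_, _, ihA hA.1 hσ hv, ihB hA.2 hσ hv, rfl⟩
  | all w A ih =>
    by_cases hw : w = v
    · subst hw
      refine repl_all.2 (.inl ⟨rfl, ?_⟩)
      simp [cdF]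
    · refine repl_all.2 (.inr ⟨fun e => hw (Nat.cast_injective e), _, ih hA (hσ.update_none w)
        (by rwa [Function.update_of_ne (Ne.symm hw)]), .inl (hok _), ?_⟩)
      simp only [cdF]
      rw [Function.update_comm hw]

end ParametrizedCodes

/-! ### The meaning of the axioms of the hierarchy in a model -/

section AxiomsInModels

variable {M : Str} [PAModel M]

/-- The indices `e ≺ c` in the sense of the model. -/
abbrev Below (lt : ArithFm 2) (c : M.C) : M.C → Prop := fun e => lt.rel M e c

variable {S : Thy} {lt : ArithFm 2} {d : ℕ} {r : ℕ → M.C}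

omit [PAModel M] in
theorem rep1_bot : Rep1 M d r (fun _ => Bld.bot) fun _ => False :=
  fun _ _ _ _ _ _ => holds_bbot

omit [PAModel M] in
theorem rep1_below {c : Tm} (hc : c.ub ≤ d) : Rep1 M d r (below lt c) (Below lt (c.eval M r)) :=
  fun d' r' t h1 h2 h3 => by rw [below, holds_app2 h3 (hc.trans h1), Tm.eval_agree hc h2]

omit [PAModel M] in
theorem rep1_upTo {c : Tm} (hc : c.ub ≤ d) :
    Rep1 M d r (upTo lt c) fun e => lt.rel M e (c.eval M r) ∨ e = c.eval M r :=
  fun d' r' t h1 h2 h3 => by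
    rw [upTo, holds_bor, holds_app2 h3 (hc.trans h1), Tm.eval_agree hc h2, holds_beq,
      Tm.eval_agree hc h2]

theorem holds_baseA {x : Tm} (hx : x.ub ≤ d) :
    (baseA S x d).Holds M r ↔ Wf S (fun _ => False) 1 (x.eval M r) :=
  holds_fmA rep1_bot hx

theorem holds_inLA {a : ℕ} {x : Tm} (hx : x.ub ≤ d) :
    (inLA S lt a x d).Holds M r ↔ Wf S (Below lt (a : M.C)) 1 (x.eval M r) := by
  rw [inLA, holds_fmA (rep1_below (by simp)) hx, eval_num]

theorem holds_inLsuccA {a : ℕ} {x : Tm} (hx : x.ub ≤ d) :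
    (inLsuccA S lt a x d).Holds M r ↔
      Wf S (fun e => lt.rel M e (a : M.C) ∨ e = (a : M.C)) 1 (x.eval M r) := by
  rw [inLsuccA, holds_fmA (rep1_upTo (by simp)) hx, eval_num]

theorem holds_axAxioms {a : ℕ} : (axAxioms S a).Holds M r ↔
    ∀ x, Wf S (fun _ => False) 1 x ∧ S.ax.prop M x → M.tr a x := by
  simp (disch := first | omega | (simp only [ub_cd] <;> omega)) only [axAxioms, holds_conn,
    holds_baseA, holds_app1, eval_cd, Function.update_self]

theorem holds_axRules {a : ℕ} : (axRules S lt a).Holds M r ↔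
    ∀ x y z, Wf S (Below lt (a : M.C)) 1 x ∧ Wf S (Below lt (a : M.C)) 1 y ∧
      Wf S (Below lt (a : M.C)) 1 z ∧ (IsLogAx S (Below lt (a : M.C)) z ∨ Infers x y z) →
      M.tr a x ∧ M.tr a y → M.tr a z := by
  have h : ∀ (d : ℕ) (r : ℕ → M.C) x y z, x.ub ≤ d → y.ub ≤ d → z.ub ≤ d →
      ((ruleA S (below lt (num a)) x y z d).Holds M r ↔
        (IsLogAx S (Below lt (a : M.C)) (z.eval M r) ∨
          Infers (x.eval M r) (y.eval M r) (z.eval M r))) := fun d r x y z hx hy hz => by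
    rw [holds_ruleA (rep1_below (by simp)) hx hy hz, eval_num]
  simp (disch := first | omega | (simp only [ub_cd] <;> omega)) only [axRules, holds_conn,
    holds_inLA, h, eval_cd, Function.update_self, Function.update_of_ne]

theorem holds_axInd {a : ℕ} : (axInd S lt a).Holds M r ↔
    ∀ v A x, Wf S (Below lt (a : M.C)) 1 A ∧ IsInd v A x → M.tr a x := by
  simp (disch := first | omega | (simp only [ub_cd] <;> omega)) only [axInd, holds_conn,
    holds_inLA, holds_indA, eval_cd, Function.update_self, Function.update_of_ne]

theorem holds_axOmega {a : ℕ} : (axOmega S lt a).Holds M r ↔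
    ∀ v A, Wf S (Below lt (a : M.C)) 1 A ∧ (∀ u, ¬ NotFree u A ↔ u = v) →
      ((∀ n, ∃ m y, IsNum n m ∧ Sub v m A y ∧ M.tr a y) ↔ M.tr a (cAll v A)) := by
  simp (disch := first | omega | (simp only [ub_cd] <;> omega)) only [axOmega, holds_conn,
    holds_inLA, holds_notFreeA, holds_numA, holds_subA, holds_trueA, eval_cd, Function.update_self,
    Function.update_of_ne]

theorem holds_axDefs {a : ℕ} : (axDefs S lt a).Holds M r ↔
    ∀ c A B m, lt.rel M c (a : M.C) ∧ Wf S (Below lt c) 1 A ∧ Clos A B ∧ IsNum A m →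
      M.tr a (cIff B (cTr c m)) := by
  have h : ∀ (d : ℕ) (r : ℕ → M.C) c x, c.ub ≤ d → x.ub ≤ d →
      ((fmA S (below lt c) x d).Holds M r ↔ Wf S (Below lt (c.eval M r)) 1 (x.eval M r)) :=
    fun d r c x hc hx => holds_fmA (rep1_below hc) hx
  simp (disch := first | omega | (simp only [ub_cd] <;> omega)) only [axDefs, holds_conn,
    h, holds_app2, holds_closureA, holds_numA, holds_trueA, eval_cd, Function.update_self,
    Function.update_of_ne]

theorem holds_inLFm : (inLFm S lt).Holds M r ↔ Wf S (Below lt (r 0)) 1 (r 1) :=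
  holds_fmA (x := .var 1) (rep1_below (by simp only [ub_cd]; omega)) (by simp only [ub_cd]; omega)

theorem holds_axAgree {a b : ℕ} : (axAgree S lt a b).Holds M r ↔
    ∀ x, Wf S (Below lt (b : M.C)) 1 x → (M.tr b x ↔ M.tr a x) := by
  simp only [axAgree, holds_all, holds_imp, holds_iff, holds_tr,
    Fm.holds_subst (Fm.freeFor_of_not_occ (t := num b)
      (fun v h => by have := Tm.occ_lt_ub h; simp at this) _ 0), holds_inLFm]
  simp

/-- The nonlogical axioms of `S_a` in the sense of the model. -/
def IsAx (S : Thy) (lt : ArithFm 2) (a : ℕ) (x : M.C) : Prop :=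
  (Wf S (fun _ => False) 1 x ∧ S.ax.prop M x) ∨
  (∃ v A, Wf S (fun e => lt.rel M e (a : M.C) ∨ e = (a : M.C)) 1 A ∧ IsInd v A x) ∨
  x = ((axAxioms S a).code : ℕ) ∨ x = ((axRules S lt a).code : ℕ) ∨
  x = ((axInd S lt a).code : ℕ) ∨ x = ((axOmega S lt a).code : ℕ) ∨
  (∃ A B m, Wf S (Below lt (a : M.C)) 1 A ∧ Clos A B ∧ IsNum A m ∧ x = cIff B (cTr (a : M.C) m)) ∨
  x = ((axDefs S lt a).code : ℕ) ∨
  ∃ c m f, lt.rel M c (a : M.C) ∧ IsNum c m ∧ Sub 0 m ((inLFm S lt).code : ℕ) f ∧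
    x = cAll 1 (cImp f (cIff (cTr c (cVar 1)) (cTr (a : M.C) (cVar 1))))

theorem holds_axA {a : ℕ} {x : Tm} (hx : x.ub ≤ d) :
    (axA S lt a x d).Holds M r ↔ IsAx S lt a (x.eval M r) := by
  simp (disch := first | omega | (simp only [ub_cd] <;> omega)) only [axA, holds_conn,
    holds_baseA, holds_inLA, holds_inLsuccA, holds_app1, holds_app2, holds_indA, holds_closureA,
    holds_numA, holds_subA, holds_isA, eval_cd, Tm.eval_update, Function.update_self,
    Function.update_of_ne, Nat.cast_one, IsAx]

/-- The theorems of `S_a` in the sense of the model. -/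
def IsThm (S : Thy) (lt : ArithFm 2) (a : ℕ) (x : M.C) : Prop :=
  Gen (fun y => Wf S (fun e => lt.rel M e (a : M.C) ∨ e = (a : M.C)) 1 y ∧
      (IsAx S lt a y ∨ IsLogAx S (fun e => lt.rel M e (a : M.C) ∨ e = (a : M.C)) y))
    (fun u w y => Wf S (fun e => lt.rel M e (a : M.C) ∨ e = (a : M.C)) 1 y ∧ Infers u w y) x

theorem holds_theoremsTrue {a b : ℕ} : (theoremsTrue S lt a b).Holds M r ↔
    ∀ x, IsThm S lt b x → M.tr a x := by
  unfold theoremsTrue thmA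
  simp only [holds_conn]
  refine forall_congr' fun x => imp_congr ?_ (by simp)
  rw [holds_genA ?_ ?_ (by simp [Tm.ub]), IsThm, eval_var, Function.update_self]
  · intro d' r' t h1 h2 h3
    rw [holds_band, holds_bor, holds_inLsuccA h3, holds_logAxA (rep1_upTo (by simp)) h3,
      holds_axA h3, eval_num]
  · intro d' r' t u w h1 h2 h3 h4 h5
    rw [holds_band, holds_inLsuccA h5, holds_inferA h3 h4 h5]

end AxiomsInModels

/-! ### The truth predicate in a model of the hierarchy -/

section TruthPredicate

variable {S : Thy} {lt : ArithFm 2} {prec : ℕ → ℕ → Prop} {a : ℕ} {M : Str}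

/-- `M` is a model of the axioms of `S_a`. -/
def Models (S : Thy) (lt : ArithFm 2) (prec : ℕ → ℕ → Prop) (a : ℕ) (M : Str) : Prop :=
  ∀ A ∈ Ax S lt a prec, A.In (langLsucc S prec a) → ∀ r, A.Holds M r

namespace Models

theorem proves (hM : Models S lt prec a M) {A : Fm} (hA : S.Proves A) (r : ℕ → M.C) :
    A.Holds M r :=
  Provable.holds hA (fun B hB hB' r => hM B (.base hB) (hB'.mono (fun _ _ h => h) (fun _ _ h => h)
    fun _ h => h.elim) r) r

theorem paModel (hM : Models S lt prec a M) (hS : S.ExtendsPA) : PAModel M :=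
  ⟨fun A hA r => hM.proves (hS A hA) r⟩

theorem inductive_langLsucc (hM : Models S lt prec a M) : Inductive (langLsucc S prec a) M :=
  ⟨fun v A hA r => hM _ (.ind v hA) ⟨⟨⟨Fm.in_subst hA (by exact trivial) v, ⟨hA, Fm.in_subst hA
    (by exact trivial) v⟩, trivial⟩, trivial⟩, hA⟩ r⟩

variable [PAModel M]

theorem axioms (hM : Models S lt prec a M) {x : M.C} (h : Wf S (fun _ => False) 1 x)
    (hx : S.ax.prop M x) : M.tr a x :=
  holds_axAxioms.1 (hM _ .axioms (in_axAxioms S (.inr rfl)) fun _ => 0) x ⟨h, hx⟩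

theorem rules (hM : Models S lt prec a M) {x y z : M.C} (hx : Wf S (Below lt (a : M.C)) 1 x)
    (hy : Wf S (Below lt (a : M.C)) 1 y) (hz : Wf S (Below lt (a : M.C)) 1 z)
    (h : IsLogAx S (Below lt (a : M.C)) z ∨ Infers x y z) (hx' : M.tr a x) (hy' : M.tr a y) :
    M.tr a z :=
  holds_axRules.1 (hM _ .rules (in_axRules S lt (.inr rfl)) fun _ => 0) x y z
    ⟨hx, hy, hz, h⟩ ⟨hx', hy'⟩

theorem truthInd (hM : Models S lt prec a M) {v A x : M.C} (hA : Wf S (Below lt (a : M.C)) 1 A)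
    (h : IsInd v A x) : M.tr a x :=
  holds_axInd.1 (hM _ .truthInd (in_axInd S lt (.inr rfl)) fun _ => 0) v A x ⟨hA, h⟩

theorem omega (hM : Models S lt prec a M) {v A : M.C} (hA : Wf S (Below lt (a : M.C)) 1 A)
    (h : ∀ u, ¬ NotFree u A ↔ u = v) :
    (∀ n, ∃ m y, IsNum n m ∧ Sub v m A y ∧ M.tr a y) ↔ M.tr a (cAll v A) :=
  holds_axOmega.1 (hM _ .omega (in_axOmega S lt (.inr rfl)) fun _ => 0) v A ⟨hA, h⟩

theorem defs (hM : Models S lt prec a M) {c A B m : M.C} (hc : lt.rel M c (a : M.C))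
    (hA : Wf S (Below lt c) 1 A) (hB : Clos A B) (hm : IsNum A m) :
    M.tr a (cIff B (cTr c m)) :=
  holds_axDefs.1 (hM _ .defs (in_axDefs S lt (.inr rfl)) fun _ => 0) c A B m ⟨hc, hA, hB, hm⟩

theorem agree (hM : Models S lt prec a M) {b : ℕ} (hb : prec b a) {x : M.C}
    (hx : Wf S (Below lt (b : M.C)) 1 x) : M.tr b x ↔ M.tr a x :=
  holds_axAgree.1 (hM _ (.agree hb) (in_axAgree S lt (L := langLsucc S prec a) (.inr rfl) (.inl hb)) fun _ => 0) x hx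

omit [PAModel M] in
theorem in_langLsucc {A : Fm} (hA : A.In (langL S prec a)) : A.In (langLsucc S prec a) :=
  hA.mono (fun _ _ h => h) (fun _ _ h => h) fun _ h => .inl h

/-- Standard formulas that hold in the model are true in the sense of its truth predicate. -/
theorem tr_code (hM : Models S lt prec a M) {A : Fm} (hA : A.In (langL S prec a))
    (h : ∀ r, A.Holds M r) : M.tr a ((A.code : ℕ) : M.C) := by
  obtain ⟨B, hB⟩ := A.exists_isUnivClosure
  have hB' := hB.1.in (in_langLsucc hA)
  have hT : (Fm.tr a (num A.code)).In (langLsucc S prec a) := ⟨.inr rfl, in_num _⟩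
  have := hM _ (.truthDef hA hB) ⟨⟨⟨hB', hT⟩, ⟨hT, hB'⟩, trivial⟩, trivial⟩ fun _ => 0
  rw [holds_iff, holds_tr, eval_num] at this
  exact this.1 (hB.1.forall_holds.2 h _)

/-- Arithmetical formulas that hold in the model are true in the sense of its truth predicate. -/
theorem tr_cdF_none (hM : Models S lt prec a M) {A : Fm} (hA : A.In Lang.arith)
    (h : ∀ r, A.Holds M r) : M.tr a (cdF (fun _ => none) A) := by
  rw [cdF_none]
  exact hM.tr_code hA.of_arith h

/-- The formulas of `L_a` in the sense of the model which are true form a Hilbert calculus. -/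
noncomputable def hilbert (hM : Models S lt prec a M) : Hilbert M.C :=
  have key : ∀ x, Wf S (Below lt (a : M.C)) 1 x → IsLogAx S (Below lt (a : M.C)) x →
      Wf S (Below lt (a : M.C)) 1 x ∧ M.tr a x := fun x hx h => by
    have h1 : Wf S (Below lt (a : M.C)) 1 (cImp cBot cBot) :=
      wf_imp.2 ⟨rfl, wf_bot.2 rfl, wf_bot.2 rfl⟩
    have h2 : M.tr a (cImp cBot cBot : M.C) :=
      hM.tr_cdF_none (A := .imp .bot .bot) (by exact ⟨trivial, trivial⟩) fun _ => id
    exact ⟨hx, hM.rules h1 h1 hx (.inl h) h2 h2⟩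
  { imp := cImp
    bot := cBot
    W := Wf S (Below lt (a : M.C)) 1
    Th := fun x => Wf S (Below lt (a : M.C)) 1 x ∧ M.tr a x
    w_bot := wf_bot.2 rfl
    w_imp := by simp [wf_imp]
    th_w := And.left
    k := fun {A B} hA hB => key _ (by simp [wf_imp, hA, hB]) (.inl ⟨A, B, rfl⟩)
    s := fun {A B C} hA hB hC => key _ (by simp [wf_imp, hA, hB, hC]) (.inr (.inl ⟨A, B, C, rfl⟩))
    dne := fun {A} hA => key _ (by simp [wf_imp, hA, wf_bot]) (.inr (.inr (.inl ⟨A, rfl⟩)))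
    mp := fun {A B} hA hB => ⟨(wf_imp.1 hB.1).2.2, hM.rules hA.1 hB.1 (wf_imp.1 hB.1).2.2
      (.inr (.inl rfl)) hA.2 hB.2⟩ }

/-- The element of the model is a formula of `L_a` and true, in the sense of the model. -/
abbrev Th (_ : Models S lt prec a M) (x : M.C) : Prop := Wf S (Below lt (a : M.C)) 1 x ∧ M.tr a x

theorem th_logAx (hM : Models S lt prec a M) {x : M.C} (hx : Wf S (Below lt (a : M.C)) 1 x)
    (h : IsLogAx S (Below lt (a : M.C)) x) : hM.Th x := by
  have := hM.hilbert.dne hM.hilbert.w_bot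
  exact ⟨hx, hM.rules this.1 this.1 hx (.inl h) this.2 this.2⟩

theorem th_mp (hM : Models S lt prec a M) {x y : M.C} (h : hM.Th (cImp x y)) (hx : hM.Th x) :
    hM.Th y := hM.hilbert.mp hx h

theorem th_gen (hM : Models S lt prec a M) {x : M.C} (hx : hM.Th x) (v : M.C) :
    hM.Th (cAll v x) :=
  ⟨wf_all.2 ⟨rfl, hx.1⟩, hM.rules hx.1 hx.1 (wf_all.2 ⟨rfl, hx.1⟩) (.inr (.inr ⟨v, rfl⟩)) hx.2 hx.2⟩

/-- Instances of true universal formulas are true. -/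
theorem th_inst (hM : Models S lt prec a M) {σ : ℕ → Option M.C} (hσ : ClosedAsg S σ) {A : Fm}
    (hA : A.In Lang.arith) {v : ℕ} (hv : σ v = none) {t : M.C} (ht : IsClosedTm S t) :
    hM.Th (cImp (cAll (v : M.C) (cdF σ A)) (cdF (Function.update σ v (some t)) A)) := by
  refine hM.th_logAx (wf_imp.2 ⟨rfl, wf_all.2 ⟨rfl, wf_cdF hσ hA _⟩,
    wf_cdF (hσ.update_some v ht) hA _⟩) ?_
  exact .inr (.inr (.inr (.inl ⟨v, t, _, _, ht.wf.mono fun _ h => h.elim,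
    repl_cdF ht.notFree hA hσ hv, rfl⟩)))

/-- The assignment of the entries of the list to the first variables. -/
def asg (l : List M.C) : ℕ → Option M.C := fun v => l[v]?

/-- Instances, at codes of closed terms, of arithmetical formulas that hold are true. -/
theorem th_valid (hM : Models S lt prec a M) {A : Fm} (hA : A.In Lang.arith)
    (h : ∀ r, A.Holds M r) (l : List M.C) (hl : ∀ t ∈ l, IsClosedTm S t) :
    hM.Th (cdF (asg l) A) ∧ ClosedAsg S (asg l) := by
  induction l using List.reverseRecOn with
  | nil => 
    have : asg ([] : List M.C) = fun _ => none := by funext v; simp [asg]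
    rw [this]
    exact ⟨⟨wf_cdF (closedAsg_none S) hA _, hM.tr_cdF_none hA h⟩, closedAsg_none S⟩
  | append_singleton l t ih =>
    obtain ⟨h1, h2⟩ := ih fun u hu => hl u (by simp [hu])
    have ht := hl t (by simp)
    have : asg (l ++ [t]) = Function.update (asg l) l.length (some t) := by
      funext v
      rcases lt_trichotomy v l.length with h | rfl | h
      · rw [Function.update_of_ne h.ne, asg, asg, List.getElem?_append_left h]
      · simp [asg]
      · rw [Function.update_of_ne h.ne', asg, asg, List.getElem?_eq_none (by simp; omega),
          List.getElem?_eq_none h.le]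
    rw [this]
    exact ⟨hM.th_mp (hM.th_inst h2 hA (by simp [asg]) ht) (hM.th_gen h1 _),
      h2.update_some _ ht⟩

end Models

end TruthPredicate

/-! ### Truth of arithmetical formulas -/

section ArithmeticalTruth

variable {S : Thy} {lt : ArithFm 2} {prec : ℕ → ℕ → Prop} {a : ℕ} {M : Str} [PAModel M]

open PAModel

namespace Models

theorem th_eq_refl (hM : Models S lt prec a M) {t : M.C} (ht : IsClosedTm S t) :
    hM.Th (cEq t t) := by
  have h := (hM.th_valid (A := .eq (.var 0) (.var 0)) (by simp [Fm.In, Tm.In])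
    (by simp [Fm.Holds]) [t] (by simp [ht])).1
  simpa [cdF, cdT, asg] using h

theorem th_eq_of_eq (hM : Models S lt prec a M) {t u w : M.C} (ht : IsClosedTm S t)
    (hu : IsClosedTm S u) (hw : IsClosedTm S w) (h1 : hM.Th (cEq t w)) (h2 : hM.Th (cEq u w)) :
    hM.Th (cEq t u) := by
  have h := (hM.th_valid (A := .imp (.eq (.var 0) (.var 2)) (.imp (.eq (.var 1) (.var 2))
    (.eq (.var 0) (.var 1)))) (by simp [Fm.In, Tm.In])
    (by simp +contextual [Fm.Holds]) [t, u, w] (by simp [ht, hu, hw])).1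
  simp only [cdF, cdT, asg] at h
  exact hM.th_mp (hM.th_mp h h1) h2

theorem th_ne_of_ne (hM : Models S lt prec a M) {t u t' u' : M.C} (ht : IsClosedTm S t)
    (hu : IsClosedTm S u) (ht' : IsClosedTm S t') (hu' : IsClosedTm S u')
    (h1 : hM.Th (cEq t t')) (h2 : hM.Th (cEq u u')) (h3 : hM.Th (cNot (cEq t' u'))) :
    hM.Th (cNot (cEq t u)) := by
  have h := (hM.th_valid (A := .imp (.eq (.var 0) (.var 2)) (.imp (.eq (.var 1) (.var 3))
    (.imp (.imp (.eq (.var 2) (.var 3)) .bot) (.imp (.eq (.var 0) (.var 1)) .bot))))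
    (by simp [Fm.In, Tm.In])
    (by simp +contextual [Fm.Holds]) [t, u, t', u'] (by simp [ht, hu, ht', hu'])).1
  simp only [cdF, cdT, asg] at h
  exact hM.th_mp (hM.th_mp (hM.th_mp h h1) h2) h3

theorem th_eq_succ (hM : Models S lt prec a M) {t u : M.C} (ht : IsClosedTm S t)
    (hu : IsClosedTm S u) (h1 : hM.Th (cEq t u)) : hM.Th (cEq (cSucc t) (cSucc u)) := by
  have h := (hM.th_valid (A := .imp (.eq (.var 0) (.var 1)) (.eq (.succ (.var 0)) (.succ (.var 1))))
    (by simp [Fm.In, Tm.In]) (by simp +contextual [Fm.Holds]) [t, u] (by simp [ht, hu])).1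
  simp only [cdF, cdT, asg] at h
  exact hM.th_mp h h1

theorem th_eq_add (hM : Models S lt prec a M) {t u t' u' w : M.C} (ht : IsClosedTm S t)
    (hu : IsClosedTm S u) (ht' : IsClosedTm S t') (hu' : IsClosedTm S u') (hw : IsClosedTm S w)
    (h1 : hM.Th (cEq t t')) (h2 : hM.Th (cEq u u')) (h3 : hM.Th (cEq (cAdd t' u') w)) :
    hM.Th (cEq (cAdd t u) w) := by
  have h := (hM.th_valid (A := .imp (.eq (.var 0) (.var 2)) (.imp (.eq (.var 1) (.var 3))
    (.imp (.eq (.add (.var 2) (.var 3)) (.var 4)) (.eq (.add (.var 0) (.var 1)) (.var 4)))))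
    (by simp [Fm.In, Tm.In])
    (by simp +contextual [Fm.Holds]) [t, u, t', u', w] (by simp [ht, hu, ht', hu', hw])).1
  simp only [cdF, cdT, asg] at h
  exact hM.th_mp (hM.th_mp (hM.th_mp h h1) h2) h3

theorem th_eq_mul (hM : Models S lt prec a M) {t u t' u' w : M.C} (ht : IsClosedTm S t)
    (hu : IsClosedTm S u) (ht' : IsClosedTm S t') (hu' : IsClosedTm S u') (hw : IsClosedTm S w)
    (h1 : hM.Th (cEq t t')) (h2 : hM.Th (cEq u u')) (h3 : hM.Th (cEq (cMul t' u') w)) :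
    hM.Th (cEq (cMul t u) w) := by
  have h := (hM.th_valid (A := .imp (.eq (.var 0) (.var 2)) (.imp (.eq (.var 1) (.var 3))
    (.imp (.eq (.mul (.var 2) (.var 3)) (.var 4)) (.eq (.mul (.var 0) (.var 1)) (.var 4)))))
    (by simp [Fm.In, Tm.In])
    (by simp +contextual [Fm.Holds]) [t, u, t', u', w] (by simp [ht, hu, ht', hu', hw])).1
  simp only [cdF, cdT, asg] at h
  exact hM.th_mp (hM.th_mp (hM.th_mp h h1) h2) h3

/-- Sums of numerals are computed correctly, by induction inside the model. -/
theorem th_add_num (hM : Models S lt prec a M) (x y : M.C) :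
    hM.Th (cEq (cAdd (cNum x) (cNum y)) (cNum (x + y))) := by
  have := hM.inductive_langLsucc
  have hT := fun f [DefF (langLsucc S prec a) M f] =>
    DefP.tr (L := langLsucc S prec a) (M := M) (f := f) (a := a) (.inr rfl) inferInstance
  have hc := isClosedTm_cNum (M := M) S
  refine PAModel.ind (L := langLsucc S prec a)
    (P := fun y => hM.Th (cEq (cAdd (cNum x) (cNum y)) (cNum (x + y)))) ?_ ?_ ?_ y
  · infer_instance
  · have h := (hM.th_valid (A := .eq (.add (.var 0) .zero) (.var 0)) (by simp [Fm.In, Tm.In])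
      (by simp [Fm.Holds]) [cNum x] (by simp [hc])).1
    rw [cNum_zero, add_zero]
    exact h
  · intro y ih
    have h := (hM.th_valid (A := .imp (.eq (.add (.var 0) (.var 1)) (.var 2))
      (.eq (.add (.var 0) (.succ (.var 1))) (.succ (.var 2)))) (by simp [Fm.In, Tm.In])
      (by intro r; simp [Fm.Holds, ← add_assoc]) [cNum x, cNum y, cNum (x + y)]
      (by simp [hc])).1
    rw [cNum_succ, ← add_assoc, cNum_succ]
    exact hM.th_mp h ih

/-- Products of numerals are computed correctly. -/
theorem th_mul_num (hM : Models S lt prec a M) (x y : M.C) :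
    hM.Th (cEq (cMul (cNum x) (cNum y)) (cNum (x * y))) := by
  have := hM.inductive_langLsucc
  have hT := fun f [DefF (langLsucc S prec a) M f] =>
    DefP.tr (L := langLsucc S prec a) (M := M) (f := f) (a := a) (.inr rfl) inferInstance
  have hc := isClosedTm_cNum (M := M) S
  refine PAModel.ind (L := langLsucc S prec a)
    (P := fun y => hM.Th (cEq (cMul (cNum x) (cNum y)) (cNum (x * y)))) ?_ ?_ ?_ y
  · infer_instance
  · have h := (hM.th_valid (A := .eq (.mul (.var 0) .zero) .zero) (by simp [Fm.In, Tm.In])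
      (by simp [Fm.Holds]) [cNum x] (by simp [hc])).1
    rw [mul_zero, cNum_zero]
    exact h
  · intro y ih
    have h := (hM.th_valid (A := .imp (.eq (.mul (.var 0) (.var 1)) (.var 2))
      (.imp (.eq (.add (.var 2) (.var 0)) (.var 3))
      (.eq (.mul (.var 0) (.succ (.var 1))) (.var 3)))) (by simp [Fm.In, Tm.In])
      (by intro r; simp +contextual [Fm.Holds, mul_add])
      [cNum x, cNum y, cNum (x * y), cNum (x * y + x)] (by simp [hc])).1
    rw [cNum_succ, mul_add, mul_one]
    exact hM.th_mp (hM.th_mp h ih) (hM.th_add_num _ _)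

/-- The truth predicate refutes equations between different numerals. -/
theorem th_ne_num (hM : Models S lt prec a M) {x y : M.C} (h : x ≠ y) :
    hM.Th (cNot (cEq (cNum x) (cNum y))) := by
  have hc := isClosedTm_cNum (M := M) S
  rcases h.lt_or_gt with h | h
  · obtain ⟨k, rfl⟩ := lt_def.1 h
    have h := (hM.th_valid (A := .imp (.eq (.add (.var 0) (.succ (.var 1))) (.var 2))
      (.imp (.eq (.var 0) (.var 2)) .bot)) (by simp [Fm.In, Tm.In])
      (by
        intro r
        simp +contextual only [Fm.Holds, eval_add, eval_succ, eval_var]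
        intro h e
        exact succ_ne (r 1) (add_left_cancel (a := r 0) (by rw [add_zero, h, e])))
      [cNum x, cNum k, cNum (x + (k + 1))] (by simp [hc])).1
    rw [show x + 1 + k = x + (k + 1) by ring]
    refine hM.th_mp h ?_
    have := hM.th_add_num x (k + 1)
    rwa [cNum_succ k] at this
  · obtain ⟨k, rfl⟩ := lt_def.1 h
    have h := (hM.th_valid (A := .imp (.eq (.add (.var 0) (.succ (.var 1))) (.var 2))
      (.imp (.eq (.var 2) (.var 0)) .bot)) (by simp [Fm.In, Tm.In])
      (by
        intro r
        simp +contextual only [Fm.Holds, eval_add, eval_succ, eval_var]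
        intro h e
        exact succ_ne (r 1) (add_left_cancel (a := r 0) (by rw [add_zero, h, e])))
      [cNum y, cNum k, cNum (y + (k + 1))] (by simp [hc])).1
    rw [show y + 1 + k = y + (k + 1) by ring]
    refine hM.th_mp h ?_
    have := hM.th_add_num y (k + 1)
    rwa [cNum_succ k] at this

end Models

/-- The assignment of the numerals for the values of the variables. -/
noncomputable def numAsg (r : ℕ → M.C) : ℕ → Option M.C := fun v => some (cNum (r v))

theorem closedAsg_numAsg (S : Thy) (r : ℕ → M.C) : ClosedAsg S (numAsg r) := by
  rintro v t h
  cases h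
  exact isClosedTm_cNum S _

theorem numAsg_update (r : ℕ → M.C) (v : ℕ) (x : M.C) :
    numAsg (Function.update r v x) = Function.update (numAsg r) v (some (cNum x)) := by
  funext w
  by_cases h : w = v
  · subst h; simp [numAsg]
  · simp [numAsg, h]

theorem isClosedTm_cdT {r : ℕ → M.C} {t : Tm} (ht : t.In Lang.arith) :
    IsClosedTm S (cdT (numAsg r) t) :=
  ⟨wf_cdT (closedAsg_numAsg S r) ht _, fun u =>
    (notFree_cdT (closedAsg_numAsg S r) ht u).2 fun v _ h => by cases h⟩

namespace Models

/-- The closed terms have their values. -/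
theorem th_eval (hM : Models S lt prec a M) {t : Tm} (ht : t.In Lang.arith) (r : ℕ → M.C) :
    hM.Th (cEq (cdT (numAsg r) t) (cNum (t.eval M r))) := by
  have hc := isClosedTm_cNum (M := M) S
  induction t with
  | var v => exact hM.th_eq_refl (hc _)
  | zero =>
    have := hM.th_eq_refl (hc 0)
    rw [eval_zero]
    rwa [cNum_zero] at this ⊢
  | succ t ih =>
    rw [eval_succ, cNum_succ]
    exact hM.th_eq_succ (isClosedTm_cdT ht) (hc _) (ih ht)
  | add t u iht ihu =>
    exact hM.th_eq_add (isClosedTm_cdT ht.1) (isClosedTm_cdT ht.2) (hc _) (hc _) (hc _)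
      (iht ht.1) (ihu ht.2) (hM.th_add_num _ _)
  | mul t u iht ihu =>
    exact hM.th_eq_mul (isClosedTm_cdT ht.1) (isClosedTm_cdT ht.2) (hc _) (hc _) (hc _)
      (iht ht.1) (ihu ht.2) (hM.th_mul_num _ _)
  | fn k i ts ih => exact ht.1.elim

open Hilbert

/-- The truth predicate decides the instances of arithmetical formulas correctly.  The `ω`-rule is
what makes the induction go through at quantifiers. -/
theorem th_of_holds (hM : Models S lt prec a M) {A : Fm} (hA : A.In Lang.arith) (r : ℕ → M.C) :
    (A.Holds M r → hM.Th (cdF (numAsg r) A)) ∧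
    (¬ A.Holds M r → hM.Th (cNot (cdF (numAsg r) A))) := by
  induction A generalizing r with
  | bot => exact ⟨False.elim, fun _ => th_id (H := hM.hilbert) hM.hilbert.w_bot⟩
  | eq t u =>
    have h1 := isClosedTm_cdT (S := S) (r := r) hA.1
    have h2 := isClosedTm_cdT (S := S) (r := r) hA.2
    have hc := isClosedTm_cNum (M := M) S
    refine ⟨fun h => ?_, fun h => ?_⟩
    · have h : t.eval M r = u.eval M r := h
      refine hM.th_eq_of_eq h1 h2 (hc (u.eval M r)) ?_ (hM.th_eval hA.2 r)
      rw [← h]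
      exact hM.th_eval hA.1 r
    · exact hM.th_ne_of_ne h1 h2 (hc _) (hc _) (hM.th_eval hA.1 r) (hM.th_eval hA.2 r)
        (hM.th_ne_num h)
  | rel k i ts => exact hA.1.elim
  | tr a t => exact hA.1.elim
  | imp A B ihA ihB =>
    obtain ⟨hA1, hA2⟩ := ihA hA.1 r
    obtain ⟨hB1, hB2⟩ := ihB hA.2 r
    have wA : hM.hilbert.W (cdF (numAsg r) A) := wf_cdF (closedAsg_numAsg S r) hA.1 _
    have wB : hM.hilbert.W (cdF (numAsg r) B) := wf_cdF (closedAsg_numAsg S r) hA.2 _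
    refine ⟨fun h => ?_, fun h => ?_⟩
    · by_cases hA' : A.Holds M r
      · exact hM.th_mp (hM.hilbert.k wB wA) (hB1 (h hA'))
      · refine der_empty (H := hM.hilbert) (Der.deduct wA (Der.exfalso wB ?_))
        exact .mp (.hyp (by simp) wA) (.th (hA2 hA'))
    · have h : A.Holds M r ∧ ¬ B.Holds M r := by simpa [Fm.Holds] using h
      have wI := hM.hilbert.w_imp.2 ⟨wA, wB⟩
      refine der_empty (H := hM.hilbert) (Der.deduct wI ?_)
      exact .mp (.mp (.th (hA1 h.1)) (.hyp (Set.mem_insert _ _) wI)) (.th (hB2 h.2))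
  | all v A ih =>
    have hA : A.In Lang.arith := hA
    have hσ := (closedAsg_numAsg S r).update_none v
    have hc := isClosedTm_cNum (M := M) S
    have hsub : ∀ n, cdF (Function.update (Function.update (numAsg r) v none) v (some (cNum n))) A
        = cdF (numAsg (Function.update r v n)) A := fun n => by
      rw [Function.update_idem, numAsg_update]
    have wF : hM.hilbert.W (cdF (Function.update (numAsg r) v none) A) := wf_cdF hσ hA _
    refine ⟨fun h => ?_, fun h => ?_⟩
    · by_cases hv : A.Free v
      · refine ⟨wf_all.2 ⟨rfl, wF⟩, (hM.omega wF fun u => ?_).1 fun n => ⟨cNum n, _, isNum_cNum n,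
          repl_cdF (hc n).notFree hA hσ (by simp), ?_⟩⟩
        · rw [notFree_cdF hσ hA]
          constructor
          · intro h
            by_contra hu
            refine h fun w hw h0 => ?_
            by_cases hwv : w = v
            · subst hwv; exact fun e => hu e.symm
            · rw [Function.update_of_ne hwv] at h0
              cases h0
          · rintro rfl h
            exact h v hv (by simp) rfl
        · rw [hsub]
          exact ((ih hA _).1 (h n)).2
      · have := (ih hA (Function.update r v 0)).1 (h 0)
        rw [← hsub, cdF_congr (τ := Function.update (numAsg r) v none) fun w hw => ?_] at this
        · exact hM.th_gen this _
        · refine Function.update_of_ne ?_ _ _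
          rintro rfl
          exact hv hw
    · have h : ∃ n, ¬ A.Holds M (Function.update r v n) := by simpa [Fm.Holds] using h
      obtain ⟨n, hn⟩ := h
      have h1 := hM.th_inst (v := v) hσ hA (by simp) (hc n)
      have h2 := (ih hA _).2 hn
      rw [hsub] at h1
      have wA : hM.hilbert.W (cAll (v : M.C) (cdF (Function.update (numAsg r) v none) A)) :=
        wf_all.2 ⟨rfl, wF⟩
      refine der_empty (H := hM.hilbert) (Der.deduct wA ?_)
      exact .mp (.mp (.hyp (Set.mem_insert _ _) wA) (.th h1)) (.th h2)

end Models

end ArithmeticalTruth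

/-! ### Free variables of the formula for membership in a language -/

section FreeVariables

theorem Tm.occ_shift {t : Tm} {d v : ℕ} (h : (t.shift d).Occ v) : ∃ i, t.Occ i ∧ v = i + d := by
  induction t with
  | var w => exact ⟨w, rfl, h.symm⟩
  | zero => exact h.elim
  | succ t ih => exact ih h
  | add t u iht ihu =>
    exact h.elim (fun h => (iht h).imp fun _ h => ⟨.inl h.1, h.2⟩)
      fun h => (ihu h).imp fun _ h => ⟨.inr h.1, h.2⟩
  | mul t u iht ihu =>
    exact h.elim (fun h => (iht h).imp fun _ h => ⟨.inl h.1, h.2⟩)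
      fun h => (ihu h).imp fun _ h => ⟨.inr h.1, h.2⟩
  | fn k i ts ih =>
    obtain ⟨j, h⟩ := h
    exact (ih j h).imp fun _ h => ⟨⟨j, h.1⟩, h.2⟩

theorem Fm.free_shift {A : Fm} {d v : ℕ} (h : (A.shift d).Free v) :
    ∃ i, A.Free i ∧ v = i + d := by
  induction A with
  | bot => exact h.elim
  | eq t u =>
    exact h.elim (fun h => (Tm.occ_shift h).imp fun _ h => ⟨.inl h.1, h.2⟩)
      fun h => (Tm.occ_shift h).imp fun _ h => ⟨.inr h.1, h.2⟩
  | rel k i ts =>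
    obtain ⟨j, h⟩ := h
    exact (Tm.occ_shift h).imp fun _ h => ⟨⟨j, h.1⟩, h.2⟩
  | tr a t => exact Tm.occ_shift (t := t) h
  | imp A B ihA ihB =>
    exact h.elim (fun h => (ihA h).imp fun _ h => ⟨.inl h.1, h.2⟩)
      fun h => (ihB h).imp fun _ h => ⟨.inr h.1, h.2⟩
  | all w A ih =>
    obtain ⟨i, h1, rfl⟩ := ih h.2
    exact ⟨i, ⟨fun e => h.1 (by rw [e]), h1⟩, rfl⟩

theorem Tm.occ_subst {t s : Tm} {v w : ℕ} (h : (t.subst v s).Occ w) :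
    (t.Occ w ∧ w ≠ v) ∨ s.Occ w := by
  induction t with
  | var u =>
    by_cases hu : u = v
    · simp only [Tm.subst, if_pos hu] at h
      exact .inr h
    · simp only [Tm.subst, if_neg hu] at h
      exact .inl ⟨h, fun e => hu (Eq.trans h e)⟩
  | zero => exact h.elim
  | succ t ih => exact ih h
  | add t u iht ihu =>
    exact h.elim (fun h => (iht h).imp_left fun h => ⟨.inl h.1, h.2⟩)
      fun h => (ihu h).imp_left fun h => ⟨.inr h.1, h.2⟩
  | mul t u iht ihu =>
    exact h.elim (fun h => (iht h).imp_left fun h => ⟨.inl h.1, h.2⟩)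
      fun h => (ihu h).imp_left fun h => ⟨.inr h.1, h.2⟩
  | fn k i ts ih =>
    obtain ⟨j, h⟩ := h
    exact (ih j h).imp_left fun h => ⟨⟨j, h.1⟩, h.2⟩

theorem Fm.free_subst {A : Fm} {s : Tm} {v w : ℕ} (h : (A.subst v s).Free w) :
    (A.Free w ∧ w ≠ v) ∨ s.Occ w := by
  induction A with
  | bot => exact h.elim
  | eq t u =>
    exact h.elim (fun h => (Tm.occ_subst h).imp_left fun h => ⟨.inl h.1, h.2⟩)
      fun h => (Tm.occ_subst h).imp_left fun h => ⟨.inr h.1, h.2⟩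
  | rel k i ts =>
    obtain ⟨j, h⟩ := h
    exact (Tm.occ_subst h).imp_left fun h => ⟨⟨j, h.1⟩, h.2⟩
  | tr a t => exact Tm.occ_subst (t := t) h
  | imp A B ihA ihB =>
    exact h.elim (fun h => (ihA h).imp_left fun h => ⟨.inl h.1, h.2⟩)
      fun h => (ihB h).imp_left fun h => ⟨.inr h.1, h.2⟩
  | all u A ih =>
    by_cases hu : u = v
    · simp only [Fm.subst, if_pos hu] at h
      exact .inl ⟨h, fun e => h.1 (hu.trans e.symm)⟩
    · simp only [Fm.subst, if_neg hu] at h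
      exact (ih h.2).imp_left fun h' => ⟨⟨h.1, h'.1⟩, h'.2⟩

/-- The free variables of the formula have index less than `d`. -/
def Fm.FreeLt (d : ℕ) (A : Fm) : Prop := ∀ v, A.Free v → v < d

theorem freeLt_eq {t u : Tm} {d : ℕ} (ht : t.ub ≤ d) (hu : u.ub ≤ d) :
    ((t =ₐ u) d).FreeLt d := fun _ hv =>
  hv.elim (fun h => (Tm.occ_lt_ub h).trans_le ht) fun h => (Tm.occ_lt_ub h).trans_le hu

theorem freeLt_conn :
    (∀ (d : ℕ) f, (Bld.ex f d).FreeLt d ↔ (f (.var d) (d + 1)).FreeLt (d + 1)) ∧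
    (∀ (d : ℕ) f, (Bld.all f d).FreeLt d ↔ (f (.var d) (d + 1)).FreeLt (d + 1)) ∧
    (∀ (d : ℕ), (Bld.bot d).FreeLt d) ∧
    (∀ (d : ℕ) A B, ((A →ₐ B) d).FreeLt d ↔ (A d).FreeLt d ∧ (B d).FreeLt d) ∧
    (∀ (d : ℕ) A B, ((A ∧ₐ B) d).FreeLt d ↔ (A d).FreeLt d ∧ (B d).FreeLt d) ∧
    (∀ (d : ℕ) A B, ((A ∨ₐ B) d).FreeLt d ↔ (A d).FreeLt d ∧ (B d).FreeLt d) := by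
  have key : ∀ (d : ℕ) (A : Fm), (∀ v, d ≠ v ∧ A.Free v → v < d) ↔ ∀ v, A.Free v → v < d + 1 := by
    intro d A
    refine forall_congr' fun v => ⟨fun h h' => ?_, fun h h' => ?_⟩
    · by_cases hv : d = v
      · omega
      · exact (h ⟨hv, h'⟩).trans (Nat.lt_succ_self d)
    · have := h h'.2
      omega
  simp only [Fm.FreeLt, Bld.ex, Bld.all, Bld.bot, Bld.imp, Bld.and, Bld.or, Fm.ex, Fm.not, Fm.and,
    Fm.or, Fm.Free, or_false, key]
  refine ⟨fun _ _ => trivial, fun _ _ => trivial, fun _ v h => h.elim, ?_, ?_, ?_⟩ <;>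
    exact fun d A B => ⟨fun h => ⟨fun v hv => h v (.inl hv), fun v hv => h v (.inr hv)⟩,
      fun h v hv => hv.elim (h.1 v) (h.2 v)⟩

theorem freeLt_app2 {A : ArithFm 2} {t u : Tm} {d : ℕ} (ht : t.ub ≤ d) (hu : u.ub ≤ d) :
    (app2 A t u d).FreeLt d := by
  intro v hv
  rcases Fm.free_subst hv with ⟨h, h1⟩ | h
  · rcases Fm.free_subst h with ⟨h, h2⟩ | h
    · obtain ⟨i, h3, rfl⟩ := Fm.free_shift h
      have := A.free i h3
      omega
    · exact (Tm.occ_lt_ub h).trans_le ht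
  · exact (Tm.occ_lt_ub h).trans_le hu

theorem freeLt_leA {x y : Tm} {d : ℕ} (hx : x.ub ≤ d) (hy : y.ub ≤ d) : (leA x y d).FreeLt d := by
  simp (disch := first | omega | simp only [ub_cd] <;> omega) only [leA, freeLt_conn, freeLt_eq]

theorem freeLt_ltA {x y : Tm} {d : ℕ} (hx : x.ub ≤ d) (hy : y.ub ≤ d) : (ltA x y d).FreeLt d :=
  freeLt_leA (x := x.succ) hx hy

theorem freeLt_pairA {x y z : Tm} {d : ℕ} (hx : x.ub ≤ d) (hy : y.ub ≤ d) (hz : z.ub ≤ d) :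
    (pairA x y z d).FreeLt d := by
  simp (disch := first | omega | simp only [ub_cd] <;> omega) only [pairA, freeLt_conn, freeLt_eq,
    freeLt_leA, freeLt_ltA, and_self]

theorem freeLt_betaA {p q i y : Tm} {d : ℕ} (hp : p.ub ≤ d) (hq : q.ub ≤ d) (hi : i.ub ≤ d)
    (hy : y.ub ≤ d) : (betaA p q i y d).FreeLt d := by
  simp (disch := first | omega | simp only [ub_cd] <;> omega) only [betaA, freeLt_conn, freeLt_eq,
    freeLt_leA, and_self]

theorem freeLt_isA {x : Tm} {c : Cd} {d : ℕ} (hx : x.ub ≤ d) (hc : c.ub ≤ d) :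
    (isA x c d).FreeLt d := by
  induction c generalizing x d with
  | tm t => exact freeLt_eq hx hc
  | pr c e ihc ihe =>
    have h1 : c.ub ≤ d := (le_max_left _ _).trans hc
    have h2 : e.ub ≤ d := (le_max_right _ _).trans hc
    simp (disch := first | omega | simp only [ub_cd] <;> omega) only [isA, freeLt_conn, ihc, ihe,
      freeLt_pairA, and_self]

theorem freeLt_genA {base : Tm → Bld} {step : Tm → Tm → Tm → Bld} {x : Tm} {d : ℕ}
    (hB : ∀ d' t, d ≤ d' → t.ub ≤ d' → (base t d').FreeLt d')
    (hS : ∀ d' t u w, d ≤ d' → t.ub ≤ d' → u.ub ≤ d' → w.ub ≤ d' → (step t u w d').FreeLt d')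
    (hx : x.ub ≤ d) : (genA base step x d).FreeLt d := by
  simp (disch := first | omega | simp only [ub_cd] <;> omega) only [genA, freeLt_conn,
    freeLt_betaA, freeLt_leA, freeLt_ltA, hB, hS, and_self]

theorem freeLt_wfA {S : Thy} {D : Tm → Bld} {s x : Tm} {d : ℕ}
    (hD : ∀ d' t, d ≤ d' → t.ub ≤ d' → (D t d').FreeLt d') (hs : s.ub ≤ d) (hx : x.ub ≤ d) :
    (wfA S D s x d).FreeLt d := by
  simp (disch := first | omega | simp only [ub_cd] <;> omega) only [wfA, freeLt_conn, freeLt_isA,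
    true_and]
  refine freeLt_genA (fun d' t h1 h2 => ?_) (fun d' t u w h1 h2 h3 h4 => ?_)
    (by simp only [ub_cd]; omega)
  · simp (disch := first | omega | simp only [ub_cd] <;> omega) only [freeLt_conn, freeLt_isA,
      and_self]
  · simp (disch := first | omega | simp only [ub_cd] <;> omega) only [freeLt_conn, freeLt_isA,
      freeLt_app2, hD, and_self]

theorem freeLt_inLFm (S : Thy) (lt : ArithFm 2) : (inLFm S lt).FreeLt 2 :=
  freeLt_wfA (fun d' t h1 h2 => freeLt_app2 h2 (by simp only [ub_cd]; omega)) (by simp)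
    (by simp only [ub_cd]; omega)

end FreeVariables

/-! ### Truth of the theorems -/

namespace Hilbert

variable {F : Type} (H : Hilbert F) {A B C : F}

theorem th_imp_trans (h1 : H.Th (H.imp A B)) (h2 : H.Th (H.imp B C)) : H.Th (H.imp A C) :=
  have hA := (H.w_imp.1 (H.th_w h1)).1
  der_empty (Der.deduct hA (.mp (.mp (.hyp (Set.mem_insert _ _) hA) (.th h1)) (.th h2)))

theorem th_and_left (h : H.Th (H.imp (H.imp A (H.imp B H.bot)) H.bot)) : H.Th A :=
  have hAB := H.w_imp.1 (H.w_imp.1 (H.th_w h)).1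
  have hA := H.w_imp.2 ⟨hAB.1, H.w_bot⟩
  der_empty (Der.by_contra hAB.1 (.mp (Der.deduct hAB.1 (Der.exfalso hAB.2
    (.mp (.hyp (Set.mem_insert _ _) hAB.1)
      (.hyp (Set.mem_insert_of_mem _ (Set.mem_insert _ _)) hA)))) (.th h)))

theorem th_and_right (h : H.Th (H.imp (H.imp A (H.imp B H.bot)) H.bot)) : H.Th B :=
  have hAB := H.w_imp.1 (H.w_imp.1 (H.th_w h)).1
  der_empty (Der.by_contra (H.w_imp.1 hAB.2).1
    (.mp (Der.imp_of (.hyp (Set.mem_insert _ _) hAB.2) hAB.1) (.th h)))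

theorem th_and_intro (hA : H.Th A) (hB : H.Th B) :
    H.Th (H.imp (H.imp A (H.imp B H.bot)) H.bot) :=
  have hw := H.w_imp.2 ⟨H.th_w hA, H.w_imp.2 ⟨H.th_w hB, H.w_bot⟩⟩
  der_empty (Der.deduct hw (.mp (.th hB) (.mp (.th hA) (.hyp (Set.mem_insert _ _) hw))))

end Hilbert

section TruthOfTheorems

variable {S : Thy} {lt : ArithFm 2} {prec : ℕ → ℕ → Prop} {a : ℕ} {M : Str}

theorem rel_of_prec [PAModel M] (hrep : Represents lt prec) {m n : ℕ} (h : prec m n) :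
    lt.rel M (m : M.C) (n : M.C) := by
  have := Provable.holds (M := M) ((hrep m n).1 h) (fun B hB _ r => PAModel.out B hB r) fun _ => 0
  rwa [holds_app2 (by simp) (by simp), eval_num, eval_num] at this

theorem IsLogAx.mono [PAModel M] {D D' : M.C → Prop} (hD : ∀ e, D e → D' e) {x : M.C}
    (h : IsLogAx S D x) : IsLogAx S D' x := by
  rcases h with h | h | h | ⟨v, t, A, B, h1, h2⟩ | h | h | ⟨v, t, u, A, B, C, h1, h2⟩
  · exact .inl h
  · exact .inr (.inl h)
  · exact .inr (.inr (.inl h))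
  · exact .inr (.inr (.inr (.inl ⟨v, t, A, B, h1.mono hD, h2⟩)))
  · exact .inr (.inr (.inr (.inr (.inl h))))
  · exact .inr (.inr (.inr (.inr (.inr (.inl h)))))
  · exact .inr (.inr (.inr (.inr (.inr (.inr ⟨v, t, u, A, B, C, h1.mono hD, h2⟩)))))

theorem wf_cIff [PAModel M] {D : M.C → Prop} {A B : M.C} (hA : Wf S D 1 A) (hB : Wf S D 1 B) :
    Wf S D 1 (cIff A B) := by
  simp [wf_imp, wf_bot, hA, hB]

namespace Models

theorem rel_trans (hM : Models S lt prec a M) (hlt : ProvesTotalOrder S lt) [PAModel M]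
    {x y z : M.C} (hxy : lt.rel M x y) (hyz : lt.rel M y z) : lt.rel M x z := by
  have := hM.proves hlt.trans fun _ => 0
  simp (disch := first | omega | (simp only [ub_cd] <;> omega)) only [holds_conn, holds_app2,
    eval_cd, Function.update_self, Function.update_of_ne] at this
  exact this x y z hxy hyz

variable [PAModel M]

/-- Inside the model, the truth definitions for `c ≺ b ≺ a` make `T_c` and `T_b` agree on `L_c`, and
this is true in the sense of `T_a`, even when `c` is not a standard number. -/
theorem th_agree (hM : Models S lt prec a M) (hlt : ProvesTotalOrder S lt) {c b f : M.C}
    (hcb : lt.rel M c b) (hba : lt.rel M b (a : M.C))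
    (hf : Sub 0 (cNum c) ((inLFm S lt).code : ℕ) f) :
    hM.Th (cAll 1 (cImp f (cIff (cTr c (cVar 1)) (cTr b (cVar 1))))) := by
  have hca := hM.rel_trans hlt hcb hba
  have hc := isClosedTm_cNum (M := M) S
  have hA : (inLFm S lt).In Lang.arith := in_inLFm S lt
  set σ : ℕ → Option M.C := Function.update (fun _ => none) 0 (some (cNum c)) with hσd
  have hσ : ClosedAsg S σ := (closedAsg_none S).update_some 0 (hc c)
  have hσ1 : σ 1 = none := rfl
  obtain rfl : cdF σ (inLFm S lt) = f := by
    have := repl_cdF (ok := fun _ => True) (s := cNum c) (v := 0) (fun _ => trivial) hA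
      (closedAsg_none (M := M) S) rfl
    rw [cdF_none, Nat.cast_zero] at this
    exact this.unique hf
  have hwt : ∀ t : M.C, Wf S (Below lt (a : M.C)) 0 t →
      Wf S (Below lt (a : M.C)) 1 (cIff (cTr c t) (cTr b t)) := fun t ht =>
    wf_cIff (wf_tr.2 ⟨rfl, hca, ht⟩) (wf_tr.2 ⟨rfl, hba, ht⟩)
  have hw : Wf S (Below lt (a : M.C)) 1
      (cImp (cdF σ (inLFm S lt)) (cIff (cTr c (cVar 1)) (cTr b (cVar 1)))) :=
    wf_imp.2 ⟨rfl, wf_cdF hσ hA _, hwt _ (wf_var.2 rfl)⟩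
  refine ⟨wf_all.2 ⟨rfl, hw⟩, (hM.omega hw fun u => ?_).1 fun n =>
    ⟨cNum n, cImp (cdF (Function.update σ 1 (some (cNum n))) (inLFm S lt))
      (cIff (cTr c (cNum n)) (cTr b (cNum n))), isNum_cNum n, ?_, ?_⟩⟩
  · have h1 : u ≠ 1 → NotFree u (cdF σ (inLFm S lt)) := fun hu => by
      rw [notFree_cdF hσ hA]
      intro v hv h0
      have := freeLt_inLFm S lt v hv
      interval_cases v
      · cases h0
      · rw [Nat.cast_one]; exact hu.symm
    simp only [notFree_imp, notFree_tr, notFree_var, notFree_bot]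
    by_cases hu : u = 1
    · simp [hu]
    · simp [hu, h1 hu, Ne.symm hu]
  · have h1 := repl_cdF (ok := fun z => NotFree z (cNum n)) (s := cNum n) (v := 1) (hc n).notFree hA hσ hσ1
    rw [Nat.cast_one] at h1
    have h2 : ∀ e : M.C, Sub 1 (cNum n) (cTr e (cVar 1)) (cTr e (cNum n)) := fun e =>
      repl_tr.2 ⟨_, repl_var.2 (.inl ⟨rfl, rfl⟩), rfl⟩
    have h3 : ∀ A A' B B' : M.C, Sub 1 (cNum n) A A' → Sub 1 (cNum n) B B' →
        Sub 1 (cNum n) (cImp A B) (cImp A' B') := fun A A' B B' hA hB =>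
      repl_imp.2 ⟨_, _, hA, hB, rfl⟩
    have h4 : Sub (1 : M.C) (cNum n) cBot cBot := repl_bot.2 rfl
    exact h3 _ _ _ _ h1 (h3 _ _ _ _ (h3 _ _ _ _ (h3 _ _ _ _ (h2 c) (h2 b))
      (h3 _ _ _ _ (h3 _ _ _ _ (h2 b) (h2 c)) h4)) h4)
  · have e : cdF (Function.update σ 1 (some (cNum n))) (inLFm S lt) =
        cdF (numAsg fun j => if j = 0 then c else n) (inLFm S lt) := by
      refine cdF_congr fun v hv => ?_
      have := freeLt_inLFm S lt v hv
      interval_cases v <;> rfl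
    have hX := hwt _ ((hc n).wf.mono fun _ h => h.elim)
    have hF : hM.hilbert.W (cdF (numAsg fun j => if j = 0 then c else n) (inLFm S lt)) :=
      wf_cdF (closedAsg_numAsg S _) hA _
    rw [e]
    by_cases h : Wf S (Below lt c) 1 n
    · obtain ⟨B, hB⟩ := h.exists_clos
      have hwB := hB.1.wf h
      have h1 : hM.Th (cIff B (cTr c (cNum n))) :=
        ⟨wf_cIff (hwB.mono fun e he => hM.rel_trans hlt he hca)
          (wf_tr.2 ⟨rfl, hca, (hc n).wf.mono fun _ h => h.elim⟩),
          hM.defs hca h hB (isNum_cNum n)⟩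
      have h2 : hM.Th (cIff B (cTr b (cNum n))) :=
        ⟨wf_cIff (hwB.mono fun e he => hM.rel_trans hlt he hca)
          (wf_tr.2 ⟨rfl, hba, (hc n).wf.mono fun _ h => h.elim⟩),
          hM.defs hba (h.mono fun e he => hM.rel_trans hlt he hcb) hB (isNum_cNum n)⟩
      have h3 : hM.Th (cIff (cTr c (cNum n)) (cTr b (cNum n))) :=
        hM.hilbert.th_and_intro
          (hM.hilbert.th_imp_trans (hM.hilbert.th_and_right h1) (hM.hilbert.th_and_left h2))
          (hM.hilbert.th_imp_trans (hM.hilbert.th_and_right h2) (hM.hilbert.th_and_left h1))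
      exact (hM.th_mp (hM.hilbert.k hX hF) h3).2
    · have h1 := (hM.th_of_holds hA fun j => if j = 0 then c else n).2 fun h' =>
        h (holds_inLFm.1 h')
      have : hM.hilbert.Th (hM.hilbert.imp _ _) := Hilbert.der_empty (Hilbert.Der.deduct hF
        (Hilbert.Der.exfalso hX (.mp (.hyp (Set.mem_insert _ _) hF) (.th h1))))
      exact this.2

/-- The axioms of `S_b` in the sense of the model are true. -/
theorem th_isAx (hM : Models S lt prec a M) (hrep : Represents lt prec)
    (hlt : ProvesTotalOrder S lt) {b : ℕ} (hba : prec b a) {x : M.C}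
    (hx : Wf S (Below lt (a : M.C)) 1 x) (h : IsAx S lt b x) : hM.Th x := by
  have hba' : lt.rel M (b : M.C) (a : M.C) := rel_of_prec hrep hba
  have hD : ∀ e, Below lt (b : M.C) e → Below lt (a : M.C) e := fun e he =>
    hM.rel_trans hlt he hba'
  have hc := isClosedTm_cNum (M := M) S
  refine ⟨hx, ?_⟩
  rcases h with ⟨h1, h2⟩ | ⟨v, A, hA, h⟩ | h | h | h | h | ⟨A, B, m, h1, h2, h3, h⟩ | h |
    ⟨c, m, f, h1, h2, h3, h⟩
  · exact hM.axioms h1 h2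
  · refine hM.truthInd (hA.mono ?_) h
    rintro e (he | rfl)
    · exact hD e he
    · exact hba'
  · rw [h]
    refine hM.tr_code (in_axAxioms S hba) fun r => holds_axAxioms.2 ?_
    rintro x ⟨h1, h2⟩
    exact (hM.agree hba (h1.mono fun _ h => h.elim)).2 (hM.axioms h1 h2)
  · rw [h]
    refine hM.tr_code (in_axRules S lt hba) fun r => holds_axRules.2 ?_
    rintro x y z ⟨h1, h2, h3, h4⟩ ⟨h5, h6⟩
    rw [hM.agree hba h1] at h5
    rw [hM.agree hba h2] at h6
    rw [hM.agree hba h3]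
    exact hM.rules (h1.mono hD) (h2.mono hD) (h3.mono hD) (h4.imp_left (IsLogAx.mono hD)) h5 h6
  · rw [h]
    refine hM.tr_code (in_axInd S lt hba) fun r => holds_axInd.2 ?_
    rintro v A x ⟨h1, h2⟩
    refine (hM.agree hba ?_).2 (hM.truthInd (h1.mono hD) h2)
    obtain ⟨A₀, A₁, h3, h4, rfl⟩ := h2
    have h5 := Repl.wf h3 h1 (wf_zero.2 rfl)
    have h6 := Repl.wf h4 h1 (wf_succ.2 ⟨rfl, wf_var.2 rfl⟩)
    simp [wf_imp, wf_all, wf_bot, h1, h5, h6]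
  · rw [h]
    refine hM.tr_code (in_axOmega S lt hba) fun r => holds_axOmega.2 ?_
    rintro v A ⟨h1, h2⟩
    rw [hM.agree hba (wf_all.2 ⟨rfl, h1⟩), ← hM.omega (h1.mono hD) h2]
    refine forall_congr' fun n => exists_congr fun m => exists_congr fun y =>
      and_congr_right fun h3 => and_congr_right fun h4 => ?_
    rw [isNum_iff_eq] at h3
    exact hM.agree hba (Repl.wf h4 h1 (h3 ▸ (hc n).wf.mono fun _ h => h.elim))
  · rw [h]
    exact hM.defs hba' h1 h2 h3
  · rw [h]
    refine hM.tr_code (in_axDefs S lt hba) fun r => holds_axDefs.2 ?_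
    rintro c A B m ⟨h1, h2, h3, h4⟩
    refine (hM.agree hba ?_).2 (hM.defs (hD c h1) h2 h3 h4)
    rw [isNum_iff_eq] at h4
    exact wf_cIff ((h3.1.wf h2).mono fun e he => hM.rel_trans hlt he h1)
      (wf_tr.2 ⟨rfl, h1, h4 ▸ (hc A).wf.mono fun _ h => h.elim⟩)
  · rw [isNum_iff_eq] at h2
    rw [h]
    exact (hM.th_agree hlt h1 hba' (h2 ▸ h3)).2

/-- The theorems of `S_b` in the sense of the model are true. -/
theorem th_isThm (hM : Models S lt prec a M) (hrep : Represents lt prec)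
    (hlt : ProvesTotalOrder S lt) {b : ℕ} (hba : prec b a) {x : M.C} (h : IsThm S lt b x) :
    hM.Th x := by
  have hba' : lt.rel M (b : M.C) (a : M.C) := rel_of_prec hrep hba
  have hD : ∀ e, (lt.rel M e (b : M.C) ∨ e = (b : M.C)) → Below lt (a : M.C) e := by
    rintro e (he | rfl)
    · exact hM.rel_trans hlt he hba'
    · exact hba'
  have := hM.inductive_langLsucc
  have hT := fun f [DefF (langLsucc S prec a) M f] =>
    DefP.tr (L := langLsucc S prec a) (M := M) (f := f) (a := a) (.inr rfl) inferInstance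
  refine Gen.induct (L := langLsucc S prec a) (Q := fun x => hM.Th x) ?_ ?_ ?_ h
  · infer_instance
  · rintro y ⟨h1, h2 | h2⟩
    · exact hM.th_isAx hrep hlt hba (h1.mono hD) h2
    · exact hM.th_logAx (h1.mono hD) (h2.mono hD)
  · rintro u w y - hu - hw ⟨h1, rfl | ⟨v, rfl⟩⟩
    · exact hM.th_mp hw hu
    · exact hM.th_gen hu v

end Models

end TruthOfTheorems

end IteratedTruth

open IteratedTruth in
/-- For `b ≺ a`, the theory `S_a` proves that every theorem of `S_b` is true. -/
theorem proposition4p1 (S : Thy) (hS : S.ExtendsPA)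
    (prec : ℕ → ℕ → Prop) (hprec : IsStrictTotalOrder ℕ prec)
    (lt : ArithFm 2) (hrep : Represents lt prec) (hlt : ProvesTotalOrder S lt)
    (a b : ℕ) (hba : prec b a) :
    TheoremOf S lt a prec (theoremsTrue S lt a b) := by
  refine Provable.of_holds (in_theoremsTrue (L := langLsucc S prec a) S lt (.inr rfl) b) fun M hM r => ?_
  have hM : Models S lt prec a M := hM
  have := hM.paModel hS
  exact holds_theoremsTrue.2 fun x hx => (hM.th_isThm hrep hlt hba hx).2
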